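/- Let $\mathbb F$ be $\mathbb R$ or $\mathbb C$. An $m\times n\times 2$ tensor $(A;B)$ over $\mathbb F$ is a pair of $m\times n$ matrices (its slices). Its rank $\mathrm{rank}_{\mathbb F}(A;B)$ is the least $r$ such that it is a sum of $r$ tensors of the form $a\otimes b\otimes c$ with $a\in\mathbb F^m$, $b\in\mathbb F^n$, $c\in\mathbb F^2$, and $\mathrm{max.rank}_{\mathbb F}(m,n,2)$ is the largest rank of an $m\times n\times 2$ tensor over $\mathbb F$. Two tensors $(A;B)$ and $(A';B')$ are equivalent if $PAQ=A'$ and $PBQ=B'$ for some nonsingular matrices $P,Q$ over $\mathbb F$. $\mathrm{Diag}$ denotes the block-diagonal direct sum of tensors (taken slice by slice), $X^{\oplus k}$ the direct sum of $k\ge 0$ copies of $X$, $X^T$ the tensor obtained by transposing both slices, $E_k$ the $k\times k$ identity matrix, $J_k$ the $k\times k$ matrix with ones just above the diagonal and zeros elsewhere, and $C_1(c,s)=\begin{pmatrix}c&-s\\ s&c\end{pmatrix}$. Thus $((0,1);(1,0))$ is a $1\times2\times2$ tensor, $((\mathbf 0,E_2);(E_2,\mathbf 0))$ is a $2\times 3\times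 2$ tensor, and a summand written $\mathbf 0$ is the $0\times1\times2$ tensor, i.e. it appends a zero column to both slices. Corollary. Let $m\le n\le 2m$ and let $(A;B)$ be an $m\times n\times 2$ tensor over $\mathbb F$ with $\mathrm{rank}_{\mathbb F}(A;B)=\mathrm{max.rank}_{\mathbb F}(m,n,2)$. Then $$\mathrm{max.rank}_{\mathbb F}(m,n,2)=\min\left(n+\lfloor m/2\rfloor,\ m+\lfloor n/2\rfloor,\ 2m,\ 2n\right),$$ and there are integers $\alpha,\ell_E\ge0$ such that the following holds. If $n$ is even, then $(A;B)$ is equivalent to $\mathrm{Diag}(Y^{\oplus\alpha},((0,1);(1,0))^{\oplus\ell_E})$. If $n$ is odd, then $(A;B)$ is equivalent to one of the following tensors: (i) $\mathrm{Diag}(Y^{\oplus\alpha},((0,1);(1,0))^{\oplus\ell_E},\mathbf 0)$; (ii) $\mathrm{Diag}(Y^{\oplus\alpha},((0,1);(1,0))^{\oplus\ell_E},((0,1);(1,0))^T)$; (iii) $\mathrm{Diag}(Y^{\oplus\alpha},((0,1);(1,0))^{\oplus\ell_E},(x;1))$ with $x\in\mathbb F$; (iv) $\mathrm{Diag}(Y^{\oplus\alpha},((0,1);(1,0))^{\oplus\ell_E},(1;0))$;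 (v) $\mathrm{Diag}((xE_2+J_2;E_2)^{\oplus(\alpha-1)},(xE_3+J_3;E_3),((0,1);(1,0))^{\oplus\ell_E})$ with $x\in\mathbb F$ and $\alpha\ge1$; (vi) $\mathrm{Diag}((E_2;J_2)^{\oplus(\alpha-1)},(E_3;J_3),((0,1);(1,0))^{\oplus\ell_E})$ with $\alpha\ge1$; (vii) $\mathrm{Diag}(Y^{\oplus\alpha},((0,1);(1,0))^{\oplus(\ell_E-1)},((\mathbf 0,E_2);(E_2,\mathbf 0)))$ with $\ell_E\ge1$. Here $Y$ is one of the $2\times2\times2$ tensors $(yE_2+J_2;E_2)$ with $y\in\mathbb F$, $(E_2;J_2)$, or, only if $\mathbb F=\mathbb R$, $(C_1(c,s);E_2)$ with $c,s\in\mathbb R$ and $s\ne0$. -/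

import Mathlib

/-- Tensors with two slices over `K`: `T 0` and `T 1` are the two slices, which are matrices with
rows indexed by `ι` and columns indexed by `κ`. The tensor written `(A; B)` is `![A, B]`. -/
abbrev Tensor2 (K ι κ : Type*) : Type _ := Fin 2 → Matrix ι κ K

section Rank

variable {K ι κ : Type*} [Field K]

/-- `T` is a sum of `r` tensors of the form `a ⊗ b ⊗ c`. -/
def IsSumOfSimple (r : ℕ) (T : Tensor2 K ι κ) : Prop :=
  ∃ (a : Fin r → ι → K) (b : Fin r → κ → K) (c : Fin r → Fin 2 → K),
    ∀ s i j, T s i j = ∑ l, a l i * b l j * c l s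

/-- The rank of `T` over `K`: the least number of simple tensors with sum `T`. -/
noncomputable def tensorRank (T : Tensor2 K ι κ) : ℕ := sInf {r | IsSumOfSimple r T}

/-- Every tensor of finite format is a sum of simple tensors. -/
theorem isSumOfSimple_card [Fintype ι] [Fintype κ] (T : Tensor2 K ι κ) :
    IsSumOfSimple (Fintype.card (Fin 2 × ι × κ)) T := by
  classical
  let e := Fintype.equivFin (Fin 2 × ι × κ)
  refine ⟨fun l => Pi.single (e.symm l).2.1 1, fun l => Pi.single (e.symm l).2.2 1,
    fun l => Pi.single (e.symm l).1 (T (e.symm l).1 (e.symm l).2.1 (e.symm l).2.2), ?_⟩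
  intro s i j
  rw [Finset.sum_eq_single (e (s, i, j))]
  · simp
  · intro l _ hl
    by_cases h1 : s = (e.symm l).1
    · by_cases h2 : i = (e.symm l).2.1
      · by_cases h3 : j = (e.symm l).2.2
        · exact absurd (by rw [h1, h2, h3]; simp) hl
        · simp [Pi.single_apply, h3]
      · simp [Pi.single_apply, h2]
    · simp [Pi.single_apply, h1]
  · simp

/-- The infimum in the definition of the rank is attained. -/
theorem isSumOfSimple_tensorRank [Fintype ι] [Fintype κ] (T : Tensor2 K ι κ) :
    IsSumOfSimple (tensorRank T) T :=
  Nat.sInf_mem (s := {r | IsSumOfSimple r T}) ⟨_, isSumOfSimple_card T⟩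

variable (K) in
/-- The maximal rank of the `m × n × 2` tensors over `K`. -/
noncomputable def maxRank (m n : ℕ) : ℕ :=
  sSup (Set.range (tensorRank : Tensor2 K (Fin m) (Fin n) → ℕ))

variable (K) in
/-- The supremum in the definition of the maximal rank is a maximum. -/
theorem isGreatest_maxRank (m n : ℕ) :
    IsGreatest (Set.range (tensorRank : Tensor2 K (Fin m) (Fin n) → ℕ)) (maxRank K m n) := by
  have hb : BddAbove (Set.range (tensorRank : Tensor2 K (Fin m) (Fin n) → ℕ)) := by
    refine ⟨Fintype.card (Fin 2 × Fin m × Fin n), ?_⟩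
    rintro _ ⟨T, rfl⟩
    exact Nat.sInf_le (isSumOfSimple_card T)
  exact ⟨Nat.sSup_mem ⟨_, ⟨0, rfl⟩⟩ hb, fun _ h => le_csSup hb h⟩

end Rank

section Forms

variable {K ι κ ι' κ' : Type*}

/-- `T` and `T'` are equivalent if `P T Q = T'` for nonsingular `P` and `Q`; the index types of
`T'` are identified with those of `T` by bijections. -/
def TensorEquivalent [Field K] [Fintype ι] [DecidableEq ι] [Fintype κ] [DecidableEq κ]
    (T : Tensor2 K ι κ) (T' : Tensor2 K ι' κ') : Prop :=
  ∃ (e : ι' ≃ ι) (f : κ' ≃ κ) (P : GL ι K) (Q : GL κ K),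
    ∀ s, (P : Matrix ι ι K) * T s * (Q : Matrix κ κ K) = Matrix.reindex e f (T' s)

/-- The direct sum `Diag(T, T')`. -/
def dsum [Zero K] (T : Tensor2 K ι κ) (T' : Tensor2 K ι' κ') : Tensor2 K (ι ⊕ ι') (κ ⊕ κ') :=
  fun s => Matrix.fromBlocks (T s) 0 0 (T' s)

/-- The direct sum of `r` copies of `T`. -/
def copies [Zero K] (r : ℕ) (T : Tensor2 K ι κ) : Tensor2 K (ι × Fin r) (κ × Fin r) :=
  fun s => Matrix.blockDiagonal fun _ => T s

variable (K) in
/-- The `k × k` matrix with ones just above the diagonal and zeros elsewhere. -/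
def shiftJ [Zero K] [One K] (k : ℕ) : Matrix (Fin k) (Fin k) K :=
  Matrix.of fun i j => if (j : ℕ) = i + 1 then 1 else 0

/-- The tensor `(x E_k + J_k; E_k)`. -/
def blockB [Field K] (x : K) (k : ℕ) : Tensor2 K (Fin k) (Fin k) :=
  ![x • (1 : Matrix (Fin k) (Fin k) K) + shiftJ K k, 1]

variable (K) in
/-- The tensor `(E_k; J_k)`. -/
def blockD [Field K] (k : ℕ) : Tensor2 K (Fin k) (Fin k) :=
  ![1, shiftJ K k]

/-- The tensor `(C_1(c, s); E_2)`. -/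
def blockC [Field K] (c s : K) : Tensor2 K (Fin 2) (Fin 2) :=
  ![!![c, -s; s, c], 1]

variable (K) in
/-- The `k × (k + 1) × 2` tensor `((0, E_k); (E_k, 0))`. -/
def blockE [Field K] (k : ℕ) : Tensor2 K (Fin k) (Fin (k + 1)) :=
  ![Matrix.of fun i j => if j = i.succ then 1 else 0,
    Matrix.of fun i j => if j = i.castSucc then 1 else 0]

variable (K) in
/-- The `(k + 1) × k × 2` tensor obtained by transposing both slices of `((0, E_k); (E_k, 0))`. -/
def blockF [Field K] (k : ℕ) : Tensor2 K (Fin (k + 1)) (Fin k) :=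
  fun s => (blockE K k s).transpose

end Forms

/-- The admissible `2 × 2 × 2` blocks `Y`: `(x E_2 + J_2; E_2)`, `(E_2; J_2)`, and, only when the
ground field is the real one (the imaginary unit of `𝕜` is `0`), `(C_1(c, s); E_2)` with `s ≠ 0`. -/
def IsYBlock {𝕜 : Type*} [RCLike 𝕜] (Y : Tensor2 𝕜 (Fin 2) (Fin 2)) : Prop :=
  (∃ x : 𝕜, Y = blockB x 2) ∨ Y = blockD 𝕜 2 ∨
    ((RCLike.I : 𝕜) = 0 ∧ ∃ c s : 𝕜, s ≠ 0 ∧ Y = blockC c s)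

/-!
A tensor `(A; B)` is treated as a pair of linear maps `A B : V → W` with `dim V = n` and
`dim W = m`, up to isomorphisms of `V` and `W`. The proof bounds its rank by some `r` with
`2 * r ≤ 2 * m + n`, keeps track of the slack `e = 2 * m + n - 2 * r`, and shows that `e ≤ 1` leaves
only the listed forms (`RankDichotomy`).

*Reduction to a linear system.* The rank of the tensor does not change when `B` is replaced by
`B + t A`, so that `B` may be assumed to have the largest rank among the maps `B + s A`. Splitting
`V` and `W` along the kernel and the range of `B` gives states `X`, inputs `Q` and outputs `P` with
`B (x, u) = (x, 0)` and `A (x, u) = (M x + b u, c x + a u)`. A Schur complement in `B + s A` shows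
that maximality of the rank forces `a = 0` and `c Mⁱ b = 0` for all `i` (`markov_eq_zero`): the
reachable space `S`, generated by the range of `b` under `M`, lies in the kernel of `c`.

*Upper bound.* The simple tensors that pay for the inputs also pay for a feedback, that is, for a
change of `M` by a map with values in the range of `b`. By Heymann's lemma
(`exists_cyclic_feedback`), feedback makes `S` a cyclic space, on which the operator can be given any
distinct eigenvalues while a complement of `S` becomes invariant (`exists_isCompl_cyclic_diagonal`).
Hence `S` and the inputs cost `dim S + dim Q`. Outputs are inputs of the transposed tensor. What
remains is a regular pair `(M, id)`, which is a sum of cyclic ones; a cyclic pair of dimension `k`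
has rank at most `k + 1`, and rank `k` if its characteristic polynomial has distinct roots in the
field (`exists_regular_bound`). Summing up, `e` is at most one only if all summands are as small as
possible, with at most one exception (`rankDichotomy_of_finrank_range_le`). The only property of `ℝ`
and `ℂ` in this part is that they are infinite and that cubic polynomials have roots.

*Lower bound.* The substitution method gives the rank `m + n / 2` for an explicit tensor
(`le_of_isSumOfSimple_extremalTensor`). So a tensor of maximal rank has `e ≤ 1`, and `e` has the
parity of `n`.

*Return to `B`.* The passage from `(A; B + t A)` back to `(A; B)` is made block by block (`shear`).
It maps every block to a block of the same kind, except that the eigenvalue of a Jordan block may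
become infinite, which gives the blocks `(1; 0)`, `(E₂; J₂)` and `(E₃; J₃)`.
-/

section

open Module Polynomial

/-! ### Tensor rank of pairs of linear maps -/

section PencilRank

variable {K V W V' W' : Type*} [Field K] [AddCommGroup V] [Module K V] [AddCommGroup W]
  [Module K W] [AddCommGroup V'] [Module K V'] [AddCommGroup W'] [Module K W']

/-- The pair `(A, B)` of linear maps, seen as a tensor in `Hom(V, W) ⊗ K²`, is a sum of `r` simple
tensors. -/
def PencilRankLE (A B : V →ₗ[K] W) (r : ℕ) : Prop :=
  ∃ (w : Fin r → W) (f : Fin r → Module.Dual K V) (c d : Fin r → K),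
    (∀ v, A v = ∑ l, (c l * f l v) • w l) ∧ ∀ v, B v = ∑ l, (d l * f l v) • w l

theorem pencilRankLE_zero (r : ℕ) : PencilRankLE (0 : V →ₗ[K] W) 0 r :=
  ⟨0, 0, 0, 0, by simp, by simp⟩

theorem PencilRankLE.add {A B A' B' : V →ₗ[K] W} {r r' : ℕ} (h : PencilRankLE A B r)
    (h' : PencilRankLE A' B' r') : PencilRankLE (A + A') (B + B') (r + r') := by
  obtain ⟨w, f, c, d, hA, hB⟩ := h
  obtain ⟨w', f', c', d', hA', hB'⟩ := h'
  refine ⟨Fin.append w w', Fin.append f f', Fin.append c c', Fin.append d d', ?_, ?_⟩ <;>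
    intro v <;> simp [Fin.sum_univ_add, hA, hA', hB, hB']

theorem PencilRankLE.mono {A B : V →ₗ[K] W} {r r' : ℕ} (h : PencilRankLE A B r) (hr : r ≤ r') :
    PencilRankLE A B r' := by
  obtain ⟨s, rfl⟩ := Nat.exists_eq_add_of_le hr
  simpa using h.add (pencilRankLE_zero s)

/-- Composing with linear maps on both sides does not increase the rank. -/
theorem PencilRankLE.comp {A B : V →ₗ[K] W} {r : ℕ} (h : PencilRankLE A B r)
    (g : W →ₗ[K] W') (k : V' →ₗ[K] V) :
    PencilRankLE (g ∘ₗ A ∘ₗ k) (g ∘ₗ B ∘ₗ k) r := by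
  obtain ⟨w, f, c, d, hA, hB⟩ := h
  exact ⟨fun l => g (w l), fun l => (f l).comp k, c, d, by simp [hA], by simp [hB]⟩

theorem PencilRankLE.swap {A B : V →ₗ[K] W} {r : ℕ} (h : PencilRankLE A B r) :
    PencilRankLE B A r := by
  obtain ⟨w, f, c, d, hA, hB⟩ := h
  exact ⟨w, f, d, c, hB, hA⟩

/-- A pair whose second map vanishes has rank at most the rank of the first map. -/
theorem pencilRankLE_of_range_le {A : V →ₗ[K] W} (U : Submodule K W) [FiniteDimensional K U]
    (hA : ∀ v, A v ∈ U) : PencilRankLE A 0 (Module.finrank K U) := by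
  let b := Module.finBasis K U
  refine ⟨fun l => b l, fun l => b.coord l ∘ₗ A.codRestrict U hA, 1, 0, fun v => ?_, by simp⟩
  have := congrArg U.subtype (b.sum_repr (A.codRestrict U hA v))
  rw [map_sum] at this
  simpa using this.symm

/-- If `M` has a basis of eigenvectors, then `(M, id)` has rank at most the dimension. -/
theorem pencilRankLE_of_eigenbasis {r : ℕ} {M : V →ₗ[K] V} (b : Module.Basis (Fin r) K V)
    (a : Fin r → K) (h : ∀ i, M (b i) = a i • b i) : PencilRankLE M LinearMap.id r := by
  refine ⟨b, b.coord, a, 1, fun v => ?_, fun v => ?_⟩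
  · conv_lhs => rw [← b.sum_repr v, map_sum]
    simp [-Module.Basis.sum_repr, h, smul_smul, mul_comm]
  · simp

theorem PencilRankLE.prodMap {A B : V →ₗ[K] W} {A' B' : V' →ₗ[K] W'} {r r' : ℕ}
    (h : PencilRankLE A B r) (h' : PencilRankLE A' B' r') :
    PencilRankLE (A.prodMap A') (B.prodMap B') (r + r') := by
  have := (h.comp (LinearMap.inl K W W') (LinearMap.fst K V V')).add
    (h'.comp (LinearMap.inr K W W') (LinearMap.snd K V V'))
  convert this using 1 <;> ext <;> simp

/-- The rank does not change under transposition. -/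
theorem PencilRankLE.of_dualMap [FiniteDimensional K V] [FiniteDimensional K W]
    {A B : V →ₗ[K] W} {r : ℕ} (h : PencilRankLE A.dualMap B.dualMap r) : PencilRankLE A B r := by
  obtain ⟨w, f, c, d, hA, hB⟩ := h
  have key : ∀ (A : V →ₗ[K] W) (c : Fin r → K),
      (∀ g, A.dualMap g = ∑ l, (c l * f l g) • w l) →
      ∀ v, A v = ∑ l, (c l * w l v) • (Module.evalEquiv K W).symm (f l) := by
    intro A c hA v
    apply (Module.evalEquiv K W).injective
    ext g
    have := LinearMap.congr_fun (hA g) v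
    simp only [LinearMap.dualMap_apply, LinearMap.sum_apply, LinearMap.smul_apply,
      smul_eq_mul] at this
    rw [Module.evalEquiv_apply, Module.Dual.eval_apply, this, map_sum, LinearMap.sum_apply]
    refine Finset.sum_congr rfl fun (l : Fin r) _ => ?_
    have h2 : g ((Module.evalEquiv K W).symm (f l)) = f l g := by
      conv_rhs => rw [← (Module.evalEquiv K W).apply_symm_apply (f l)]
      rw [Module.evalEquiv_apply, Module.Dual.eval_apply]
    rw [map_smul, Module.evalEquiv_apply, LinearMap.smul_apply, Module.Dual.eval_apply, h2,
      smul_eq_mul]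
    ring
  exact ⟨_, w, c, d, key A c hA, key B d hB⟩

/-- `(A, B)` and `(A', B')` differ by isomorphisms of source and target. -/
def PencilIso (A B : V →ₗ[K] W) (A' B' : V' →ₗ[K] W') : Prop :=
  ∃ (e : V ≃ₗ[K] V') (f : W ≃ₗ[K] W'), (∀ v, f (A v) = A' (e v)) ∧ ∀ v, f (B v) = B' (e v)

theorem PencilRankLE.of_iso {A B : V →ₗ[K] W} {A' B' : V' →ₗ[K] W'} {r : ℕ}
    (h : PencilRankLE A' B' r) (hi : PencilIso A B A' B') : PencilRankLE A B r := by
  obtain ⟨e, f, hA, hB⟩ := hi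
  have := h.comp f.symm.toLinearMap e.toLinearMap
  convert this using 1
  · ext v; simp [← hA]
  · ext v; simp [← hB]

end PencilRank

/-! ### Cyclic subspaces and feedback -/

section Cyclic

variable {K X : Type*} [Field K] [AddCommGroup X] [Module K X]

theorem LinearIndependent.fin_snoc_of_notMem {k : ℕ} {v : ℕ → X}
    (hv : LinearIndependent K fun i : Fin k => v i)
    (h : v k ∉ Submodule.span K (Set.range fun i : Fin k => v i)) :
    LinearIndependent K fun i : Fin (k + 1) => v i := by
  have := linearIndependent_finSnoc.2 ⟨hv, h⟩
  convert this using 1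
  ext i
  refine Fin.lastCases ?_ (fun j => ?_) i <;> simp

theorem LinearIndependent.exists_dual_eq {ι : Type*} {v : ι → X} (hv : LinearIndependent K v)
    (c : ι → K) : ∃ ψ : Dual K X, ∀ i, ψ (v i) = c i := by
  obtain ⟨ψ, hψ⟩ := LinearMap.exists_extend ((Basis.span hv).constr K c)
  refine ⟨ψ, fun i => ?_⟩
  have := LinearMap.congr_fun hψ (Basis.span hv i)
  rw [Basis.constr_basis] at this
  simpa [Basis.span_apply] using this

/-- A form of Heymann's lemma: after a feedback `N - M` with values in `U`, a single vector `u` of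
`U` generates a cyclic `N`-invariant subspace containing `U`. The feedback is chosen such that the
chain `u, N u, N² u, …` is linearly independent for as long as possible. -/
theorem exists_cyclic_feedback [FiniteDimensional K X] (M : End K X) (U : Submodule K X) :
    ∃ (N : End K X) (u : X) (k : ℕ), (∀ x, N x - M x ∈ U) ∧ u ∈ U ∧
      (LinearIndependent K fun i : Fin k => (N ^ (i : ℕ)) u) ∧
      U ≤ Submodule.span K (Set.range fun i : Fin k => (N ^ (i : ℕ)) u) ∧
      (N ^ k) u ∈ Submodule.span K (Set.range fun i : Fin k => (N ^ (i : ℕ)) u) := by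
  classical
  by_cases hU : U = ⊥
  · subst hU
    exact ⟨M, 0, 0, by simp, by simp, linearIndependent_empty_type, by simp, by simp⟩
  obtain ⟨u, huU, hu⟩ := Submodule.exists_mem_ne_zero_of_ne_bot hU
  let P : ℕ → Prop := fun k => ∃ N : End K X, (∀ x, N x - M x ∈ U) ∧
    LinearIndependent K fun i : Fin k => (N ^ (i : ℕ)) u
  have hb : ∀ k, P k → k ≤ finrank K X := by
    rintro k ⟨N, -, h⟩
    simpa using h.fintype_card_le_finrank
  have h1 : P 1 := ⟨M, by simp, by simpa using hu⟩
  have hP : P (Nat.findGreatest P (finrank K X)) := Nat.findGreatest_spec (hb 1 h1) h1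
  have hmax : ¬ P (Nat.findGreatest P (finrank K X) + 1) := fun h =>
    absurd (Nat.le_findGreatest (hb _ h) h) (by omega)
  have hpos : 1 ≤ Nat.findGreatest P (finrank K X) := Nat.le_findGreatest (hb 1 h1) h1
  generalize Nat.findGreatest P (finrank K X) = k at hP hmax hpos
  obtain ⟨N, hN, hli⟩ := hP
  -- By maximality, the next vector of the chain stays in the span for every choice of feedback.
  have key : ∀ y ∈ U,
      (N ^ k) u + y ∈ Submodule.span K (Set.range fun i : Fin k => (N ^ (i : ℕ)) u) := by
    intro y hy
    by_contra hcon
    apply hmax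
    -- A feedback along `y` that acts on the last vector of the chain only.
    let e : Fin k := ⟨k - 1, by omega⟩
    obtain ⟨ψ, hψ'⟩ := hli.exists_dual_eq fun i : Fin k => if i = e then (1 : K) else 0
    let N' : End K X := N + ψ.smulRight y
    have hpow : ∀ i, i < k → (N' ^ i) u = (N ^ i) u := by
      intro i
      induction i with
      | zero => simp
      | succ i ih =>
        intro hi
        rw [pow_succ', Module.End.mul_apply, ih (by omega), pow_succ', Module.End.mul_apply]
        have := hψ' ⟨i, by omega⟩
        rw [if_neg (by simp [e, Fin.ext_iff]; omega)] at this
        simp only at this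
        simp [N', this]
    have hpowk : (N' ^ k) u = (N ^ k) u + y := by
      obtain ⟨j, rfl⟩ : ∃ j, k = j + 1 := ⟨k - 1, by omega⟩
      rw [pow_succ', Module.End.mul_apply, hpow j (by omega), pow_succ', Module.End.mul_apply]
      have := hψ' ⟨j, by omega⟩
      rw [if_pos (by simp [e])] at this
      simp only at this
      simp [N', this]
    refine ⟨N', fun x => ?_, ?_⟩
    · have : N' x - M x = (N x - M x) + ψ x • y := by simp [N']; abel
      rw [this]
      exact U.add_mem (hN x) (U.smul_mem _ hy)
    · have hfun : (fun i : Fin k => (N' ^ (i : ℕ)) u) = fun i : Fin k => (N ^ (i : ℕ)) u :=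
        funext fun i => hpow i i.2
      apply LinearIndependent.fin_snoc_of_notMem (v := fun i => (N' ^ i) u)
      · simpa only [hfun] using hli
      · simp only [hfun, hpowk]
        exact hcon
  have hk := key 0 U.zero_mem
  rw [add_zero] at hk
  refine ⟨N, u, k, hN, huU, hli, fun y hy => ?_, hk⟩
  simpa using Submodule.sub_mem _ (key y hy) hk

/-- Splitting off a cyclic subspace `C = ⟨u, N u, …, N ^ (k - 1) u⟩`: a rank one change of `N` along
`u` gives an operator `N'` that leaves `C` and a complement of it invariant, and whose
characteristic polynomial on `C` is any prescribed monic polynomial `p` of degree `k`. No change is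
necessary when `p(N) = 0`. The functional `φ` reads off the last coordinate on `C`, and the
complement is the intersection of the kernels of the `φ ∘ N' ^ i`. -/
theorem exists_isCompl_cyclic [FiniteDimensional K X] (N : End K X) (u : X) {k : ℕ}
    (hli : LinearIndependent K fun i : Fin k => (N ^ (i : ℕ)) u)
    (hk : (N ^ k) u ∈ Submodule.span K (Set.range fun i : Fin k => (N ^ (i : ℕ)) u))
    (p : K[X]) (hp : p.Monic) (hpk : p.natDegree = k) :
    ∃ (N' : End K X) (W : Submodule K X) (φ : Dual K X),
      (∀ x, N' x - N x ∈ Submodule.span K {u}) ∧ (aeval N p = 0 → N' = N) ∧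
      IsCompl (Submodule.span K (Set.range fun i : Fin k => (N ^ (i : ℕ)) u)) W ∧
      (∀ x ∈ Submodule.span K (Set.range fun i : Fin k => (N ^ (i : ℕ)) u),
        N' x ∈ Submodule.span K (Set.range fun i : Fin k => (N ^ (i : ℕ)) u)) ∧
      (∀ x ∈ W, N' x ∈ W) ∧
      (∀ x ∈ Submodule.span K (Set.range fun i : Fin k => (N ^ (i : ℕ)) u), aeval N' p x = 0) ∧
      ∀ g : K[X], g.Monic → g.natDegree + 1 = k → φ (aeval N' g u) = 1 := by
  obtain _ | j := k
  · have hp1 : p = 1 := hp.natDegree_eq_zero.1 hpk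
    refine ⟨N, ⊤, 0, by simp, by simp, ?_, ?_, by simp, ?_, by simp⟩
    · simpa using isCompl_bot_top
    · simp
    · simp
  set C := Submodule.span K (Set.range fun i : Fin (j + 1) => (N ^ (i : ℕ)) u) with hC
  obtain ⟨φ, hφ⟩ := hli.exists_dual_eq fun i : Fin (j + 1) => if (i : ℕ) = j then (1 : K) else 0
  replace hφ : ∀ i ≤ j, φ ((N ^ i) u) = if i = j then 1 else 0 := fun i hi => hφ ⟨i, by omega⟩
  -- With this correction, `φ ∘ p(N') = 0`.
  set ψ : Dual K X := -(φ ∘ₗ aeval N p) with hψ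
  set N' : End K X := N + ψ.smulRight u with hN'
  have hN'x : ∀ x, N' x = N x + ψ x • u := fun x => by simp [hN']
  have hle : ∀ i ≤ j, ∀ x, φ ((N' ^ i) x) = φ ((N ^ i) x) := by
    intro i
    induction i with
    | zero => simp
    | succ i ih =>
      intro hi x
      rw [pow_succ, End.mul_apply, ih (by omega), hN'x, map_add, map_smul, map_add, map_smul,
        hφ i (by omega), if_neg (by omega), smul_zero, add_zero, pow_succ, End.mul_apply]
  have hsucc : ∀ x, φ ((N' ^ (j + 1)) x) = φ ((N ^ (j + 1)) x) + ψ x := by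
    intro x
    rw [pow_succ, End.mul_apply, hle j le_rfl, hN'x, map_add, map_smul, map_add, map_smul,
      hφ j le_rfl, if_pos rfl, pow_succ, End.mul_apply, smul_eq_mul, mul_one]
  have hlead : p.coeff (j + 1) = 1 := by rw [← hpk]; exact hp
  have hsum : ∀ (L : End K X) x, φ (aeval L p x) =
      ∑ i ∈ Finset.range (j + 1), p.coeff i * φ ((L ^ i) x) + φ ((L ^ (j + 1)) x) := by
    intro L x
    rw [aeval_eq_sum_range, hpk, Finset.sum_range_succ, hlead]
    simp
  have hpz : ∀ x, φ (aeval N' p x) = 0 := by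
    intro x
    have h1 := hsum N x
    have h2 : ψ x = - φ (aeval N p x) := by simp [hψ]
    rw [hsum, hsucc, h2, h1, Finset.sum_congr rfl fun i hi => by
      rw [hle i (by simp at hi; omega)]]
    ring
  let F : X →ₗ[K] (Fin (j + 1) → K) := LinearMap.pi fun i => φ ∘ₗ (N' ^ (i : ℕ))
  have hF : ∀ x i, F x i = φ ((N' ^ (i : ℕ)) x) := fun x i => rfl
  have hW : ∀ x, x ∈ LinearMap.ker F ↔ ∀ i ≤ j, φ ((N' ^ i) x) = 0 := by
    intro x
    rw [LinearMap.mem_ker, funext_iff]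
    exact ⟨fun h i hi => h ⟨i, by omega⟩, fun h i => h i (by omega)⟩
  have hmem : ∀ i ≤ j, (N ^ i) u ∈ C := fun i hi => Submodule.subset_span ⟨⟨i, by omega⟩, rfl⟩
  have hNC : ∀ x ∈ C, N x ∈ C := by
    intro x hx
    have : C ≤ C.comap N := by
      rw [hC, Submodule.span_le, ← hC]
      rintro _ ⟨i, rfl⟩
      change N ((N ^ (i : ℕ)) u) ∈ C
      rw [← End.mul_apply, ← pow_succ']
      rcases Nat.lt_or_ge i j with h | h
      · exact hmem _ h
      · rw [show (i : ℕ) = j by omega]; exact hk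
    exact this hx
  have hN'C : ∀ x ∈ C, N' x ∈ C := fun x hx => by
    rw [hN'x]
    exact C.add_mem (hNC x hx) (C.smul_mem _ (by simpa using hmem 0 (Nat.zero_le _)))
  have hdisj : ∀ x ∈ C, x ∈ LinearMap.ker F → x = 0 := by
    intro x hx hxF
    rw [hW] at hxF
    obtain ⟨c, rfl⟩ := (Submodule.mem_span_range_iff_exists_fun K).1 hx
    -- The coefficients of `x` vanish one after the other, from the last to the first.
    have hc : ∀ t, ∀ i : Fin (j + 1), j + 1 ≤ i + t → c i = 0 := by
      intro t
      induction t with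
      | zero => intro i hi; omega
      | succ t ih =>
        intro i hi
        by_cases h : j + 1 ≤ i + t
        · exact ih i h
        have h0 := hxF (j - i) (by omega)
        rw [hle _ (by omega), map_sum, map_sum, Finset.sum_eq_single i] at h0
        · rw [map_smul, map_smul, ← End.mul_apply, ← pow_add, hφ _ (by omega),
            if_pos (by omega)] at h0
          simpa using h0
        · intro l _ hl
          rcases lt_or_gt_of_ne hl with h' | h'
          · rw [map_smul, map_smul, ← End.mul_apply, ← pow_add, hφ _ (by omega),
              if_neg (by omega), smul_zero]
          · rw [ih l (by omega), zero_smul, map_zero, map_zero]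
        · simp
    exact Finset.sum_eq_zero fun i _ => by rw [hc (j + 1) i (by omega), zero_smul]
  have hcompl : IsCompl C (LinearMap.ker F) := by
    have hinj : Function.Injective (F ∘ₗ C.subtype) := by
      rw [← LinearMap.ker_eq_bot, LinearMap.ker_eq_bot']
      intro x hx
      exact Subtype.ext (hdisj x x.2 hx)
    have hsurj : Function.Surjective (F ∘ₗ C.subtype) := by
      rw [← LinearMap.injective_iff_surjective_of_finrank_eq_finrank]
      · exact hinj
      · rw [finrank_span_eq_card hli]; simp
    refine ⟨disjoint_iff_inf_le.2 fun x hx => hdisj x hx.1 hx.2, codisjoint_iff_le_sup.2 ?_⟩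
    intro x _
    obtain ⟨y, hy⟩ := hsurj (F x)
    refine Submodule.mem_sup.2 ⟨y, y.2, x - y, ?_, by simp⟩
    rw [LinearMap.mem_ker, map_sub, ← hy]
    simp
  refine ⟨N', LinearMap.ker F, φ, fun x => ?_, fun h => ?_, hcompl, hN'C, fun x hx => ?_,
    fun x hx => ?_, fun g hg hgj => ?_⟩
  · rw [hN'x, add_sub_cancel_left]
    exact Submodule.smul_mem _ _ (Submodule.mem_span_singleton_self u)
  · rw [hN', hψ, h]; ext; simp
  · rw [hW] at hx ⊢
    intro i hi
    rw [← End.mul_apply, ← pow_succ]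
    rcases Nat.lt_or_ge i j with h | h
    · exact hx _ h
    · obtain rfl : i = j := le_antisymm hi h
      have := hsum N' x
      rw [hpz, Finset.sum_eq_zero, zero_add] at this
      · exact this.symm
      · intro l hl
        rw [hx l (by simp at hl; omega), mul_zero]
  · refine hdisj _ ?_ ?_
    · rw [aeval_eq_sum_range, LinearMap.sum_apply]
      refine Submodule.sum_mem _ fun i hi => Submodule.smul_mem _ _ ?_
      clear hi
      induction i with
      | zero => simpa using hx
      | succ i ih => rw [pow_succ', End.mul_apply]; exact hN'C _ ih
    · rw [hW]
      intro i _
      have hcomm : (N' ^ i) (aeval N' p x) = aeval N' p ((N' ^ i) x) := by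
        rw [← End.mul_apply, ← End.mul_apply]
        congr 1
        simpa using (Polynomial.aeval_mul (x := N') (p := Polynomial.X ^ i) (q := p)).symm.trans
          ((congrArg (aeval N') (mul_comm (Polynomial.X ^ i) p)).trans
            (Polynomial.aeval_mul (x := N')))
      rw [hcomm, hpz]
  · have hg1 : g.natDegree = j := by omega
    rw [aeval_eq_sum_range, LinearMap.sum_apply, map_sum, hg1, Finset.sum_range_succ,
      Finset.sum_eq_zero, zero_add]
    · rw [LinearMap.smul_apply, map_smul, hle j le_rfl, hφ j le_rfl, if_pos rfl, ← hg1]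
      simpa [Monic.def] using hg
    · intro i hi
      have : i < j := by simpa using hi
      rw [LinearMap.smul_apply, map_smul, hle i this.le, hφ i this.le, if_neg this.ne, smul_zero]

/-- With feedback through the generator, a cyclic subspace splits off and the operator becomes
diagonalizable on it, with any prescribed distinct eigenvalues `a i`. -/
theorem exists_isCompl_cyclic_diagonal [FiniteDimensional K X] (N : End K X) (u : X) {k : ℕ}
    (hli : LinearIndependent K fun i : Fin k => (N ^ (i : ℕ)) u)
    (hk : (N ^ k) u ∈ Submodule.span K (Set.range fun i : Fin k => (N ^ (i : ℕ)) u))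
    (a : Fin k → K) (ha : Function.Injective a) {S : Submodule K X}
    (hS : S = Submodule.span K (Set.range fun i : Fin k => (N ^ (i : ℕ)) u)) :
    ∃ (N' : End K X) (W : Submodule K X),
      (∀ x, N' x - N x ∈ Submodule.span K {u}) ∧
      (aeval N (∏ i, (Polynomial.X - C (a i))) = 0 → N' = N) ∧
      IsCompl S W ∧ (∀ x ∈ W, N' x ∈ W) ∧ ∃ hC : ∀ x ∈ S, N' x ∈ S,
      PencilRankLE (N'.restrict hC) LinearMap.id k := by
  classical
  obtain ⟨N', W, φ, h1, h2, h3, h4, h5, h6, h7⟩ := exists_isCompl_cyclic N u hli hk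
    (∏ i, (Polynomial.X - C (a i))) (monic_prod_X_sub_C a Finset.univ) (by simp)
  rw [← hS] at hk h3 h4 h6
  refine ⟨N', W, h1, h2, h3, h5, h4, ?_⟩
  have hu : 0 < k → u ∈ S := fun hk0 => by
    rw [hS]
    simpa using Submodule.subset_span (R := K) (s := Set.range fun i : Fin k => (N ^ (i : ℕ)) u)
      ⟨⟨0, hk0⟩, rfl⟩
  have hmem : ∀ (g : K[X]) x, x ∈ S → aeval N' g x ∈ S := by
    intro g x hx
    rw [aeval_eq_sum_range, LinearMap.sum_apply]
    refine Submodule.sum_mem _ fun i hi => Submodule.smul_mem _ _ ?_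
    clear hi
    induction i with
    | zero => simpa using hx
    | succ i ih => rw [pow_succ', End.mul_apply]; exact h4 _ ih
  -- The vector `∏_{j ≠ i} (N' - a j) u` is an eigenvector for `a i`.
  let q : Fin k → K[X] := fun i => ∏ j ∈ Finset.univ.erase i, (Polynomial.X - C (a j))
  let v : Fin k → S := fun i => ⟨aeval N' (q i) u, hmem _ _ (hu i.pos)⟩
  have hv : ∀ i, End.HasEigenvector (N'.restrict h4) (a i) (v i) := by
    intro i
    refine ⟨?_, fun h0 => ?_⟩
    · rw [End.mem_eigenspace_iff]
      apply Subtype.ext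
      have h := h6 u (hu i.pos)
      rw [← Finset.mul_prod_erase _ _ (Finset.mem_univ i), map_mul, End.mul_apply] at h
      simpa [v, q, sub_eq_zero, LinearMap.restrict_apply] using h
    · have h := h7 (q i) (monic_prod_X_sub_C a _) (by simp [q]; have := i.pos; omega)
      rw [show aeval N' (q i) u = 0 from congrArg Subtype.val h0, map_zero] at h
      exact zero_ne_one h
  have hvli := End.eigenvectors_linearIndependent' (N'.restrict h4) a ha v hv
  have hcard : Fintype.card (Fin k) = finrank K S := by
    rw [hS, finrank_span_eq_card hli]
  let b : Basis (Fin k) K S := basisOfLinearIndependentOfCardEqFinrank' v hvli hcard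
  refine pencilRankLE_of_eigenbasis b a fun i => ?_
  have := (hv i).apply_eq_smul
  simpa [b] using this

end Cyclic

/-! ### Reachable subspaces and linear systems -/

section Systems

variable {K X Q P : Type*} [Field K] [AddCommGroup X] [Module K X] [AddCommGroup Q] [Module K Q]
  [AddCommGroup P] [Module K P]

/-- Splitting off the reachable subspace `S`, the least `M`-invariant subspace containing `U`: up
to feedback through `U`, it has an invariant complement and the operator is diagonalizable on
it. -/
theorem exists_isCompl_reachable [Infinite K] [FiniteDimensional K X] (M : End K X)
    (U : Submodule K X) :
    ∃ (N : End K X) (S W : Submodule K X), (∀ x, N x - M x ∈ U) ∧ U ≤ S ∧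
      (∀ Z : Submodule K X, U ≤ Z → (∀ x ∈ Z, M x ∈ Z) → S ≤ Z) ∧ (∀ x ∈ S, M x ∈ S) ∧
      IsCompl S W ∧ (∀ x ∈ W, N x ∈ W) ∧
      ∃ hS : ∀ x ∈ S, N x ∈ S, PencilRankLE (N.restrict hS) LinearMap.id (finrank K S) := by
  obtain ⟨N₀, u, k, hN₀, hu, hli, hU, hk⟩ := exists_cyclic_feedback M U
  let a : Fin k ↪ K := Fin.valEmbedding.trans (Infinite.natEmbedding K)
  obtain ⟨S, hS⟩ : ∃ S, S = Submodule.span K (Set.range fun i : Fin k => (N₀ ^ (i : ℕ)) u) :=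
    ⟨_, rfl⟩
  obtain ⟨N, W, hN, -, hc, hW, hSN, hr⟩ :=
    exists_isCompl_cyclic_diagonal N₀ u hli hk a a.injective hS
  have hNM : ∀ x, N x - M x ∈ U := fun x => by
    have h1 := Submodule.span_le.2 (Set.singleton_subset_iff.2 hu) (hN x)
    simpa using U.add_mem h1 (hN₀ x)
  rw [← hS] at hU
  refine ⟨N, S, W, hNM, hU, fun Z hUZ hMZ => ?_, fun x hx => ?_, hc, hW, hSN, ?_⟩
  · have hZ : ∀ i, (N₀ ^ i) u ∈ Z := by
      intro i
      induction i with
      | zero => simpa using hUZ hu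
      | succ i ih =>
        rw [pow_succ', End.mul_apply]
        simpa using Z.add_mem (hUZ (hN₀ ((N₀ ^ i) u))) (hMZ _ ih)
    rw [hS, Submodule.span_le]
    rintro _ ⟨i, rfl⟩
    exact hZ i
  · simpa using S.sub_mem (hSN x hx) (hU (hNM x))
  · have : finrank K S = k := by rw [hS, finrank_span_eq_card hli, Fintype.card_fin]
    rwa [this]

/-- The first map `(x, u) ↦ (M x + b u, c x)` of the pair attached to a linear system with
states `X`, inputs `Q` and outputs `P`. -/
def sysA (M : X →ₗ[K] X) (b : Q →ₗ[K] X) (c : X →ₗ[K] P) : X × Q →ₗ[K] X × P :=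
  (M.coprod b).prod (c ∘ₗ LinearMap.fst K X Q)

variable (K X Q P) in
/-- The second map `(x, u) ↦ (x, 0)` of the pair attached to a linear system. -/
def sysB : X × Q →ₗ[K] X × P := LinearMap.inl K X P ∘ₗ LinearMap.fst K X Q

@[simp]
theorem sysA_apply (M : X →ₗ[K] X) (b : Q →ₗ[K] X) (c : X →ₗ[K] P) (v : X × Q) :
    sysA M b c v = (M v.1 + b v.2, c v.1) := rfl

@[simp]
theorem sysB_apply (v : X × Q) : sysB K X Q P v = (v.1, 0) := rfl

/-- Rank bound for a system: `N` differs from `M` by feedback, the state space is the direct sum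
of `N`-invariant subspaces `S` and `W`, and there is no output on `S`. -/
theorem pencilRankLE_sys [FiniteDimensional K X] {M N : X →ₗ[K] X} {b : Q →ₗ[K] X}
    {c : X →ₗ[K] P} {S W : Submodule K X} (hN : ∀ x, N x - M x ∈ LinearMap.range b)
    (hcompl : IsCompl S W) (hc : ∀ x ∈ S, c x = 0) (hS : ∀ x ∈ S, N x ∈ S)
    (hW : ∀ x ∈ W, N x ∈ W) {s r : ℕ} (hs : PencilRankLE (N.restrict hS) LinearMap.id s)
    (hr : PencilRankLE ((N.restrict hW).prod (c ∘ₗ W.subtype)) (LinearMap.inl K W P) r) :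
    PencilRankLE (sysA M b c) (sysB K X Q P) (finrank K (LinearMap.range b) + (s + r)) := by
  let e := (Submodule.prodEquivOfIsCompl S W hcompl).symm
  have he : ∀ x, ((e x).1 : X) + (e x).2 = x := fun x =>
    (Submodule.prodEquivOfIsCompl S W hcompl).apply_symm_apply x
  -- The feedback `M - N` and the inputs together have values in `range b`, so that they cost no
  -- more than `finrank (range b)` simple tensors.
  let D : X × Q →ₗ[K] X := (M - N).coprod b
  have hD : ∀ v, D v ∈ LinearMap.range b := fun v => by
    have h1 : D v = -(N v.1 - M v.1) + b v.2 := by simp [D]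
    rw [h1]
    exact Submodule.add_mem _ (Submodule.neg_mem _ (hN v.1)) ⟨v.2, rfl⟩
  have h0 := (pencilRankLE_of_range_le _ hD).comp (LinearMap.inl K X P) LinearMap.id
  have h1 := hs.comp (LinearMap.inl K X P ∘ₗ S.subtype)
    (LinearMap.fst K S W ∘ₗ e.toLinearMap ∘ₗ LinearMap.fst K X Q)
  have h2 := hr.comp (W.subtype.prodMap LinearMap.id)
    (LinearMap.snd K S W ∘ₗ e.toLinearMap ∘ₗ LinearMap.fst K X Q)
  have h := h0.add (h1.add h2)
  convert h using 1
  · refine LinearMap.ext fun v => Prod.ext ?_ ?_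
    · have h3 : N (e v.1).1 + N (e v.1).2 = N v.1 := by rw [← map_add, he]
      change M v.1 + b v.2 = (M v.1 - N v.1 + b v.2) + (N (e v.1).1 + N (e v.1).2)
      rw [h3]
      abel
    · have h3 : c v.1 = c (e v.1).2 := by
        conv_lhs => rw [← he v.1]
        rw [map_add, hc _ (e v.1).1.2, zero_add]
      simp [h3]
  · refine LinearMap.ext fun v => Prod.ext ?_ ?_
    · simp [he]
    · simp

end Systems

/-! ### Equivalence of pairs and of tensors -/

section Iso

variable {K V W V' W' V'' W'' V₁ W₁ V₂ W₂ : Type*} [Field K]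
  [AddCommGroup V] [Module K V] [AddCommGroup W] [Module K W]
  [AddCommGroup V'] [Module K V'] [AddCommGroup W'] [Module K W']
  [AddCommGroup V''] [Module K V''] [AddCommGroup W''] [Module K W'']
  [AddCommGroup V₁] [Module K V₁] [AddCommGroup W₁] [Module K W₁]
  [AddCommGroup V₂] [Module K V₂] [AddCommGroup W₂] [Module K W₂]

theorem PencilIso.refl (A B : V →ₗ[K] W) : PencilIso A B A B :=
  ⟨LinearEquiv.refl K V, LinearEquiv.refl K W, fun _ => rfl, fun _ => rfl⟩

theorem PencilIso.symm {A B : V →ₗ[K] W} {A' B' : V' →ₗ[K] W'} (h : PencilIso A B A' B') :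
    PencilIso A' B' A B := by
  obtain ⟨e, f, hA, hB⟩ := h
  refine ⟨e.symm, f.symm, fun v => ?_, fun v => ?_⟩
  · rw [LinearEquiv.symm_apply_eq, hA, e.apply_symm_apply]
  · rw [LinearEquiv.symm_apply_eq, hB, e.apply_symm_apply]

theorem PencilIso.trans {A B : V →ₗ[K] W} {A' B' : V' →ₗ[K] W'} {A'' B'' : V'' →ₗ[K] W''}
    (h : PencilIso A B A' B') (h' : PencilIso A' B' A'' B'') : PencilIso A B A'' B'' := by
  obtain ⟨e, f, hA, hB⟩ := h
  obtain ⟨e', f', hA', hB'⟩ := h'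
  exact ⟨e.trans e', f.trans f', fun v => by simp [hA, hA'], fun v => by simp [hB, hB']⟩

theorem PencilIso.prodMap {A B : V →ₗ[K] W} {A' B' : V' →ₗ[K] W'} {A₁ B₁ : V₁ →ₗ[K] W₁}
    {A₂ B₂ : V₂ →ₗ[K] W₂} (h : PencilIso A B A₁ B₁) (h' : PencilIso A' B' A₂ B₂) :
    PencilIso (A.prodMap A') (B.prodMap B') (A₁.prodMap A₂) (B₁.prodMap B₂) := by
  obtain ⟨e, f, hA, hB⟩ := h
  obtain ⟨e', f', hA', hB'⟩ := h'
  exact ⟨e.prodCongr e', f.prodCongr f', fun v => by simp [hA, hA'], fun v => by simp [hB, hB']⟩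

theorem PencilIso.shear {A B : V →ₗ[K] W} {A' B' : V' →ₗ[K] W'} (h : PencilIso A B A' B')
    (t : K) : PencilIso A (B - t • A) A' (B' - t • A') := by
  obtain ⟨e, f, hA, hB⟩ := h
  exact ⟨e, f, hA, fun v => by simp [hA, hB]⟩

theorem pencilIso_prodComm (A B : V →ₗ[K] W) (A' B' : V' →ₗ[K] W') :
    PencilIso (A.prodMap A') (B.prodMap B') (A'.prodMap A) (B'.prodMap B) :=
  ⟨LinearEquiv.prodComm K V V', LinearEquiv.prodComm K W W', fun _ => rfl, fun _ => rfl⟩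

end Iso

section Shear

variable {K ι κ ι' κ' : Type*} [Field K]

/-- The tensor `(S 0; S 1 - t S 0)`. -/
def shear (t : K) (S : Tensor2 K ι κ) : Tensor2 K ι κ := ![S 0, S 1 - t • S 0]

theorem shear_dsum (t : K) (S : Tensor2 K ι κ) (S' : Tensor2 K ι' κ') :
    shear t (dsum S S') = dsum (shear t S) (shear t S') := by
  ext s i j
  fin_cases s <;> rcases i with i | i <;> rcases j with j | j <;> simp [shear, dsum]

theorem shear_copies (t : K) (a : ℕ) (S : Tensor2 K ι κ) :
    shear t (copies a S) = copies a (shear t S) := by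
  ext s ⟨i, k⟩ ⟨j, l⟩
  fin_cases s <;> by_cases h : k = l <;> simp [shear, copies, Matrix.blockDiagonal_apply, h]

end Shear

section PencilRep

variable {K V W V' W' ι κ ι' κ' ι'' κ'' ι₁ κ₁ ι₂ κ₂ : Type*} [Field K]
  [AddCommGroup V] [Module K V] [AddCommGroup W] [Module K W]
  [AddCommGroup V'] [Module K V'] [AddCommGroup W'] [Module K W']
  [Fintype κ] [Fintype κ'] [Fintype κ''] [Fintype κ₁] [Fintype κ₂]

/-- In suitable bases the pair `(A, B)` has the tensor `S` as coordinates. -/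
def PencilRep (A B : V →ₗ[K] W) (S : Tensor2 K ι κ) : Prop :=
  PencilIso A B (S 0).mulVecLin (S 1).mulVecLin

/-- Equivalence of tensors as pairs of linear maps. In contrast to `TensorEquivalent`, no bijections
between the index sets are chosen. -/
def TensorIso (S : Tensor2 K ι κ) (S' : Tensor2 K ι' κ') : Prop :=
  PencilRep (S 0).mulVecLin (S 1).mulVecLin S'

theorem TensorIso.refl (S : Tensor2 K ι κ) : TensorIso S S := PencilIso.refl _ _

theorem TensorIso.symm {S : Tensor2 K ι κ} {S' : Tensor2 K ι' κ'} (h : TensorIso S S') :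
    TensorIso S' S :=
  PencilIso.symm h

theorem TensorIso.trans {S : Tensor2 K ι κ} {S' : Tensor2 K ι' κ'} {S'' : Tensor2 K ι'' κ''}
    (h : TensorIso S S') (h' : TensorIso S' S'') : TensorIso S S'' := PencilIso.trans h h'

theorem PencilRep.trans {A B : V →ₗ[K] W} {S : Tensor2 K ι κ} {S' : Tensor2 K ι' κ'}
    (h : PencilRep A B S) (h' : TensorIso S S') : PencilRep A B S' := PencilIso.trans h h'

theorem PencilRep.of_basis [Fintype ι] {A B : V →ₗ[K] W} {S : Tensor2 K ι κ} (v : Basis κ K V)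
    (w : Basis ι K W) (hA : ∀ j, A (v j) = ∑ i, S 0 i j • w i)
    (hB : ∀ j, B (v j) = ∑ i, S 1 i j • w i) : PencilRep A B S := by
  classical
  have key : ∀ (A : V →ₗ[K] W) (T : Matrix ι κ K), (∀ j, A (v j) = ∑ i, T i j • w i) →
      ∀ x, w.equivFun (A x) = T.mulVecLin (v.equivFun x) := by
    intro A T h x
    have : w.equivFun.toLinearMap ∘ₗ A = T.mulVecLin ∘ₗ v.equivFun.toLinearMap := by
      refine v.ext fun j => ?_
      ext i
      simp [h, Finsupp.single_apply, Matrix.mulVec, dotProduct]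
    exact LinearMap.congr_fun this x
  exact ⟨v.equivFun, w.equivFun, key A _ hA, key B _ hB⟩

theorem TensorIso.of_equiv [Fintype ι] [Fintype ι'] {S : Tensor2 K ι κ} {S' : Tensor2 K ι' κ'}
    (e : ι ≃ ι') (f : κ ≃ κ')
    (h : ∀ s i j, S' s (e i) (f j) = S s i j) : TensorIso S S' := by
  refine ⟨LinearEquiv.funCongrLeft K K f.symm, LinearEquiv.funCongrLeft K K e.symm, ?_, ?_⟩ <;>
  · intro v
    ext i
    obtain ⟨i, rfl⟩ := e.surjective i
    simp [LinearMap.funLeft, Matrix.mulVec, dotProduct, ← h, ← f.sum_comp]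

/-- Equivalence from matrices with two-sided inverses. -/
theorem TensorIso.of_matrix [Fintype ι] [DecidableEq ι] [DecidableEq κ] {S S' : Tensor2 K ι κ}
    (P P' : Matrix ι ι K) (Q Q' : Matrix κ κ K) (hP : P * P' = 1) (hQ : Q * Q' = 1)
    (h : ∀ s, P * S s = S' s * Q) : TensorIso S S' := by
  refine ⟨Matrix.toLin'OfInv (mul_eq_one_comm.1 hQ) hQ,
    Matrix.toLin'OfInv (mul_eq_one_comm.1 hP) hP, ?_, ?_⟩ <;>
  · intro v
    simp [Matrix.toLin'OfInv, h]

theorem pencilRep_prodMap_dsum [Fintype ι] [Fintype ι'] (S : Tensor2 K ι κ) (S' : Tensor2 K ι' κ') :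
    PencilRep ((S 0).mulVecLin.prodMap (S' 0).mulVecLin) ((S 1).mulVecLin.prodMap (S' 1).mulVecLin)
      (dsum S S') := by
  refine ⟨(LinearEquiv.sumArrowLequivProdArrow κ κ' K K).symm,
    (LinearEquiv.sumArrowLequivProdArrow ι ι' K K).symm, ?_, ?_⟩ <;>
  · rintro ⟨v, v'⟩
    ext i
    cases i <;> simp [dsum, Matrix.mulVec, dotProduct]

theorem PencilRep.dsum [Fintype ι] [Fintype ι'] {A B : V →ₗ[K] W} {A' B' : V' →ₗ[K] W'}
    {S : Tensor2 K ι κ} {S' : Tensor2 K ι' κ'} (h : PencilRep A B S) (h' : PencilRep A' B' S') :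
    PencilRep (A.prodMap A') (B.prodMap B') (dsum S S') :=
  (PencilIso.prodMap h h').trans (pencilRep_prodMap_dsum S S')

theorem TensorIso.dsum [Fintype ι] [Fintype ι'] [Fintype ι₁] [Fintype ι₂]
    {S : Tensor2 K ι κ} {S' : Tensor2 K ι' κ'} {T : Tensor2 K ι₁ κ₁}
    {T' : Tensor2 K ι₂ κ₂} (h : TensorIso S T) (h' : TensorIso S' T') :
    TensorIso (dsum S S') (dsum T T') :=
  (PencilIso.symm (pencilRep_prodMap_dsum S S')).trans (PencilRep.dsum h h')

theorem TensorIso.dsum_comm [Fintype ι] [Fintype ι'] (S : Tensor2 K ι κ) (S' : Tensor2 K ι' κ') :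
    TensorIso (_root_.dsum S S') (_root_.dsum S' S) :=
  (PencilIso.symm (pencilRep_prodMap_dsum S S')).trans
    ((pencilIso_prodComm _ _ _ _).trans (pencilRep_prodMap_dsum S' S))

theorem TensorIso.dsum_assoc [Fintype ι] [Fintype ι'] [Fintype ι''] (S : Tensor2 K ι κ)
    (S' : Tensor2 K ι' κ') (S'' : Tensor2 K ι'' κ'') :
    TensorIso (_root_.dsum (_root_.dsum S S') S'') (_root_.dsum S (_root_.dsum S' S'')) :=
  TensorIso.of_equiv (Equiv.sumAssoc _ _ _) (Equiv.sumAssoc _ _ _) (by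
    rintro s ((i | i) | i) ((j | j) | j) <;> rfl)

/-- Moving a summand past another one. -/
theorem TensorIso.dsum_right_comm [Fintype ι] [Fintype ι'] [Fintype ι''] (S : Tensor2 K ι κ)
    (S' : Tensor2 K ι' κ') (S'' : Tensor2 K ι'' κ'') :
    TensorIso (_root_.dsum (_root_.dsum S S') S'') (_root_.dsum (_root_.dsum S S'') S') :=
  (TensorIso.dsum_assoc _ _ _).trans (((TensorIso.refl S).dsum (TensorIso.dsum_comm _ _)).trans
    (TensorIso.dsum_assoc _ _ _).symm)

theorem TensorIso.dsum_empty [Fintype ι] [Fintype ι'] [IsEmpty ι'] [IsEmpty κ'] (S : Tensor2 K ι κ)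
    (S' : Tensor2 K ι' κ') : TensorIso S (_root_.dsum S S') :=
  TensorIso.of_equiv (Equiv.sumEmpty ι ι').symm (Equiv.sumEmpty κ κ').symm fun _ _ _ => rfl

theorem TensorIso.copies_add [Fintype ι] (a b : ℕ) (S : Tensor2 K ι κ) :
    TensorIso (_root_.dsum (copies a S) (copies b S)) (copies (a + b) S) := by
  refine TensorIso.of_equiv
    ((Equiv.prodSumDistrib _ _ _).symm.trans ((Equiv.refl ι).prodCongr finSumFinEquiv))
    ((Equiv.prodSumDistrib _ _ _).symm.trans ((Equiv.refl κ).prodCongr finSumFinEquiv)) ?_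
  rintro s (⟨i, k⟩ | ⟨i, k⟩) (⟨j, l⟩ | ⟨j, l⟩)
  · simp [copies, _root_.dsum, Matrix.blockDiagonal_apply]
  · have : Fin.castAdd b k ≠ Fin.natAdd a l := fun h => by
      have := congrArg Fin.val h; simp at this; omega
    simp [copies, _root_.dsum, Matrix.blockDiagonal_apply, this]
  · have : Fin.natAdd a k ≠ Fin.castAdd b l := fun h => by
      have := congrArg Fin.val h; simp at this; omega
    simp [copies, _root_.dsum, Matrix.blockDiagonal_apply, this]
  · simp [copies, _root_.dsum, Matrix.blockDiagonal_apply]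

theorem TensorIso.copies_one [Fintype ι] (S : Tensor2 K ι κ) : TensorIso S (copies 1 S) :=
  TensorIso.of_equiv (Equiv.prodUnique ι (Fin 1)).symm (Equiv.prodUnique κ (Fin 1)).symm
    fun s i j => by simp [copies, Matrix.blockDiagonal_apply]

theorem TensorIso.copies_succ [Fintype ι] (a : ℕ) (S : Tensor2 K ι κ) :
    TensorIso (_root_.dsum (copies a S) S) (copies (a + 1) S) :=
  ((TensorIso.refl _).dsum (TensorIso.copies_one S)).trans (TensorIso.copies_add a 1 S)

theorem TensorIso.copies [Fintype ι] [Fintype ι'] {S : Tensor2 K ι κ} {S' : Tensor2 K ι' κ'}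
    (h : TensorIso S S') (a : ℕ) : TensorIso (copies a S) (_root_.copies a S') := by
  induction a with
  | zero =>
    exact TensorIso.of_equiv (Equiv.equivOfIsEmpty _ _) (Equiv.equivOfIsEmpty _ _)
      fun s i => isEmptyElim i
  | succ a ih =>
    exact (TensorIso.copies_succ a S).symm.trans ((ih.dsum h).trans (TensorIso.copies_succ a S'))

theorem PencilRep.shear {A B : V →ₗ[K] W} {S : Tensor2 K ι κ} (h : PencilRep A B S) (t : K) :
    PencilRep A (B - t • A) (shear t S) := by
  have := PencilIso.shear h t
  simpa [PencilRep, _root_.shear] using this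

theorem TensorIso.shear {S : Tensor2 K ι κ} {S' : Tensor2 K ι' κ'} (h : TensorIso S S') (t : K) :
    TensorIso (shear t S) (_root_.shear t S') := by
  have := PencilRep.shear h t
  simpa [TensorIso, _root_.shear] using this

/-- Bases of the coordinate spaces give nonsingular matrices `P` and `Q`; the index sets match because
the dimensions do. -/
theorem TensorIso.tensorEquivalent [Fintype ι] [DecidableEq ι] [DecidableEq κ] [Fintype ι']
    {S : Tensor2 K ι κ} {S' : Tensor2 K ι' κ'} (h : TensorIso S S') : TensorEquivalent S S' := by
  obtain ⟨E, F, hA, hB⟩ := h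
  have hκ : Fintype.card κ' = Fintype.card κ := by simpa using E.finrank_eq.symm
  have hι : Fintype.card ι' = Fintype.card ι := by simpa using F.finrank_eq.symm
  let f := Fintype.equivOfCardEq hκ
  let e := Fintype.equivOfCardEq hι
  let E' : (κ → K) ≃ₗ[K] (κ → K) := E.trans (LinearEquiv.funCongrLeft K K f.symm)
  let F' : (ι → K) ≃ₗ[K] (ι → K) := F.trans (LinearEquiv.funCongrLeft K K e.symm)
  refine ⟨e, f, ⟨F'.toLinearMap.toMatrix', F'.symm.toLinearMap.toMatrix', ?_, ?_⟩,
    ⟨E'.symm.toLinearMap.toMatrix', E'.toLinearMap.toMatrix', ?_, ?_⟩, ?_⟩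
  · rw [← LinearMap.toMatrix'_comp]; simp
  · rw [← LinearMap.toMatrix'_comp]; simp
  · rw [← LinearMap.toMatrix'_comp]; simp
  · rw [← LinearMap.toMatrix'_comp]; simp
  · intro s
    have hs : ∀ v, F ((S s).mulVecLin v) = (S' s).mulVecLin (E v) := by
      fin_cases s
      · exact hA
      · exact hB
    apply Matrix.toLin'.injective
    refine LinearMap.ext fun x => ?_
    have h1 := hs (E'.symm x)
    have h2 : E (E'.symm x) = fun j => x (f j) := by
      have := congrArg (LinearEquiv.funCongrLeft K K f) (E'.apply_symm_apply x)
      funext j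
      simpa [E', LinearMap.funLeft] using congrFun this j
    ext i
    obtain ⟨i, rfl⟩ := e.surjective i
    have h3 := congrFun h1 i
    rw [h2] at h3
    simp only [Matrix.toLin'_mul, Matrix.toLin'_toMatrix', LinearMap.comp_apply]
    simpa [F', LinearMap.funLeft, Matrix.mulVec, dotProduct, ← f.sum_comp] using h3

end PencilRep

/-! ### Regular pairs -/

section Regular

variable {K X : Type*} [Field K] [AddCommGroup X] [Module K X]

/-- A quadratic monic polynomial which is not a product of two distinct monic linear factors. Over an
infinite field these are the ones for which `(companion matrix; E₂)` has rank `3` instead of `2`. -/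
def BadQuadratic (g : K[X]) : Prop :=
  g.Monic ∧ g.natDegree = 2 ∧ ∀ a b, g = (Polynomial.X - C a) * (Polynomial.X - C b) → a = b

theorem badQuadratic_sq (a : K) : BadQuadratic ((Polynomial.X - C a) * (Polynomial.X - C a)) := by
  refine ⟨(monic_X_sub_C a).mul (monic_X_sub_C a), ?_, fun b c h => ?_⟩
  · rw [natDegree_mul (X_sub_C_ne_zero a) (X_sub_C_ne_zero a)]; simp
  · have hb := congrArg (eval b) h
    have hc := congrArg (eval c) h
    simp only [eval_mul, eval_sub, eval_X, eval_C, sub_self, zero_mul, mul_zero, mul_self_eq_zero,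
      sub_eq_zero] at hb hc
    rw [hb, hc]

/-- The tensor `(M; E₂)` with `M` the companion matrix of the monic quadratic polynomial `g`. -/
def compBlock (g : K[X]) : Tensor2 K (Fin 2) (Fin 2) :=
  ![!![0, -g.coeff 0; 1, -g.coeff 1], 1]

theorem aeval_quadratic {g : K[X]} (hg : g.Monic) (h2 : g.natDegree = 2) (M : End K X) (x : X) :
    aeval M g x = M (M x) + g.coeff 1 • M x + g.coeff 0 • x := by
  have : g.coeff 2 = 1 := by rw [← h2]; exact hg
  rw [aeval_eq_sum_range, h2]
  simp [Finset.sum_range_succ, this, pow_two]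
  abel

theorem linearIndependent_pow_of_forall_natDegree_lt {M : End K X} {u : X} {k : ℕ}
    (h : ∀ p : K[X], p.natDegree < k → aeval M p u = 0 → p = 0) :
    LinearIndependent K fun i : Fin k => (M ^ (i : ℕ)) u := by
  rw [Fintype.linearIndependent_iff]
  intro c hc i
  have hk : 0 < k := i.pos
  let p : K[X] := ∑ i : Fin k, C (c i) * Polynomial.X ^ (i : ℕ)
  have hp : p = 0 := by
    apply h
    · refine lt_of_le_of_lt (natDegree_sum_le_of_forall_le (n := k - 1) _ _ fun j _ => ?_) (by omega)
      exact (natDegree_C_mul_X_pow_le _ _).trans (by omega)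
    · rw [← hc]
      simp [p]
  have := congrArg (fun q => coeff q i) hp
  simpa [p, finsetSum_coeff, coeff_C_mul, coeff_X_pow, Fin.val_inj] using this

theorem pow_mem_span_of_monic {M : End K X} {u : X} {k : ℕ} {p : K[X]} (hp : p.Monic)
    (hk : p.natDegree = k) (h : aeval M p u = 0) :
    (M ^ k) u ∈ Submodule.span K (Set.range fun i : Fin k => (M ^ (i : ℕ)) u) := by
  have hlead : p.coeff k = 1 := by rw [← hk]; exact hp
  rw [aeval_eq_sum_range, hk, Finset.sum_range_succ, hlead, one_smul, LinearMap.add_apply,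
    LinearMap.sum_apply] at h
  rw [eq_neg_of_add_eq_zero_right h]
  refine Submodule.neg_mem _ (Submodule.sum_mem _ fun i hi => ?_)
  exact Submodule.smul_mem _ _ (Submodule.subset_span ⟨⟨i, by simpa using hi⟩, rfl⟩)

/-- There is a vector whose annihilator is generated by the minimal polynomial. -/
theorem exists_forall_minpoly_dvd [FiniteDimensional K X] (M : End K X) :
    ∃ u : X, ∀ p : K[X], aeval M p u = 0 → minpoly K M ∣ p := by
  obtain ⟨x, hx⟩ := exists_ker_toSpanSingleton_eq_annihilator K[X] (AEval' M)
  obtain ⟨x, rfl⟩ := (AEval'.of _).surjective x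
  refine ⟨x, fun p hp => ?_⟩
  rw [← span_minpoly_eq_annihilator] at hx
  rw [← Ideal.mem_span_singleton, ← hx, LinearMap.mem_ker, LinearMap.toSpanSingleton_apply]
  have := AEval.of_aeval_smul M p x
  rw [End.smul_def, hp, map_zero] at this
  exact this.symm

theorem exists_basis_cyclic {M : End K X} {u : X} {k : ℕ}
    (hli : LinearIndependent K fun i : Fin k => (M ^ (i : ℕ)) u) {S : Submodule K X}
    (hS : S = Submodule.span K (Set.range fun i : Fin k => (M ^ (i : ℕ)) u)) :
    ∃ b : Basis (Fin k) K S, ∀ i, (b i : X) = (M ^ (i : ℕ)) u := by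
  subst hS
  exact ⟨Basis.span hli, fun i => congrArg Subtype.val (Basis.span_apply hli i)⟩

theorem pencilIso_of_isCompl {M : End K X} {S W : Submodule K X} (h : IsCompl S W)
    (hS : ∀ x ∈ S, M x ∈ S) (hW : ∀ x ∈ W, M x ∈ W) :
    PencilIso M LinearMap.id ((M.restrict hS).prodMap (M.restrict hW))
      (LinearMap.id.prodMap LinearMap.id) := by
  refine PencilIso.symm ⟨Submodule.prodEquivOfIsCompl S W h, Submodule.prodEquivOfIsCompl S W h,
    fun v => ?_, fun v => ?_⟩ <;> simp

/-- A cyclic operator becomes diagonalizable by a rank one correction, so that the pair `(M, id)` on a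
cyclic space of dimension `k` has rank at most `k + 1`. -/
theorem pencilRankLE_cyclic [Infinite K] [FiniteDimensional K X] (M : End K X) (u : X) {k : ℕ}
    (hli : LinearIndependent K fun i : Fin k => (M ^ (i : ℕ)) u)
    (hk : (M ^ k) u ∈ Submodule.span K (Set.range fun i : Fin k => (M ^ (i : ℕ)) u))
    {S : Submodule K X}
    (hS : S = Submodule.span K (Set.range fun i : Fin k => (M ^ (i : ℕ)) u))
    (hMS : ∀ x ∈ S, M x ∈ S) : PencilRankLE (M.restrict hMS) LinearMap.id (k + 1) := by
  let a : Fin k ↪ K := Fin.valEmbedding.trans (Infinite.natEmbedding K)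
  obtain ⟨N, W, hN, -, hc, hW, hNS, hr⟩ :=
    exists_isCompl_cyclic_diagonal M u hli hk a a.injective hS
  let L := (K ∙ u).comap S.subtype
  have hL : finrank K L ≤ 1 := by
    have h1 : L.map S.subtype ≤ K ∙ u := Submodule.map_comap_le _ _
    have h2 := Submodule.finrank_mono h1
    rw [Submodule.finrank_map_subtype_eq] at h2
    exact h2.trans ((finrank_span_le_card _).trans (by simp))
  have hD : ∀ x, (M.restrict hMS - N.restrict hNS) x ∈ L := by
    intro x
    change M x - N x ∈ K ∙ u
    rw [← neg_sub]
    exact Submodule.neg_mem _ (hN x)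
  have := hr.add ((pencilRankLE_of_range_le L hD).mono hL)
  simpa using this

theorem coe_aeval_restrict {M : End K X} {W : Submodule K X} (h : ∀ x ∈ W, M x ∈ W) (p : K[X])
    (x : W) : (aeval (M.restrict h : End K W) p x : X) = aeval M p (x : X) := by
  have hpow : ∀ i : ℕ, (((M.restrict h : End K W) ^ i) x : X) = (M ^ i) (x : X) := by
    intro i
    induction i with
    | zero => simp
    | succ i ih => rw [pow_succ', pow_succ', End.mul_apply, End.mul_apply, ← ih]; rfl
  rw [aeval_eq_sum_range, aeval_eq_sum_range]
  simp [hpow]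

theorem pencilRep_of_finrank_eq_zero {V W ι κ : Type*} [AddCommGroup V] [Module K V]
    [AddCommGroup W] [Module K W] [FiniteDimensional K V] [FiniteDimensional K W] [Fintype κ]
    [Fintype ι] [IsEmpty ι] (A B : V →ₗ[K] W) (S : Tensor2 K ι κ)
    (hV : finrank K V = Fintype.card κ) (hW : finrank K W = 0) : PencilRep A B S :=
  ⟨LinearEquiv.ofFinrankEq _ _ (by simp [hV]), LinearEquiv.ofFinrankEq _ _ (by simp [hW]),
    fun _ => Subsingleton.elim _ _, fun _ => Subsingleton.elim _ _⟩

theorem exists_pencilRep_smul_one [FiniteDimensional K X] (a : K) (Y : Tensor2 K (Fin 2) (Fin 2)) :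
    PencilRankLE (a • (1 : End K X)) LinearMap.id (finrank K X) ∧
      (finrank K X = 0 → PencilRep (a • (1 : End K X)) LinearMap.id (copies 0 Y)) ∧
      (finrank K X = 1 →
        PencilRep (a • (1 : End K X)) LinearMap.id (dsum (copies 0 Y) ![!![a], !![1]])) := by
  refine ⟨pencilRankLE_of_eigenbasis (finBasis K X) (fun _ => a) (by simp), fun h0 => ?_,
    fun h1 => ?_⟩
  · exact pencilRep_of_finrank_eq_zero _ _ _ (by simp [h0]) h0
  · let b := finBasisOfFinrankEq K X h1
    have : PencilRep (a • (1 : End K X)) LinearMap.id (![!![a], !![1]] : Tensor2 K _ _) := by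
      refine PencilRep.of_basis b b (fun j => ?_) (fun j => ?_) <;> fin_cases j <;> simp
    exact this.trans ((TensorIso.dsum_empty _ _).trans (TensorIso.dsum_comm _ _))

/-- A cyclic space of dimension two, in the basis `u, M u`, is the companion block of the polynomial
that kills `u`. -/
theorem pencilRep_compBlock {M : End K X} {u : X} {g : K[X]} (hg : g.Monic) (h2 : g.natDegree = 2)
    (hu : aeval M g u = 0) (hli : LinearIndependent K fun i : Fin 2 => (M ^ (i : ℕ)) u)
    {S : Submodule K X}
    (hS : S = Submodule.span K (Set.range fun i : Fin 2 => (M ^ (i : ℕ)) u))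
    (hMS : ∀ x ∈ S, M x ∈ S) : PencilRep (M.restrict hMS) LinearMap.id (compBlock g) := by
  obtain ⟨b, hb⟩ := exists_basis_cyclic hli hS
  have hb0 : (b 0 : X) = u := by simpa using hb 0
  have hb1 : (b 1 : X) = M u := by simpa using hb 1
  rw [aeval_quadratic hg h2] at hu
  refine PencilRep.of_basis b b (fun j => Subtype.ext ?_) (fun j => Subtype.ext ?_) <;>
    fin_cases j <;> simp [compBlock, hb0, hb1]
  rw [← sub_eq_zero, ← hu]
  abel

/-- If `M` is annihilated by the monic quadratic polynomial `g`, then the space splits into `α` cyclic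
planes with annihilator `g` and `s` eigenvectors. The form is recorded for `s ≤ 1` only. -/
theorem exists_pencilRep_of_quadratic [FiniteDimensional K X] [Infinite K] (M : End K X) (g : K[X])
    (hg : g.Monic) (h2 : g.natDegree = 2) (hM : aeval M g = 0) :
    ∃ (α s : ℕ) (x : K), 2 * α + s = finrank K X ∧
      PencilRankLE M LinearMap.id (3 * α + s) ∧
      (s = 0 → PencilRep M LinearMap.id (copies α (compBlock g))) ∧
      (s = 1 → PencilRep M LinearMap.id (dsum (copies α (compBlock g)) ![!![x], !![1]])) := by
  induction hn : finrank K X using Nat.strong_induction_on generalizing X with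
  | _ n ih =>
  by_cases h : ∀ v, ¬ LinearIndependent K ![v, M v]
  · obtain ⟨a, rfl⟩ := LinearMap.exists_eq_smul_id_of_forall_notLinearIndependent h
    obtain ⟨h0, h1, h2⟩ := exists_pencilRep_smul_one (X := X) a (compBlock g)
    exact ⟨0, n, a, by omega, by simpa [hn] using h0, fun hh => h1 (by omega),
      fun hh => h2 (by omega)⟩
  · push Not at h
    obtain ⟨u, hu⟩ := h
    have hli : LinearIndependent K fun i : Fin 2 => (M ^ (i : ℕ)) u := by
      convert hu using 1
      ext i; fin_cases i <;> simp
    have hgu : aeval M g u = 0 := by rw [hM]; rfl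
    have hk := pow_mem_span_of_monic hg h2 hgu
    obtain ⟨N, W, φ, -, hN, hc, hNS, hNW, -, -⟩ := exists_isCompl_cyclic M u hli hk g hg h2
    obtain rfl := hN hM
    obtain ⟨S, hS⟩ : ∃ S, S = Submodule.span K (Set.range fun i : Fin 2 => (N ^ (i : ℕ)) u) :=
      ⟨_, rfl⟩
    rw [← hS] at hc hNS
    have hdim := Submodule.finrank_add_eq_of_isCompl hc
    have hS2 : finrank K S = 2 := by rw [hS, finrank_span_eq_card hli, Fintype.card_fin]
    obtain ⟨α, s, x, h3, h4, h5, h6⟩ := ih (finrank K W) (by omega) (N.restrict hNW)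
      (LinearMap.ext fun x => Subtype.ext (by rw [coe_aeval_restrict, hM]; rfl)) rfl
    have hiso := pencilIso_of_isCompl hc hNS hNW
    have hrep := pencilRep_compBlock hg h2 hgu hli hS hNS
    refine ⟨α + 1, s, x, by omega, ?_, fun hs => ?_, fun hs => ?_⟩
    · exact (((pencilRankLE_cyclic N u hli hk hS hNS).prodMap h4).of_iso hiso).mono (by omega)
    · exact (hiso.trans (hrep.dsum (h5 hs))).trans
        ((TensorIso.dsum_comm _ _).trans (TensorIso.copies_succ _ _))
    · exact (hiso.trans (hrep.dsum (h6 hs))).trans ((TensorIso.dsum_comm _ _).trans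
        ((TensorIso.dsum_right_comm _ _ _).trans
          ((TensorIso.copies_succ _ _).dsum (TensorIso.refl _))))

end Regular

section Regular

variable {K X : Type*} [Field K] [AddCommGroup X] [Module K X]

theorem exists_eq_mul_X_sub_C {p g : K[X]} (hp : p.Monic) (hg : g.Monic) (h : g ∣ p)
    (hd : p.natDegree = g.natDegree + 1) : ∃ b, p = g * (Polynomial.X - C b) := by
  obtain ⟨q, rfl⟩ := h
  have hq : q.Monic := hg.of_mul_monic_left hp
  rw [hg.natDegree_mul hq] at hd
  refine ⟨-q.coeff 0, ?_⟩
  conv_lhs => rw [hq.eq_X_add_C (by omega)]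
  simp

/-- A monic cubic with a root has three distinct roots, or it is a linear factor times a quadratic
without two distinct roots. -/
theorem cubic_cases {p : K[X]} (hp : p.Monic) (h3 : p.natDegree = 3) {b : K} (hb : p.IsRoot b) :
    (∃ a : Fin 3 → K, Function.Injective a ∧ p = ∏ i, (Polynomial.X - C (a i))) ∨
      ∃ g b, BadQuadratic g ∧ p = g * (Polynomial.X - C b) := by
  obtain ⟨q, hq⟩ := dvd_iff_isRoot.2 hb
  have hqm : q.Monic := (monic_X_sub_C b).of_mul_monic_left (hq ▸ hp)
  have hq2 : q.natDegree = 2 := by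
    have := congrArg natDegree hq
    rw [(monic_X_sub_C b).natDegree_mul hqm, natDegree_X_sub_C] at this
    omega
  by_cases hbad : BadQuadratic q
  · exact Or.inr ⟨q, b, hbad, by rw [hq, mul_comm]⟩
  simp only [BadQuadratic, hqm, hq2, true_and, not_forall] at hbad
  obtain ⟨c, d, hcd, hne⟩ := hbad
  by_cases hbc : b = c
  · refine Or.inr ⟨_, d, badQuadratic_sq b, ?_⟩
    rw [hq, hcd, hbc]; ring
  by_cases hbd : b = d
  · refine Or.inr ⟨_, c, badQuadratic_sq b, ?_⟩
    rw [hq, hcd, hbd]; ring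
  refine Or.inl ⟨![b, c, d], ?_, ?_⟩
  · intro i j hij
    have h1 : b ≠ c := hbc
    have h2 : b ≠ d := hbd
    fin_cases i <;> fin_cases j <;>
      simp [h1, h2, hne, h1.symm, h2.symm, Ne.symm hne] at hij ⊢
  · rw [hq, hcd, Fin.prod_univ_three]
    simp [mul_assoc]

/-- The only reducible polynomials in the class `BadQuadratic` are the squares. -/
theorem BadQuadratic.eq_sq {g : K[X]} (hg : BadQuadratic g) {b : K} (hb : g.eval b = 0) :
    g = (Polynomial.X - C b) * (Polynomial.X - C b) := by
  obtain ⟨c, hc⟩ := exists_eq_mul_X_sub_C hg.1 (monic_X_sub_C b) (dvd_iff_isRoot.2 hb)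
    (by rw [hg.2.1, natDegree_X_sub_C])
  rw [← hg.2.2 b c hc] at hc
  exact hc

theorem coeff_sq_X_sub_C (x : K) :
    (((Polynomial.X : K[X]) - C x) * (Polynomial.X - C x)).coeff 0 = x * x ∧
    (((Polynomial.X : K[X]) - C x) * (Polynomial.X - C x)).coeff 1 = -(2 * x) := by
  have : ((Polynomial.X : K[X]) - C x) * (Polynomial.X - C x) =
      Polynomial.X ^ 2 + C (-(2 * x)) * Polynomial.X + C (x * x) := by
    simp only [C_neg, C_mul]
    rw [show (C 2 : K[X]) = 2 from rfl]
    ring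
  rw [this]
  constructor <;> simp [coeff_X, coeff_C]

theorem compBlock_sq_tensorIso (x : K) :
    TensorIso (compBlock ((Polynomial.X - C x) * (Polynomial.X - C x))) (blockB x 2) := by
  obtain ⟨h0, h1⟩ := coeff_sq_X_sub_C x
  refine TensorIso.symm (TensorIso.of_matrix !![-x, 1; 1, 0] !![0, 1; 1, x] !![-x, 1; 1, 0]
    !![0, 1; 1, x] ?_ ?_ fun s => ?_)
  · ext i j; fin_cases i <;> fin_cases j <;> simp
  · ext i j; fin_cases i <;> fin_cases j <;> simp
  · fin_cases s
    · ext i j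
      fin_cases i <;> fin_cases j <;>
        simp [compBlock, blockB, shiftJ, h0, h1, Matrix.mul_apply, Fin.sum_univ_two] <;> ring
    · simp [compBlock, blockB]

theorem LinearIndependent.of_det_ne_zero {ι : Type*} [Fintype ι] [DecidableEq ι] {u v : ι → X}
    (hu : LinearIndependent K u) (m : Matrix ι ι K) (hm : m.det ≠ 0)
    (hv : ∀ i, v i = ∑ j, m i j • u j) : LinearIndependent K v := by
  rw [Fintype.linearIndependent_iff] at hu ⊢
  intro c hc
  have h0 : Matrix.vecMul c m = 0 := by
    funext j
    refine hu (Matrix.vecMul c m) ?_ j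
    rw [← hc]
    simp only [hv, Matrix.vecMul, dotProduct, Finset.sum_smul, Finset.smul_sum, smul_smul]
    exact Finset.sum_comm
  exact congrFun (Matrix.eq_zero_of_vecMul_eq_zero hm h0)

/-- The cyclic subspace generated by `u`, seen as a space of its own. -/
theorem exists_restrict_cyclic {M : End K X} {u : X} {k : ℕ} (hk : 0 < k)
    (hli : LinearIndependent K fun i : Fin k => (M ^ (i : ℕ)) u) {S : Submodule K X}
    (hS : S = Submodule.span K (Set.range fun i : Fin k => (M ^ (i : ℕ)) u))
    (hMS : ∀ x ∈ S, M x ∈ S) :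
    ∃ u' : S, (LinearIndependent K fun i : Fin k => ((M.restrict hMS : End K S) ^ (i : ℕ)) u') ∧
      ∀ p : K[X], aeval M p u = 0 → aeval (M.restrict hMS : End K S) p u' = 0 := by
  have hu : u ∈ S := by
    rw [hS]
    simpa using Submodule.subset_span (R := K) (s := Set.range fun i : Fin k => (M ^ (i : ℕ)) u)
      ⟨⟨0, hk⟩, rfl⟩
  refine ⟨⟨u, hu⟩, LinearIndependent.of_comp S.subtype ?_, fun p hp => Subtype.ext ?_⟩
  · convert hli using 1
    funext i
    have := coe_aeval_restrict hMS (Polynomial.X ^ (i : ℕ)) ⟨u, hu⟩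
    simpa using this
  · rw [coe_aeval_restrict, hp]; rfl

/-- A cyclic space with annihilator `g (X - b)`, where `g` is quadratic and prime to `X - b`. -/
theorem pencilRep_cyclic_coprime [FiniteDimensional K X] {M : End K X} {u : X} {g : K[X]}
    (hg : g.Monic) (h2 : g.natDegree = 2) {b : K} (hb : g.eval b ≠ 0)
    (hu : aeval M (g * (Polynomial.X - C b)) u = 0)
    (hli : LinearIndependent K fun i : Fin 3 => (M ^ (i : ℕ)) u) (hX : finrank K X = 3) :
    PencilRep M LinearMap.id (dsum (compBlock g) ![!![b], !![1]]) := by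
  have hgb : g.eval b = b * b + g.coeff 1 * b + g.coeff 0 := by
    have hlead : g.coeff 2 = 1 := by rw [← h2]; exact hg
    rw [eval_eq_sum_range, h2]
    simp [Finset.sum_range_succ, hlead]
    ring
  have h1 : aeval M g (M u - b • u) = 0 := by
    rw [map_mul, End.mul_apply] at hu
    simpa using hu
  have h3 : M (aeval M g u) - b • aeval M g u = 0 := by
    rw [mul_comm, map_mul, End.mul_apply] at hu
    simpa using hu
  rw [aeval_quadratic hg h2] at h1 h3
  have hv := hli.of_det_ne_zero (v := ![M u - b • u, M (M u - b • u),
    M (M u) + g.coeff 1 • M u + g.coeff 0 • u])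
    !![-b, 1, 0; 0, -b, 1; g.coeff 0, g.coeff 1, 1] (by
      rw [Matrix.det_fin_three]
      simp
      intro h
      exact hb (by rw [hgb]; linear_combination h)) (fun i => by
      fin_cases i <;> simp [Fin.sum_univ_three, pow_two] <;> abel)
  let w := (basisOfLinearIndependentOfCardEqFinrank' _ hv (by simp [hX])).reindex
    (finSumFinEquiv (m := 2) (n := 1)).symm
  have hw0 : w (Sum.inl 0) = M u - b • u := by simp [w]; rfl
  have hw1 : w (Sum.inl 1) = M (M u - b • u) := by simp [w]; rfl
  have hw2 : w (Sum.inr 0) = M (M u) + g.coeff 1 • M u + g.coeff 0 • u := by simp [w]; rfl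
  refine PencilRep.of_basis w w (fun j => ?_) (fun j => ?_)
  · rcases j with j | j <;> fin_cases j
    · simp [dsum, compBlock, hw0, hw1]
    · simp only [Fin.mk_one, dsum, compBlock, Fintype.sum_sum_type, Fin.sum_univ_two]
      simp [hw0, hw1] at h1 ⊢
      rw [← sub_eq_zero, ← h1]
      abel
    · simp only [dsum, compBlock, Fintype.sum_sum_type, Fin.sum_univ_two]
      simp [hw2] at h3 ⊢
      rw [← sub_eq_zero, ← h3]
  · rcases j with j | j <;> fin_cases j <;> simp [dsum, compBlock]

/-- A cyclic space with annihilator `(X - b)³` is a Jordan block. -/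
theorem pencilRep_cyclic_cube [FiniteDimensional K X] {M : End K X} {u : X} {b : K}
    (hu : aeval M ((Polynomial.X - C b) * (Polynomial.X - C b) * (Polynomial.X - C b)) u = 0)
    (hli : LinearIndependent K fun i : Fin 3 => (M ^ (i : ℕ)) u) (hX : finrank K X = 3) :
    PencilRep M LinearMap.id (blockB b 3) := by
  have hv := hli.of_det_ne_zero (v := ![M (M u - b • u) - b • (M u - b • u), M u - b • u, u])
    !![b * b, -(b + b), 1; -b, 1, 0; 1, 0, 0] (by
      rw [Matrix.det_fin_three]
      simp) (fun i => by
      fin_cases i <;> simp [Fin.sum_univ_three, pow_two, smul_sub, smul_smul, add_smul] <;> abel)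
  let w := basisOfLinearIndependentOfCardEqFinrank' _ hv (by simp [hX])
  have hw0 : w 0 = M (M u - b • u) - b • (M u - b • u) := by simp [w]
  have hw1 : w 1 = M u - b • u := by simp [w]
  have hw2 : w 2 = u := by simp [w]
  have h0 : M (w 0) - b • w 0 = 0 := by
    rw [hw0, ← hu]
    simp only [map_mul, End.mul_apply, map_sub, aeval_X, aeval_C, LinearMap.sub_apply,
      Module.algebraMap_end_apply, map_smul, smul_sub]
  refine PencilRep.of_basis w w (fun j => ?_) (fun j => ?_)
  · fin_cases j
    · simpa [blockB, shiftJ, Fin.sum_univ_three, Matrix.one_apply] using sub_eq_zero.1 h0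
    · simp [blockB, shiftJ, Fin.sum_univ_three, Matrix.one_apply, hw1, hw0]
    · simp [blockB, shiftJ, Fin.sum_univ_three, Matrix.one_apply, hw1, hw2]
  · fin_cases j <;> simp [blockB, Matrix.one_apply]

/-- The forms of a regular pair whose rank misses `3 * dim / 2` by one half only. -/
def RegularForm (M : End K X) : Prop :=
  (∃ (g : K[X]) (α : ℕ) (x : K), BadQuadratic g ∧
    PencilRep M LinearMap.id (dsum (copies α (compBlock g)) ![!![x], !![1]])) ∨
  ∃ (α : ℕ) (x : K),
    PencilRep M LinearMap.id (dsum (copies α (blockB x 2)) (blockB x 3))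

/-- The rank of a regular pair `(M, id)` is at most `3 * dim / 2`, and the form of `M` is known when
the bound is missed by at most one half. The space splits off a cyclic subspace of dimension
`k = deg μ`, where `μ` is the minimal polynomial of `M`; this subspace has rank at most `k + 1`, and
`k` if `μ` has distinct roots in `K`. Hence a loss of at most one half is possible for `k ≤ 3`
only. -/
theorem exists_regular_bound [Infinite K]
    (hcubic : ∀ p : K[X], p.Monic → p.natDegree = 3 → ∃ b, p.IsRoot b)
    [FiniteDimensional K X] (M : End K X) :
    ∃ r e : ℕ, PencilRankLE M LinearMap.id r ∧ 2 * r + e = 3 * finrank K X ∧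
      (e = 0 → finrank K X = 0 ∨ (BadQuadratic (minpoly K M) ∧
        ∃ α, PencilRep M LinearMap.id (copies α (compBlock (minpoly K M))))) ∧
      (e = 1 → RegularForm M) := by
  induction hn : finrank K X using Nat.strong_induction_on generalizing X with
  | _ n ih =>
  by_cases hscal : ∃ a : K, M = a • 1
  · obtain ⟨a, rfl⟩ := hscal
    -- No block occurs, so that any polynomial of the class can be named.
    obtain ⟨h0, -, h2⟩ := exists_pencilRep_smul_one (X := X) a
      (compBlock ((Polynomial.X - C (0 : K)) * (Polynomial.X - C 0)))
    rw [hn] at h0 h2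
    exact ⟨n, n, h0, by omega, fun h => Or.inl h,
      fun h => Or.inl ⟨_, 0, a, badQuadratic_sq 0, h2 h⟩⟩
  obtain ⟨u, hu⟩ := exists_forall_minpoly_dvd M
  have hμ : (minpoly K M).Monic := minpoly.monic (Algebra.IsIntegral.isIntegral M)
  have hμM : aeval M (minpoly K M) = 0 := minpoly.aeval K M
  generalize hμe : minpoly K M = μ at hu hμ hμM
  obtain ⟨k, hk⟩ : ∃ k, μ.natDegree = k := ⟨_, rfl⟩
  have hk0 : k ≠ 0 := by
    rintro rfl
    rw [hμ.natDegree_eq_zero.1 hk, map_one] at hμM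
    exact hscal ⟨0, by rw [zero_smul, ← mul_one M, hμM, mul_zero]⟩
  have hk1 : k ≠ 1 := by
    rintro rfl
    rw [hμ.eq_X_add_C hk, map_add, aeval_X, aeval_C] at hμM
    refine hscal ⟨-μ.coeff 0, ?_⟩
    rw [neg_smul, eq_neg_iff_add_eq_zero, ← hμM, Algebra.algebraMap_eq_smul_one]
  have hμu : aeval M μ u = 0 := by rw [hμM]; rfl
  have hli : LinearIndependent K fun i : Fin k => (M ^ (i : ℕ)) u := by
    refine linearIndependent_pow_of_forall_natDegree_lt fun p hp hpu => ?_
    exact eq_zero_of_dvd_of_natDegree_lt (hu p hpu) (by omega)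
  have hkm := pow_mem_span_of_monic hμ hk hμu
  obtain ⟨S, hS⟩ : ∃ S, S = Submodule.span K (Set.range fun i : Fin k => (M ^ (i : ℕ)) u) :=
    ⟨_, rfl⟩
  have hSk : finrank K S = k := by rw [hS, finrank_span_eq_card hli, Fintype.card_fin]
  -- If `μ` has distinct roots in `K`, the cyclic summand has rank `k` only.
  have hsplit : ∀ a : Fin k → K, Function.Injective a → μ = ∏ i, (Polynomial.X - C (a i)) →
      ∃ r e : ℕ, PencilRankLE M LinearMap.id r ∧ 2 * r + e = 3 * n ∧ 2 ≤ e := by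
    intro a ha hμa
    obtain ⟨N, W, -, hN, hc, hNW, hNS, hr⟩ := exists_isCompl_cyclic_diagonal M u hli hkm a ha hS
    obtain rfl := hN (by rw [← hμa, hμM])
    have hdim := Submodule.finrank_add_eq_of_isCompl hc
    obtain ⟨r, e, h1, h2, -, -⟩ := ih (finrank K W) (by omega) (N.restrict hNW) rfl
    exact ⟨k + r, k + e, (hr.prodMap h1).of_iso (pencilIso_of_isCompl hc hNS hNW),
      by omega, by omega⟩
  by_cases hspl : ∃ a : Fin k → K, Function.Injective a ∧ μ = ∏ i, (Polynomial.X - C (a i))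
  · obtain ⟨a, ha, hμa⟩ := hspl
    obtain ⟨r, e, h1, h2, h3⟩ := hsplit a ha hμa
    exact ⟨r, e, h1, h2, by omega, by omega⟩
  by_cases hk2 : k = 2
  · subst hk2
    have hbad : BadQuadratic μ := by
      refine ⟨hμ, hk, fun a b hab => ?_⟩
      by_contra hne
      refine hspl ⟨![a, b], ?_, by simpa using hab⟩
      intro i j hij
      fin_cases i <;> fin_cases j <;> simp_all [eq_comm]
    obtain ⟨α, s, x, h1, h2, h3, h4⟩ := exists_pencilRep_of_quadratic M μ hμ hk hμM
    exact ⟨_, s, h2, by omega, fun h => Or.inr ⟨hbad, α, h3 h⟩,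
      fun h => Or.inl ⟨μ, α, x, hbad, h4 h⟩⟩
  -- Now `3 ≤ k`, and only `k = 3` with an extremal complement can come close to the bound.
  obtain ⟨N, W, φ, -, hN, hc, hNS, hNW, -, -⟩ := exists_isCompl_cyclic M u hli hkm μ hμ hk
  obtain rfl := hN hμM
  rw [← hS] at hc hNS
  have hdim := Submodule.finrank_add_eq_of_isCompl hc
  obtain ⟨r, e, h1, h2, h3, h4⟩ := ih (finrank K W) (by omega) (N.restrict hNW) rfl
  have hiso := pencilIso_of_isCompl hc hNS hNW
  refine ⟨k + 1 + r, k - 2 + e, ((pencilRankLE_cyclic N u hli hkm hS hNS).prodMap h1).of_iso hiso,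
    by omega, by omega, fun he => ?_⟩
  obtain rfl : k = 3 := by omega
  obtain rfl : e = 0 := by omega
  have hW0 : aeval (N.restrict hNW : End K W) μ = 0 :=
    LinearMap.ext fun x => Subtype.ext (by rw [coe_aeval_restrict, hμM]; rfl)
  -- The annihilator `g` of the complement divides `μ`, hence occurs in the cyclic summand too.
  obtain ⟨g, b, α, hg, hgb, hrep⟩ : ∃ (g : K[X]) (b : K) (α : ℕ), BadQuadratic g ∧
      μ = g * (Polynomial.X - C b) ∧
      PencilRep (N.restrict hNW) LinearMap.id (copies α (compBlock g)) := by
    rcases h3 rfl with h0 | ⟨hbad, α, hα⟩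
    · obtain ⟨b, hb⟩ := hcubic μ hμ hk
      rcases cubic_cases hμ hk hb with h | ⟨g, b, hg, hgb⟩
      · exact absurd h hspl
      · exact ⟨g, b, 0, hg, hgb, pencilRep_of_finrank_eq_zero _ _ _ (by simp [h0]) h0⟩
    · obtain ⟨b, hb⟩ := exists_eq_mul_X_sub_C hμ hbad.1 (minpoly.dvd K _ hW0)
        (by rw [hk, hbad.2.1])
      exact ⟨_, b, α, hbad, hb, hα⟩
  obtain ⟨u', hli', hu'⟩ := exists_restrict_cyclic (by norm_num) hli hS hNS
  have hμu' := hu' μ hμu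
  rw [hgb] at hμu'
  by_cases hgb0 : g.eval b = 0
  · have hsq := hg.eq_sq hgb0
    subst hsq
    exact Or.inr ⟨α, b, (hiso.trans ((pencilRep_cyclic_cube hμu' hli' hSk).dsum
      (hrep.trans ((compBlock_sq_tensorIso b).copies α)))).trans (TensorIso.dsum_comm _ _)⟩
  · refine Or.inl ⟨g, α + 1, b, hg, (hiso.trans
      ((pencilRep_cyclic_coprime hg.1 hg.2.1 hgb0 hμu' hli' hSk).dsum hrep)).trans ?_⟩
    exact (TensorIso.dsum_right_comm _ _ _).trans (((TensorIso.dsum_comm _ _).trans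
      (TensorIso.copies_succ _ _)).dsum (TensorIso.refl _))

end Regular

/-! ### Pairs of almost maximal rank -/

section NearMaximal

universe u₁ u₂ u₃ u₄
variable {K : Type*} {V : Type u₁} {W : Type u₂} {V' : Type u₃} {W' : Type u₄} [Field K]
  [AddCommGroup V] [Module K V] [AddCommGroup W] [Module K W]
  [AddCommGroup V'] [Module K V'] [AddCommGroup W'] [Module K W']

/-- The form of the pairs `(A, B)` with `2 * rank = 2 * dim W + dim V`, when `B` has the largest rank
among the maps `B + s A`. -/
def MaximalForm (A B : V →ₗ[K] W) : Prop :=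
  ∃ (g : K[X]) (α ℓ : ℕ), BadQuadratic g ∧
    PencilRep A B (dsum (copies α (compBlock g)) (copies ℓ (blockE K 1)))

/-- The forms of the pairs `(A, B)` with `2 * rank + 1 = 2 * dim W + dim V`, when `B` has the largest
rank among the maps `B + s A`. -/
def SubmaximalForm (A B : V →ₗ[K] W) : Prop :=
  (∃ (g : K[X]) (α ℓ : ℕ), BadQuadratic g ∧
    (PencilRep A B (dsum (dsum (copies α (compBlock g)) (copies ℓ (blockE K 1)))
        (0 : Tensor2 K (Fin 0) (Fin 1))) ∨
      PencilRep A B (dsum (dsum (copies α (compBlock g)) (copies ℓ (blockE K 1))) (blockF K 1)) ∨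
      (∃ x : K, PencilRep A B (dsum (dsum (copies α (compBlock g)) (copies ℓ (blockE K 1)))
        ![!![x], !![1]])) ∨
      PencilRep A B
        (dsum (dsum (copies α (compBlock g)) (copies ℓ (blockE K 1))) (blockE K 2)))) ∨
  ∃ (α ℓ : ℕ) (x : K), PencilRep A B
    (dsum (dsum (copies α (blockB x 2)) (blockB x 3)) (copies ℓ (blockE K 1)))

/-- The rank of `(A, B)` is bounded by some `r` with `2 * r ≤ 2 * dim W + dim V`, and the form of
`(A, B)` is known when the difference `e` of the two sides is at most one. -/
def RankDichotomy (A B : V →ₗ[K] W) : Prop :=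
  ∃ r e : ℕ, PencilRankLE A B r ∧ 2 * r + e = 2 * finrank K W + finrank K V ∧
    (e = 0 → MaximalForm A B) ∧ (e = 1 → SubmaximalForm A B)

theorem PencilIso.rep {ι κ : Type*} [Fintype κ] {A B : V →ₗ[K] W} {A' B' : V' →ₗ[K] W'}
    {S : Tensor2 K ι κ} (h : PencilIso A B A' B') (h' : PencilRep A' B' S) : PencilRep A B S :=
  h.trans h'

theorem RankDichotomy.of_iso {A B : V →ₗ[K] W} {A' B' : V' →ₗ[K] W'}
    (h : RankDichotomy A' B') (hi : PencilIso A B A' B') : RankDichotomy A B := by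
  obtain ⟨r, e, h1, h2, h3, h4⟩ := h
  refine ⟨r, e, h1.of_iso hi, ?_, fun he => ?_, fun he => ?_⟩
  · obtain ⟨f, g, -, -⟩ := hi
    rw [f.finrank_eq, g.finrank_eq, h2]
  · obtain ⟨g, α, ℓ, hg, h⟩ := h3 he
    exact ⟨g, α, ℓ, hg, hi.rep h⟩
  · rcases h4 he with ⟨g, α, ℓ, hg, h⟩ | ⟨α, ℓ, x, h⟩
    · refine Or.inl ⟨g, α, ℓ, hg, ?_⟩
      exact h.imp hi.rep fun h => h.imp hi.rep fun h => h.imp (fun ⟨x, h⟩ => ⟨x, hi.rep h⟩) hi.rep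
    · exact Or.inr ⟨α, ℓ, x, hi.rep h⟩

/-- The pair of the two projections `Q × Q → Q` is a sum of blocks `((0, 1); (1, 0))`. -/
theorem pencilRep_snd_fst (Q : Type*) [AddCommGroup Q] [Module K Q] [FiniteDimensional K Q] :
    PencilRep (LinearMap.snd K Q Q) (LinearMap.fst K Q Q)
      (copies (finrank K Q) (blockE K 1)) := by
  let b := finBasis K Q
  let e : Fin 2 × Fin (finrank K Q) ≃ Fin (finrank K Q) ⊕ Fin (finrank K Q) :=
    { toFun := fun p => if p.1 = 0 then Sum.inl p.2 else Sum.inr p.2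
      invFun := Sum.elim (fun i => (0, i)) (fun i => (1, i))
      left_inv := fun ⟨i, j⟩ => by fin_cases i <;> simp
      right_inv := fun p => by rcases p with p | p <;> simp }
  refine PencilRep.of_basis ((b.prod b).reindex e.symm)
    (b.reindex (Equiv.uniqueProd (Fin (finrank K Q)) (Fin 1)).symm) ?_ ?_ <;>
  · rintro ⟨i, j⟩
    fin_cases i <;>
      simp [e, blockE, copies, Matrix.blockDiagonal_apply, Fintype.sum_prod_type]

/-- Blocks `((0, 1); (1, 0))` have rank `2` each and do not change the slack `e`. -/
theorem RankDichotomy.prod_blockE (Q : Type*) [AddCommGroup Q] [Module K Q]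
    [FiniteDimensional K Q] [FiniteDimensional K V] [FiniteDimensional K W]
    {A B : V →ₗ[K] W} (h : RankDichotomy A B) :
    RankDichotomy (A.prodMap (LinearMap.snd K Q Q)) (B.prodMap (LinearMap.fst K Q Q)) := by
  obtain ⟨r, e, h1, h2, h3, h4⟩ := h
  have hr : PencilRankLE (LinearMap.snd K Q Q) (LinearMap.fst K Q Q)
      (finrank K Q + finrank K Q) := by
    have ha := pencilRankLE_of_range_le (A := LinearMap.snd K Q Q) ⊤ (by simp)
    have hb := pencilRankLE_of_range_le (A := LinearMap.fst K Q Q) ⊤ (by simp)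
    simpa using ha.add hb.swap
  have hQ := pencilRep_snd_fst (K := K) Q
  -- The new blocks join the old ones.
  have key : ∀ {ι κ : Type} [Fintype ι] [Fintype κ] (S : Tensor2 K ι κ) (ℓ : ℕ),
      PencilRep A B (dsum S (copies ℓ (blockE K 1))) →
      PencilRep (A.prodMap (LinearMap.snd K Q Q)) (B.prodMap (LinearMap.fst K Q Q))
        (dsum S (copies (ℓ + finrank K Q) (blockE K 1))) := fun S ℓ h =>
    (h.dsum hQ).trans ((TensorIso.dsum_assoc _ _ _).trans
      ((TensorIso.refl S).dsum (TensorIso.copies_add _ _ _)))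
  have key2 : ∀ {ι κ ι' κ' : Type} [Fintype ι] [Fintype κ] [Fintype ι'] [Fintype κ']
      (S : Tensor2 K ι κ) (S' : Tensor2 K ι' κ') (ℓ : ℕ),
      PencilRep A B (dsum (dsum S (copies ℓ (blockE K 1))) S') →
      PencilRep (A.prodMap (LinearMap.snd K Q Q)) (B.prodMap (LinearMap.fst K Q Q))
        (dsum (dsum S (copies (ℓ + finrank K Q) (blockE K 1))) S') := fun S S' ℓ h =>
    (key _ _ (h.trans (TensorIso.dsum_right_comm _ _ _))).trans (TensorIso.dsum_right_comm _ _ _)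
  refine ⟨_, e, h1.prodMap hr, ?_, fun he => ?_, fun he => ?_⟩
  · rw [finrank_prod, finrank_prod, finrank_prod]; omega
  · obtain ⟨g, α, ℓ, hg, h⟩ := h3 he
    exact ⟨g, α, _, hg, key _ _ h⟩
  · rcases h4 he with ⟨g, α, ℓ, hg, h⟩ | ⟨α, ℓ, x, h⟩
    · refine Or.inl ⟨g, α, ℓ + finrank K Q, hg, ?_⟩
      exact h.imp (key2 _ _ _) fun h => h.imp (key2 _ _ _) fun h =>
        h.imp (fun ⟨x, h⟩ => ⟨x, key2 _ _ _ h⟩) (key2 _ _ _)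
    · exact Or.inr ⟨α, _, x, key _ _ h⟩

/-- Zero columns: each of them increases the slack `e` by one. -/
theorem RankDichotomy.prod_zero (Z : Type*) [AddCommGroup Z] [Module K Z]
    [FiniteDimensional K Z] [FiniteDimensional K V] [FiniteDimensional K W]
    {A B : V →ₗ[K] W} (h : RankDichotomy A B) :
    RankDichotomy (A.prodMap (0 : Z →ₗ[K] (Fin 0 → K))) (B.prodMap (0 : Z →ₗ[K] (Fin 0 → K))) := by
  obtain ⟨r, e, h1, h2, h3, h4⟩ := h
  have hZ : ∀ n, finrank K Z = n → PencilRep (0 : Z →ₗ[K] (Fin 0 → K)) 0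
      (0 : Tensor2 K (Fin 0) (Fin n)) := fun n hn =>
    pencilRep_of_finrank_eq_zero _ _ _ (by simpa using hn) (by simp)
  have key : ∀ {ι κ : Type} [Fintype ι] [Fintype κ] (S : Tensor2 K ι κ), finrank K Z = 0 →
      PencilRep A B S →
      PencilRep (A.prodMap (0 : Z →ₗ[K] (Fin 0 → K))) (B.prodMap (0 : Z →ₗ[K] (Fin 0 → K))) S :=
    fun S hz h => (h.dsum (hZ 0 hz)).trans (TensorIso.dsum_empty _ _).symm
  refine ⟨r, e + finrank K Z, h1.prodMap (pencilRankLE_zero 0), ?_, fun he => ?_, fun he => ?_⟩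
  · rw [finrank_prod, finrank_prod, finrank_fin_fun]; omega
  · obtain ⟨g, α, ℓ, hg, h⟩ := h3 (by omega)
    exact ⟨g, α, _, hg, key _ (by omega) h⟩
  · rcases Nat.eq_zero_or_pos (finrank K Z) with hz | hz
    · rcases h4 (by omega) with ⟨g, α, ℓ, hg, h⟩ | ⟨α, ℓ, x, h⟩
      · refine Or.inl ⟨g, α, ℓ, hg, ?_⟩
        exact h.imp (key _ hz) fun h => h.imp (key _ hz) fun h =>
          h.imp (fun ⟨x, h⟩ => ⟨x, key _ hz h⟩) (key _ hz)
      · exact Or.inr ⟨α, _, x, key _ hz h⟩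
    · obtain ⟨g, α, ℓ, hg, h⟩ := h3 (by omega)
      exact Or.inl ⟨g, α, ℓ, hg, Or.inl (h.dsum (hZ 1 (by omega)))⟩

/-- A block `((0, E₂); (E₂, 0))` has rank `3` and increases the slack `e` by one. -/
theorem RankDichotomy.prod_blockE_two [FiniteDimensional K V] [FiniteDimensional K W]
    {A B : V →ₗ[K] W} (h : RankDichotomy A B) :
    RankDichotomy (A.prodMap ((LinearMap.snd K K K).prodMap (LinearMap.id : K →ₗ[K] K)))
      (B.prodMap (LinearMap.fst K (K × K) K)) := by
  obtain ⟨r, e, h1, h2, h3, -⟩ := h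
  have hr : PencilRankLE ((LinearMap.snd K K K).prodMap (LinearMap.id : K →ₗ[K] K))
      (LinearMap.fst K (K × K) K) 3 := by
    let x₁ : (K × K) × K →ₗ[K] K := LinearMap.fst K K K ∘ₗ LinearMap.fst K (K × K) K
    let x₂ : (K × K) × K →ₗ[K] K := LinearMap.snd K K K ∘ₗ LinearMap.fst K (K × K) K
    -- The slices are `(x₂, x₃)` and `(x₁, x₂)`; the products are `x₃ - x₂`, `x₁ - x₂` and `x₂`.
    exact ⟨![(0, 1), (1, 0), (1, 1)], ![LinearMap.snd K (K × K) K - x₂, x₁ - x₂, x₂],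
      ![1, 0, 1], ![0, 1, 1], fun v => by simp [Fin.sum_univ_three, x₂],
      fun v => by simp [Fin.sum_univ_three, x₁, x₂]⟩
  have hrep : PencilRep ((LinearMap.snd K K K).prodMap (LinearMap.id : K →ₗ[K] K))
      (LinearMap.fst K (K × K) K) (blockE K 2) := by
    let b := (Basis.finTwoProd K).prod (Basis.singleton (Fin 1) K)
    refine PencilRep.of_basis (b.reindex (finSumFinEquiv (m := 2) (n := 1)))
      (Basis.finTwoProd K) (fun j => ?_) (fun j => ?_)
    all_goals
      have h0 : (finSumFinEquiv (m := 2) (n := 1)).symm 0 = Sum.inl 0 := rfl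
      have h1 : (finSumFinEquiv (m := 2) (n := 1)).symm 1 = Sum.inl 1 := rfl
      have h2 : (finSumFinEquiv (m := 2) (n := 1)).symm 2 = Sum.inr 0 := rfl
      fin_cases j <;> simp [b, blockE, h0, h1, h2]
  refine ⟨_, e + 1, h1.prodMap hr, ?_, by omega, fun he => ?_⟩
  · simp only [finrank_prod, finrank_self]; omega
  · obtain ⟨g, α, ℓ, hg, h⟩ := h3 (by omega)
    exact Or.inl ⟨g, α, ℓ, hg, Or.inr (Or.inr (Or.inr (h.dsum hrep)))⟩

/-- A block `((0, 1); (1, 0))ᵀ` has rank `2` and increases the slack `e` by one. -/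
theorem RankDichotomy.prod_blockF [FiniteDimensional K V] [FiniteDimensional K W]
    {A B : V →ₗ[K] W} (h : RankDichotomy A B) :
    RankDichotomy (A.prodMap (LinearMap.inr K K K)) (B.prodMap (LinearMap.inl K K K)) := by
  obtain ⟨r, e, h1, h2, h3, -⟩ := h
  have hr : PencilRankLE (LinearMap.inr K K K) (LinearMap.inl K K K) 2 :=
    ⟨![(1, 0), (0, 1)], ![LinearMap.id, LinearMap.id], ![0, 1], ![1, 0],
      fun v => by simp, fun v => by simp⟩
  have hrep : PencilRep (LinearMap.inr K K K) (LinearMap.inl K K K) (blockF K 1) := by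
    refine PencilRep.of_basis (Basis.singleton (Fin 1) K) (Basis.finTwoProd K)
      (fun j => ?_) (fun j => ?_) <;> fin_cases j <;> simp [blockF, blockE]
  refine ⟨_, e + 1, h1.prodMap hr, ?_, by omega, fun he => ?_⟩
  · simp only [finrank_prod, finrank_self]; omega
  · obtain ⟨g, α, ℓ, hg, h⟩ := h3 (by omega)
    exact Or.inl ⟨g, α, ℓ, hg, Or.inr (Or.inl (h.dsum hrep))⟩

end NearMaximal

/-! ### Systems without inputs -/

section Outputs

variable {K X P : Type*} [Field K] [AddCommGroup X] [Module K X]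

/-- A system without inputs and with one output, nonzero and with invariant kernel, splits into a
regular pair and a block `((0, 1); (1, 0))ᵀ`. -/
theorem pencilIso_of_ker_invariant {M : End K X} {c : X →ₗ[K] K} (hc : c ≠ 0)
    (hM : ∀ x ∈ LinearMap.ker c, M x ∈ LinearMap.ker c) :
    PencilIso (M.prod c) (LinearMap.inl K X K)
      ((M.restrict hM).prodMap (LinearMap.inr K K K))
      (LinearMap.id.prodMap (LinearMap.inl K K K)) := by
  obtain ⟨x₀, hx₀⟩ : ∃ x₀, c x₀ = 1 := by
    obtain ⟨y, hy⟩ : ∃ y, c y ≠ 0 := by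
      by_contra! h
      exact hc (LinearMap.ext h)
    exact ⟨(c y)⁻¹ • y, by simp [hy]⟩
  have hk : ∀ w : LinearMap.ker c, c w = 0 := fun w => w.2
  let E : LinearMap.ker c × K →ₗ[K] X :=
    (LinearMap.ker c).subtype.coprod (LinearMap.toSpanSingleton K X x₀)
  have hE : ∀ w a, E (w, a) = w + a • x₀ := fun w a => rfl
  -- The correction by `M x₀` is the output injection that makes the complement invariant.
  let F : LinearMap.ker c × (K × K) →ₗ[K] X × K :=
    ((LinearMap.ker c).subtype.coprod ((LinearMap.toSpanSingleton K X x₀).coprod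
      (LinearMap.toSpanSingleton K X (M x₀)))).prod
      (LinearMap.snd K K K ∘ₗ LinearMap.snd K _ _)
  have hF : ∀ w a b, F (w, (a, b)) = (w + (a • x₀ + b • M x₀), b) := fun w a b => rfl
  have hEb : Function.Bijective E := by
    refine ⟨(injective_iff_map_eq_zero E).2 ?_, fun x => ?_⟩
    · rintro ⟨w, a⟩ h
      rw [hE] at h
      have ha : a = 0 := by simpa [hk, hx₀] using congrArg c h
      subst ha
      simpa using h
    · exact ⟨(⟨x - c x • x₀, by simp [hx₀]⟩, c x), by simp [hE]⟩
  have hFb : Function.Bijective F := by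
    refine ⟨(injective_iff_map_eq_zero F).2 ?_, fun ⟨x, b⟩ => ?_⟩
    · rintro ⟨w, a, b⟩ h
      rw [hF, Prod.mk_eq_zero] at h
      obtain ⟨h, rfl⟩ := h
      have ha : a = 0 := by simpa [hk, hx₀] using congrArg c h
      subst ha
      simpa using h
    · refine ⟨(⟨x - b • M x₀ - c (x - b • M x₀) • x₀, by simp [hx₀]⟩,
        (c (x - b • M x₀), b)), ?_⟩
      rw [hF, Prod.mk.injEq]
      exact ⟨by simp only; abel, rfl⟩
  refine PencilIso.symm ⟨LinearEquiv.ofBijective E hEb, LinearEquiv.ofBijective F hFb,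
    fun ⟨w, a⟩ => ?_, fun ⟨w, a⟩ => ?_⟩
  · simp [hE, hF, hk, hx₀]
  · simp [hE, hF]

variable [AddCommGroup P] [Module K P] [FiniteDimensional K X] [FiniteDimensional K P]
  [Infinite K]

theorem rankDichotomy_regular
    (hcubic : ∀ p : K[X], p.Monic → p.natDegree = 3 → ∃ b, p.IsRoot b) (M : End K X) :
    RankDichotomy M LinearMap.id := by
  obtain ⟨r, e, h1, h2, h3, h4⟩ := exists_regular_bound hcubic M
  refine ⟨r, e, h1, by omega, fun he => ?_, fun he => ?_⟩
  · rcases h3 he with h | ⟨hg, α, h⟩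
    · exact ⟨_, 0, 0, badQuadratic_sq 0, pencilRep_of_finrank_eq_zero _ _ _ (by simp [h]) h⟩
    · exact ⟨_, α, 0, hg, h.trans (TensorIso.dsum_empty _ _)⟩
  · rcases h4 he with ⟨g, α, x, hg, h⟩ | ⟨α, x, h⟩
    · exact Or.inl ⟨g, α, 0, hg, Or.inr (Or.inr (Or.inl ⟨x, h.trans
        ((TensorIso.dsum_empty _ _).dsum (TensorIso.refl _))⟩))⟩
    · exact Or.inr ⟨α, 0, x, h.trans (TensorIso.dsum_empty _ _)⟩

/-- The rank bound for systems without inputs. By transposition, the outputs become inputs, to which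
feedback applies; the bound is missed by at least one unless there is no output, or a single
nonzero one with invariant kernel. -/
theorem rankDichotomy_outputs
    (hcubic : ∀ p : K[X], p.Monic → p.natDegree = 3 → ∃ b, p.IsRoot b) (M : End K X)
    (c : X →ₗ[K] P) : RankDichotomy (M.prod c) (LinearMap.inl K X P) := by
  by_cases hP : finrank K P = 0
  · have := finrank_zero_iff.1 hP
    have : Unique P := uniqueOfSubsingleton 0
    exact (rankDichotomy_regular hcubic M).of_iso ⟨LinearEquiv.refl K X,
      LinearEquiv.prodUnique, fun v => rfl, fun v => rfl⟩
  by_cases hF : finrank K P = 1 ∧ c ≠ 0 ∧ ∀ x ∈ LinearMap.ker c, M x ∈ LinearMap.ker c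
  · obtain ⟨hP1, hc, hM⟩ := hF
    let e : P ≃ₗ[K] K := LinearEquiv.ofFinrankEq P K (by simp [hP1])
    have hker : LinearMap.ker (e.toLinearMap ∘ₗ c) = LinearMap.ker c := by ext; simp
    have hM' : ∀ x ∈ LinearMap.ker (e.toLinearMap ∘ₗ c),
        M x ∈ LinearMap.ker (e.toLinearMap ∘ₗ c) := by rwa [hker]
    have h := (rankDichotomy_regular hcubic (M.restrict hM')).prod_blockF.of_iso
      (pencilIso_of_ker_invariant (fun h => hc ?_) hM')
    · exact h.of_iso ⟨LinearEquiv.refl K X, (LinearEquiv.refl K X).prodCongr e,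
        fun v => rfl, fun v => by simp⟩
    · ext x
      simpa using LinearMap.congr_fun h x
  -- In the other cases the dual system gives a smaller rank.
  obtain ⟨N, S, W, hN, hUS, -, hMS, hSW, hW, hS, hr⟩ :=
    exists_isCompl_reachable (M.dualMap : End K (Dual K X)) (LinearMap.range c.dualMap)
  obtain ⟨r, e, hrW, hre, -, -⟩ := rankDichotomy_regular (X := W) hcubic (N.restrict hW)
  have hsys := pencilRankLE_sys (c := (0 : Dual K X →ₗ[K] (Fin 0 → K))) hN hSW (by simp) hS hW hr
    (r := r) (by
      convert PencilRankLE.comp (W' := W × (Fin 0 → K)) hrW (LinearMap.inl K W (Fin 0 → K))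
        LinearMap.id using 1 <;> rfl)
  have hrank : PencilRankLE (M.prod c) (LinearMap.inl K X P)
      (finrank K (LinearMap.range c.dualMap) + (finrank K S + r)) := by
    refine PencilRankLE.of_dualMap ?_
    convert hsys.comp (LinearMap.fst K _ _)
      ((LinearMap.inl K X P).dualMap.prod (LinearMap.inr K X P).dualMap) using 1
    · refine LinearMap.ext fun η => LinearMap.ext fun x => ?_
      change η (M x, c x) = η (M x, 0) + η (0, c x)
      rw [← map_add]
      simp
    · rfl
  have hdim := Submodule.finrank_add_eq_of_isCompl hSW
  rw [Subspace.dual_finrank_eq] at hdim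
  have hle := Submodule.finrank_mono hUS
  have hleP := LinearMap.finrank_range_le c.dualMap
  rw [Subspace.dual_finrank_eq] at hleP
  obtain ⟨e', he'⟩ := Nat.exists_eq_add_of_le
    (show 2 * (finrank K (LinearMap.range c.dualMap) + (finrank K S + r)) ≤
      2 * finrank K (X × P) + finrank K X by rw [finrank_prod]; omega)
  by_cases h2 : 2 ≤ e'
  · exact ⟨_, e', hrank, he'.symm, by omega, by omega⟩
  exfalso
  rw [finrank_prod] at he'
  refine hF ⟨by omega, ?_, fun x hx => ?_⟩
  · rintro rfl
    have : finrank K (LinearMap.range (0 : X →ₗ[K] P).dualMap) = 0 := by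
      rw [LinearMap.finrank_range_dualMap_eq_finrank_range]; simp
    omega
  · have hUeq := Submodule.eq_of_le_of_finrank_eq hUS (by omega)
    rw [LinearMap.mem_ker, ← Module.forall_dual_apply_eq_zero_iff K]
    intro π
    obtain ⟨π', hπ'⟩ : M.dualMap (c.dualMap π) ∈ LinearMap.range c.dualMap := by
      rw [hUeq]
      exact hMS _ (hUS ⟨π, rfl⟩)
    have h3 := LinearMap.congr_fun hπ' x
    simp only [LinearMap.dualMap_apply, LinearMap.mem_ker.1 hx, map_zero] at h3
    exact h3.symm

end Outputs

/-! ### Systems with inputs -/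

section Inputs

variable {K X Q P : Type*} [Field K] [AddCommGroup X] [Module K X] [AddCommGroup Q] [Module K Q]
  [AddCommGroup P] [Module K P]

/-- If the image of the inputs is invariant, then the inputs split off as blocks
`((0, 1); (1, 0))`. -/
theorem pencilIso_of_range_invariant {M : X →ₗ[K] X} {b : Q →ₗ[K] X} {c : X →ₗ[K] P}
    (hb : Function.Injective b) (hM : ∀ y, M (b y) ∈ LinearMap.range b) (hcb : ∀ y, c (b y) = 0) :
    ∃ (W : Submodule K X) (N : X →ₗ[K] X) (hW : ∀ x ∈ W, N x ∈ W),
      PencilIso (sysA M b c) (sysB K X Q P)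
        (((N.restrict hW).prod (c ∘ₗ W.subtype)).prodMap (LinearMap.snd K Q Q))
        ((LinearMap.inl K W P).prodMap (LinearMap.fst K Q Q)) := by
  obtain ⟨θ, hθ⟩ := LinearMap.exists_leftInverse_of_injective b (LinearMap.ker_eq_bot.2 hb)
  replace hθ : ∀ y, θ (b y) = y := fun y => LinearMap.congr_fun hθ y
  have hMb : ∀ y, b (θ (M (b y))) = M (b y) := fun y => by
    obtain ⟨z, hz⟩ := hM y
    rw [← hz, hθ]
  have hW : ∀ x ∈ LinearMap.ker θ, (M - b ∘ₗ θ ∘ₗ M) x ∈ LinearMap.ker θ := fun x _ => by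
    simp [hθ]
  refine ⟨LinearMap.ker θ, M - b ∘ₗ θ ∘ₗ M, hW, PencilIso.symm ?_⟩
  -- The last component is the new input `u + θ (M x)`, which gives the coordinate along `b` of the
  -- first slice.
  let E : LinearMap.ker θ × (Q × Q) →ₗ[K] X × Q :=
    LinearMap.prod ((LinearMap.ker θ).subtype.coprod (b ∘ₗ LinearMap.fst K Q Q))
      (LinearMap.coprod 0 (LinearMap.snd K Q Q) -
        θ ∘ₗ M ∘ₗ (LinearMap.ker θ).subtype.coprod (b ∘ₗ LinearMap.fst K Q Q))
  have hE : ∀ w y z, E (w, (y, z)) = (w + b y, z - θ (M (w + b y))) := fun w y z => by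
    simp [E]
  let F : (LinearMap.ker θ × P) × Q →ₗ[K] X × P :=
    (((LinearMap.ker θ).subtype.prodMap LinearMap.id).coprod (LinearMap.inl K X P ∘ₗ b))
  have hF : ∀ w p y, F ((w, p), y) = (w + b y, p) := fun w p y => by simp [F]
  have hk : ∀ w : LinearMap.ker θ, θ w = 0 := fun w => w.2
  have hEb : Function.Bijective E := by
    refine ⟨(injective_iff_map_eq_zero E).2 ?_, fun ⟨x, u⟩ => ?_⟩
    · rintro ⟨w, y, z⟩ h
      rw [hE, Prod.mk_eq_zero] at h
      obtain ⟨h, h'⟩ := h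
      have hy : y = 0 := by simpa [hk, hθ] using congrArg θ h
      rw [h] at h'
      subst hy
      simpa using And.intro h h'
    · refine ⟨(⟨x - b (θ x), by simp [hθ]⟩, (θ x, u + θ (M x))), ?_⟩
      rw [hE]
      simp
  have hFb : Function.Bijective F := by
    refine ⟨(injective_iff_map_eq_zero F).2 ?_, fun ⟨x, p⟩ => ?_⟩
    · rintro ⟨⟨w, p⟩, y⟩ h
      rw [hF, Prod.mk_eq_zero] at h
      obtain ⟨h, rfl⟩ := h
      have hy : y = 0 := by simpa [hk, hθ] using congrArg θ h
      subst hy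
      simpa using h
    · refine ⟨((⟨x - b (θ x), by simp [hθ]⟩, p), θ x), ?_⟩
      rw [hF]
      simp
  refine ⟨LinearEquiv.ofBijective E hEb, LinearEquiv.ofBijective F hFb, ?_, ?_⟩
  · rintro ⟨w, y, z⟩
    simp [hE, hF, hcb, hMb]
    abel
  · rintro ⟨w, y, z⟩
    simp [hE, hF]

/-- If the reachable space exceeds the image of the inputs by one dimension, then one block
`((0, E₂); (E₂, 0))` splits off, and blocks `((0, 1); (1, 0))` for the other inputs. Here `φ`
is a functional on the states that sees just the additional dimension of the reachable space
`S`. -/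
theorem pencilIso_of_range_codim_one {M : X →ₗ[K] X} {b : Q →ₗ[K] X} {c : X →ₗ[K] P}
    {S : Submodule K X} (hb : Function.Injective b) (hMS : ∀ x ∈ S, M x ∈ S)
    (hbS : ∀ y, b y ∈ S) (hcS : ∀ x ∈ S, c x = 0) (φ : X →ₗ[K] K) (hφb : ∀ y, φ (b y) = 0)
    (hφ : ∀ x ∈ S, φ x = 0 → x ∈ LinearMap.range b) (y₁ : Q) (hy₁ : φ (M (b y₁)) = 1) :
    ∃ (W : Submodule K X) (N : X →ₗ[K] X) (hW : ∀ x ∈ W, N x ∈ W) (Q' : Submodule K Q),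
      PencilIso (sysA M b c) (sysB K X Q P)
        ((((N.restrict hW).prod (c ∘ₗ W.subtype)).prodMap (LinearMap.snd K Q' Q')).prodMap
          ((LinearMap.snd K K K).prodMap (LinearMap.id : K →ₗ[K] K)))
        (((LinearMap.inl K W P).prodMap (LinearMap.fst K Q' Q')).prodMap
          (LinearMap.fst K (K × K) K)) := by
  obtain ⟨θ₀, hθ₀⟩ := LinearMap.exists_leftInverse_of_injective b (LinearMap.ker_eq_bot.2 hb)
  replace hθ₀ : ∀ y, θ₀ (b y) = y := fun y => LinearMap.congr_fun hθ₀ y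
  let f : X →ₗ[K] K := φ ∘ₗ M
  have hf : ∀ x, f x = φ (M x) := fun x => rfl
  let Q' := LinearMap.ker (f ∘ₗ b)
  let π : Q →ₗ[K] Q' := LinearMap.codRestrict Q'
    (LinearMap.id - (f ∘ₗ b).smulRight y₁) (fun y => by simp [Q', hf, hy₁])
  have hπ : ∀ y, (π y : Q) = y - f (b y) • y₁ := fun y => rfl
  have hQ' : ∀ z : Q', f (b z) = 0 := fun z => z.2
  have hπQ : ∀ z : Q', π z = z := fun z => Subtype.ext (by rw [hπ, hQ', zero_smul, sub_zero])
  have hπ1 : π y₁ = 0 := Subtype.ext (by rw [hπ, hf, hy₁, one_smul, sub_self]; rfl)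
  let θ : X →ₗ[K] Q' := π ∘ₗ θ₀
  have hθ : ∀ y, θ (b y) = π y := fun y => by simp [θ, hθ₀]
  -- Feedback makes `f` and `θ` vanish on the range of the operator.
  let N : X →ₗ[K] X := M - f.smulRight (b y₁) ∘ₗ M - b ∘ₗ Q'.subtype ∘ₗ θ ∘ₗ M
  have hN : ∀ x, N x = M x - f (M x) • b y₁ - b (θ (M x)) := fun x => rfl
  have hφN : ∀ x, φ (N x) = f x := fun x => by simp [hN, hφb, hf]
  have hfN : ∀ x, f (N x) = 0 := fun x => by
    have h1 : f (b y₁) = 1 := hy₁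
    simp [hN, h1, hQ']
  have hθN : ∀ x, θ (N x) = 0 := fun x => by simp [hN, hθ, hπ1, hπQ]
  have hNS : ∀ x ∈ S, N x ∈ S := fun x hx => by
    rw [hN]
    exact S.sub_mem (S.sub_mem (hMS x hx) (S.smul_mem _ (hbS _))) (hbS _)
  have hzero : ∀ x ∈ S, φ x = 0 → f x = 0 → θ x = 0 → x = 0 := by
    intro x hx h1 h2 h3
    obtain ⟨y, rfl⟩ := hφ x hx h1
    rw [hθ] at h3
    have := hπ y
    rw [h3, h2, zero_smul, sub_zero] at this
    rw [← this]; simp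
  let w₁ := N (b y₁)
  have hf1 : f (b y₁) = 1 := hy₁
  have hφw : φ w₁ = 1 := by rw [hφN, hf1]
  have hfw : f w₁ = 0 := hfN _
  have hθw : θ w₁ = 0 := hθN _
  have hwS : w₁ ∈ S := hNS _ (hbS _)
  have hNw : N w₁ = 0 := hzero _ (hNS _ hwS) (by rw [hφN, hfw]) (hfN _) (hθN _)
  have hNz : ∀ z : Q', N (b z) = 0 := fun z =>
    hzero _ (hNS _ (hbS _)) (by rw [hφN, hQ']) (hfN _) (hθN _)
  let W := LinearMap.ker φ ⊓ LinearMap.ker f ⊓ LinearMap.ker θ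
  have hWm : ∀ x, x ∈ W ↔ (φ x = 0 ∧ f x = 0) ∧ θ x = 0 := fun x => Iff.rfl
  have hW : ∀ x ∈ W, N x ∈ W := fun x hx => by
    rw [hWm] at hx ⊢
    exact ⟨⟨by rw [hφN, hx.1.2], hfN x⟩, hθN x⟩
  have hW1 : ∀ w : W, φ w = 0 := fun w => w.2.1.1
  have hW2 : ∀ w : W, f w = 0 := fun w => w.2.1.2
  have hW3 : ∀ w : W, θ w = 0 := fun w => w.2.2
  have hθ1 : θ (b y₁) = 0 := by rw [hθ, hπ1]
  have hθz : ∀ z : Q', θ (b z) = z := fun z => by rw [hθ, hπQ]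
  refine ⟨W, N, hW, Q', PencilIso.symm ?_⟩
  -- The states, in coordinates adapted to the splitting.
  let G : (W × Q') × (K × K) →ₗ[K] X :=
    (W.subtype.coprod (b ∘ₗ Q'.subtype)).coprod
      ((LinearMap.toSpanSingleton K X w₁).coprod (LinearMap.toSpanSingleton K X (b y₁)))
  have hG : ∀ w z s t, G ((w, z), (s, t)) = (w + b z) + (s • w₁ + t • b y₁) :=
    fun w z s t => rfl
  have hφG : ∀ w z s t, φ (G ((w, z), (s, t))) = s := fun w z s t => by
    simp [hG, hW1, hφb, hφw]
  have hfG : ∀ w z s t, f (G ((w, z), (s, t))) = t := fun w z s t => by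
    simp [hG, hW2, hQ', hfw, hf1]
  have hθG : ∀ w z s t, θ (G ((w, z), (s, t))) = z := fun w z s t => by
    simp [hG, hW3, hθz, hθw, hθ1]
  have hG0 : ∀ w z s t, G ((w, z), (s, t)) = 0 → w = 0 ∧ z = 0 ∧ s = 0 ∧ t = 0 := by
    intro w z s t h
    have h1 := hφG w z s t
    have h2 := hfG w z s t
    have h3 := hθG w z s t
    rw [h, map_zero] at h1 h2 h3
    subst h1 h2 h3
    exact ⟨by simpa [hG] using h, rfl, rfl, rfl⟩
  have hGs : ∀ x, ∃ w : W, G ((w, θ x), (φ x, f x)) = x := by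
    intro x
    refine ⟨⟨x - b (θ x) - φ x • w₁ - f x • b y₁, ?_⟩, ?_⟩
    · rw [hWm]
      simp [hφb, hφw, hQ', hfw, hf1, hθz, hθw, hθ1]
    · rw [hG]
      simp only
      abel
  have hNG : ∀ w z s t, N (G ((w, z), (s, t))) = N w + t • w₁ := fun w z s t => by
    simp only [hG, map_add, map_smul, hNz, hNw, smul_zero, add_zero, zero_add]
    rfl
  let E : (W × (Q' × Q')) × ((K × K) × K) →ₗ[K] X × Q :=
    LinearMap.prod (G ∘ₗ LinearMap.prod
        ((LinearMap.id.prodMap (LinearMap.fst K Q' Q')) ∘ₗ LinearMap.fst K _ _)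
        (LinearMap.fst K (K × K) K ∘ₗ LinearMap.snd K _ _))
      ((Q'.subtype ∘ₗ LinearMap.snd K Q' Q' ∘ₗ LinearMap.snd K _ _).coprod
        (LinearMap.toSpanSingleton K Q y₁ ∘ₗ LinearMap.snd K (K × K) K) -
        ((f.smulRight y₁ + Q'.subtype ∘ₗ θ) ∘ₗ M ∘ₗ G ∘ₗ LinearMap.prod
        ((LinearMap.id.prodMap (LinearMap.fst K Q' Q')) ∘ₗ LinearMap.fst K _ _)
        (LinearMap.fst K (K × K) K ∘ₗ LinearMap.snd K _ _)))
  have hE : ∀ w z z' s t a, E ((w, (z, z')), ((s, t), a)) = (G ((w, z), (s, t)),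
      z' + a • y₁ - (f (M (G ((w, z), (s, t)))) • y₁ + θ (M (G ((w, z), (s, t)))))) :=
    fun _ _ _ _ _ _ => rfl
  let F : ((W × P) × Q') × (K × K) →ₗ[K] X × P :=
    LinearMap.prod (G ∘ₗ
        ((LinearMap.fst K W P).prodMap LinearMap.id).prodMap LinearMap.id)
      (LinearMap.snd K W P ∘ₗ LinearMap.fst K _ _ ∘ₗ LinearMap.fst K _ _)
  have hF : ∀ w p z s t, F (((w, p), z), (s, t)) = (G ((w, z), (s, t)), p) :=
    fun _ _ _ _ _ => rfl
  have hEb : Function.Bijective E := by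
    refine ⟨(injective_iff_map_eq_zero E).2 ?_, fun ⟨x, u⟩ => ?_⟩
    · rintro ⟨⟨w, z, z'⟩, ⟨s, t⟩, a⟩ h
      rw [hE, Prod.mk_eq_zero] at h
      obtain ⟨h, h'⟩ := h
      rw [h] at h'
      obtain ⟨rfl, rfl, rfl, rfl⟩ := hG0 _ _ _ _ h
      simp only [map_zero, zero_smul, ZeroMemClass.coe_zero, add_zero, sub_zero] at h'
      have ha : a = 0 := by
        have := congrArg (f ∘ₗ b) h'
        simpa [hQ', hf1] using this
      subst ha
      have hz : z' = 0 := Subtype.ext (by simpa using h')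
      subst hz
      rfl
    · obtain ⟨w, hw⟩ := hGs x
      refine ⟨((w, (θ x, π u + θ (M x))), ((φ x, f x), f (b u) + f (M x))), ?_⟩
      rw [hE, hw, Prod.mk.injEq]
      refine ⟨rfl, ?_⟩
      rw [Submodule.coe_add, hπ, add_smul]
      abel
  have hFb : Function.Bijective F := by
    refine ⟨(injective_iff_map_eq_zero F).2 ?_, fun ⟨x, p⟩ => ?_⟩
    · rintro ⟨⟨⟨w, p⟩, z⟩, ⟨s, t⟩⟩ h
      rw [hF, Prod.mk_eq_zero] at h
      obtain ⟨h, rfl⟩ := h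
      obtain ⟨rfl, rfl, rfl, rfl⟩ := hG0 _ _ _ _ h
      rfl
    · obtain ⟨w, hw⟩ := hGs x
      exact ⟨(((w, p), θ x), (φ x, f x)), by rw [hF, hw]⟩
  refine ⟨LinearEquiv.ofBijective E hEb, LinearEquiv.ofBijective F hFb, ?_, ?_⟩
  · rintro ⟨⟨w, z, z'⟩, ⟨s, t⟩, a⟩
    have hcG : c (G ((w, z), (s, t))) = c w := by
      rw [hG]
      simp [hcS _ hwS, hcS _ (hbS _)]
    change F (((N.restrict hW w, c w), z'), (t, a)) = sysA M b c (E ((w, (z, z')), ((s, t), a)))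
    rw [hF, hE, sysA_apply, hcG, Prod.mk.injEq]
    refine ⟨?_, rfl⟩
    have h1 := hNG w z s t
    rw [hN] at h1
    rw [hG, LinearMap.coe_restrict_apply, eq_sub_of_add_eq h1.symm]
    simp only [map_add, map_sub, map_smul]
    abel
  · rintro ⟨⟨w, z, z'⟩, ⟨s, t⟩, a⟩
    change F (((w, 0), z), (s, t)) = sysB K X Q P (E ((w, (z, z')), ((s, t), a)))
    rw [hF, hE, sysB_apply]

end Inputs

section Systems

variable {K X Q P : Type*} [Field K] [AddCommGroup X] [Module K X] [AddCommGroup Q] [Module K Q]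
  [AddCommGroup P] [Module K P] [FiniteDimensional K X] [FiniteDimensional K Q]
  [FiniteDimensional K P] [Infinite K]

/-- The rank bound for systems with vanishing Markov parameters and independent inputs. Write `S` for
the reachable space, which lies in the kernel of the outputs. Splitting off `S` increases the slack
by `dim S - dim Q`; if this difference is `0` or `1`, blocks `((0, 1); (1, 0))` and
`((0, E₂); (E₂, 0))` split off. -/
theorem rankDichotomy_sys_of_injective
    (hcubic : ∀ p : K[X], p.Monic → p.natDegree = 3 → ∃ b, p.IsRoot b) (M : End K X)
    (b : Q →ₗ[K] X) (c : X →ₗ[K] P) (hb : Function.Injective b)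
    (hc : ∀ (i : ℕ) y, c ((M ^ i) (b y)) = 0) : RankDichotomy (sysA M b c) (sysB K X Q P) := by
  obtain ⟨N, S, W, hN, hUS, hmin, hMS, hSW, hW, hS, hr⟩ :=
    exists_isCompl_reachable M (LinearMap.range b)
  have hbS : ∀ y, b y ∈ S := fun y => hUS ⟨y, rfl⟩
  have hcS : ∀ x ∈ S, c x = 0 := by
    let Z : Submodule K X := ⨅ i : ℕ, LinearMap.ker (c ∘ₗ (M ^ i : End K X))
    have hZ : ∀ x, x ∈ Z ↔ ∀ i : ℕ, c ((M ^ i) x) = 0 := fun x => by simp [Z]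
    have hSZ : S ≤ Z := by
      refine hmin Z ?_ fun x hx => ?_
      · rintro _ ⟨y, rfl⟩
        exact (hZ _).2 fun i => hc i y
      · rw [hZ] at hx ⊢
        intro i
        rw [← End.mul_apply, ← pow_succ]
        exact hx (i + 1)
    exact fun x hx => by simpa using (hZ x).1 (hSZ hx) 0
  have hq : finrank K (LinearMap.range b) = finrank K Q := LinearMap.finrank_range_of_inj hb
  have hle := Submodule.finrank_mono hUS
  have hdim := Submodule.finrank_add_eq_of_isCompl hSW
  by_cases h0 : finrank K S = finrank K Q
  · have hUeq := Submodule.eq_of_le_of_finrank_eq hUS (by omega)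
    obtain ⟨W', N', hW', hiso⟩ := pencilIso_of_range_invariant (c := c) hb
      (fun y => by rw [hUeq]; exact hMS _ (hbS y)) (fun y => hcS _ (hbS y))
    exact ((rankDichotomy_outputs (X := W') hcubic (N'.restrict hW')
      (c ∘ₗ W'.subtype)).prod_blockE Q).of_iso hiso
  by_cases h1 : finrank K S = finrank K Q + 1
  · have hne : LinearMap.range b ≠ S := fun h => by rw [h] at hq; omega
    obtain ⟨x₀, hx₀S, hx₀⟩ := SetLike.exists_of_lt (lt_of_le_of_ne hUS hne)
    obtain ⟨φ, hφ0, hφ⟩ := Submodule.exists_dual_map_eq_bot_of_notMem hx₀ inferInstance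
    have hφb : ∀ y, φ (b y) = 0 := fun y => by
      have : φ (b y) ∈ (LinearMap.range b).map φ := ⟨b y, ⟨y, rfl⟩, rfl⟩
      rw [hφ] at this
      simpa using this
    have hφS : ∀ x ∈ S, φ x = 0 → x ∈ LinearMap.range b := by
      have hlt : S ⊓ LinearMap.ker φ < S :=
        lt_of_le_of_ne inf_le_left fun h => hφ0 (by rw [← h] at hx₀S; exact hx₀S.2)
      have hlt' := Submodule.finrank_lt_finrank_of_lt hlt
      have hle' : LinearMap.range b ≤ S ⊓ LinearMap.ker φ := by
        rintro _ ⟨y, rfl⟩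
        exact ⟨hbS y, hφb y⟩
      have := Submodule.eq_of_le_of_finrank_le hle' (by omega)
      intro x hx h
      rw [this]
      exact ⟨hx, h⟩
    obtain ⟨y₀, hy₀⟩ : ∃ y, φ (M (b y)) ≠ 0 := by
      by_contra! h
      refine hne (le_antisymm hUS (hmin _ le_rfl ?_))
      rintro _ ⟨y, rfl⟩
      exact hφS _ (hMS _ (hbS y)) (h y)
    obtain ⟨W', N', hW', Q', hiso⟩ := pencilIso_of_range_codim_one hb hMS hbS hcS φ hφb hφS
      ((φ (M (b y₀)))⁻¹ • y₀) (by simp [hy₀])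
    exact ((rankDichotomy_outputs (X := W') hcubic (N'.restrict hW')
      (c ∘ₗ W'.subtype)).prod_blockE Q').prod_blockE_two.of_iso hiso
  · obtain ⟨r, e, hrW, hre, -, -⟩ :=
      rankDichotomy_outputs (X := W) hcubic (N.restrict hW) (c ∘ₗ W.subtype)
    rw [finrank_prod] at hre
    refine ⟨_, finrank K S - finrank K Q + e, pencilRankLE_sys hN hSW hcS hS hW hr hrW, ?_,
      by omega, by omega⟩
    rw [finrank_prod, finrank_prod]
    omega

/-- Inputs in the kernel of `b` are zero columns. -/
theorem rankDichotomy_sys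
    (hcubic : ∀ p : K[X], p.Monic → p.natDegree = 3 → ∃ b, p.IsRoot b) (M : End K X)
    (b : Q →ₗ[K] X) (c : X →ₗ[K] P) (hc : ∀ (i : ℕ) y, c ((M ^ i) (b y)) = 0) :
    RankDichotomy (sysA M b c) (sysB K X Q P) := by
  obtain ⟨Q', hQ'⟩ := (LinearMap.ker b).exists_isCompl
  have hinj : Function.Injective (b ∘ₗ Q'.subtype) := by
    rw [← LinearMap.ker_eq_bot, LinearMap.ker_eq_bot']
    intro y hy
    exact Subtype.ext (Submodule.disjoint_def.1 hQ'.disjoint y hy y.2)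
  have h := (rankDichotomy_sys_of_injective hcubic M (b ∘ₗ Q'.subtype) c hinj
    fun i y => hc i y).prod_zero (LinearMap.ker b)
  refine h.of_iso (PencilIso.symm ⟨(LinearEquiv.prodAssoc K X Q' (LinearMap.ker b)).trans
    ((LinearEquiv.refl K X).prodCongr (Submodule.prodEquivOfIsCompl _ _ hQ'.symm)),
    LinearEquiv.prodUnique, ?_, ?_⟩)
  · rintro ⟨⟨x, y⟩, z⟩
    simp
  · rintro ⟨⟨x, y⟩, z⟩
    simp

end Systems

/-! ### Pencils whose second slice has the largest rank -/

section Transfer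

variable {K ι : Type*} [Field K] [Infinite K] [Fintype ι] [DecidableEq ι]

/-- If the rational function `α - s f (1 + s M)⁻¹ x` of `s` vanishes, then so do the coefficients of
its expansion at `s = 0`. The denominator `det (1 + s M)` is cleared in the hypothesis. -/
theorem dotProduct_pow_mulVec_eq_zero (M : Matrix ι ι K) (f x : ι → K) (α : K)
    (h : ∀ s : K, s ≠ 0 → (1 + s • M).det ≠ 0 →
      (1 + s • M).det * α = s * (f ⬝ᵥ ((1 + s • M).adjugate.mulVec x))) :
    α = 0 ∧ ∀ i : ℕ, f ⬝ᵥ ((M ^ i).mulVec x) = 0 := by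
  let T : Matrix ι ι K[X] := 1 + (Polynomial.X : K[X]) • M.map C
  let x' : ι → K[X] := fun i => C (x i)
  let H : (ι → K) → K[X] := fun f => (fun i => C (f i)) ⬝ᵥ (T.adjugate.mulVec x')
  have hT : ∀ s, (evalRingHom s).mapMatrix T = 1 + s • M := fun s => by
    ext i j
    by_cases hij : i = j <;> simp [T, hij] <;> exact mul_comm _ _
  have hdet : ∀ s, T.det.eval s = (1 + s • M).det := fun s => by
    rw [← hT, ← RingHom.map_det]; rfl
  have hH : ∀ f s, (H f).eval s = f ⬝ᵥ ((1 + s • M).adjugate.mulVec x) := fun f s => by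
    rw [← hT, ← RingHom.map_adjugate]
    simp [H, x', dotProduct, Matrix.mulVec, eval_finsetSum]
  have hdet0 : T.det ≠ 0 := fun h0 => by
    have := hdet 0
    simp [h0] at this
  have hpoly : C α * T.det = Polynomial.X * H f := by
    have hz : (C α * T.det - Polynomial.X * H f) * (Polynomial.X * T.det) = 0 := by
      refine Polynomial.funext fun s => ?_
      by_cases hs : s = 0
      · simp [hs]
      by_cases hd : T.det.eval s = 0
      · simp [hd]
      have := h s hs (by rwa [← hdet])
      simp only [eval_mul, eval_sub, eval_C, eval_X, hH, hdet, eval_zero]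
      rw [mul_comm α, this, sub_self, zero_mul]
    exact sub_eq_zero.1 ((mul_eq_zero.1 hz).resolve_right (mul_ne_zero X_ne_zero hdet0))
  have hα : α = 0 := by
    have := congrArg (eval 0) hpoly
    simpa [hdet] using this
  have hf0 : H f = 0 := by
    rw [hα, map_zero, zero_mul, eq_comm] at hpoly
    exact (mul_eq_zero.1 hpoly).resolve_left X_ne_zero
  -- Multiply by `T` to pass from `f` to `f M`.
  have hstep : ∀ f, H f = 0 → f ⬝ᵥ x = 0 ∧ H (Matrix.vecMul f M) = 0 := by
    intro f hf
    have h0 : f ⬝ᵥ x = 0 := by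
      have := hH f 0
      simpa [hf] using this.symm
    refine ⟨h0, ?_⟩
    have h1 : (fun i => C (f i)) ⬝ᵥ ((T * T.adjugate).mulVec x') =
        H f + Polynomial.X * H (Matrix.vecMul f M) := by
      have h2 : Matrix.vecMul (fun i => C (f i)) (M.map C) =
          fun i => C (Matrix.vecMul f M i) := by
        ext1 i
        simp [Matrix.vecMul, dotProduct]
      rw [← Matrix.mulVec_mulVec, Matrix.dotProduct_mulVec]
      simp only [T, Matrix.vecMul_add, Matrix.vecMul_one, add_dotProduct, Matrix.vecMul_smul,
        smul_dotProduct, h2, smul_eq_mul, H]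
    have h3 : (fun i => C (f i)) ⬝ᵥ x' = C (f ⬝ᵥ x) := by simp [x', dotProduct]
    rw [Matrix.mul_adjugate, Matrix.smul_mulVec, Matrix.one_mulVec, dotProduct_smul, h3, h0, hf,
      map_zero, smul_zero, zero_add, eq_comm] at h1
    exact (mul_eq_zero.1 h1).resolve_left X_ne_zero
  refine ⟨hα, fun i => ?_⟩
  have hall : ∀ i : ℕ, H (Matrix.vecMul f (M ^ i)) = 0 := by
    intro i
    induction i with
    | zero => simpa using hf0
    | succ i ih => rw [pow_succ, ← Matrix.vecMul_vecMul]; exact (hstep _ ih).2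
  rw [Matrix.dotProduct_mulVec]
  exact (hstep _ (hall i)).1

/-- If `(x, 0)` has the largest rank in the pencil `(x + s (M x + b u), s (c x + a u))`, then `a`
and all the Markov parameters `c Mⁱ b` vanish. -/
theorem markov_eq_zero {Q P : Type*} [AddCommGroup Q] [Module K Q] [AddCommGroup P] [Module K P]
    [FiniteDimensional K Q] [FiniteDimensional K P]
    (M : End K (ι → K)) (b : Q →ₗ[K] (ι → K)) (c : (ι → K) →ₗ[K] P) (a : Q →ₗ[K] P)
    (h : ∀ s : K, finrank K (LinearMap.range (sysB K (ι → K) Q P +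
      s • (M.coprod b).prod (c.coprod a))) ≤ Fintype.card ι) :
    a = 0 ∧ ∀ (i : ℕ) y, c ((M ^ i) (b y)) = 0 := by
  have key : ∀ (g : Dual K P) (u : Q), g (a u) = 0 ∧ ∀ i : ℕ, g (c ((M ^ i) (b u))) = 0 := by
    intro g u
    let m := LinearMap.toMatrix' M
    have hm : ∀ x, M x = m.mulVec x := fun x => (LinearMap.toMatrix'_mulVec M x).symm
    let f : ι → K := fun i => g (c (Pi.single i 1))
    have hf : ∀ x, g (c x) = f ⬝ᵥ x := fun x => by
      have := (g ∘ₗ c).pi_apply_eq_sum_univ x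
      simp only [LinearMap.comp_apply, smul_eq_mul] at this
      rw [this, dotProduct]
      refine Finset.sum_congr rfl fun i _ => ?_
      rw [mul_comm]
      congr 3
      ext j
      simp [Pi.single_apply, eq_comm]
    have hpow : ∀ (i : ℕ) x, (M ^ i) x = (m ^ i).mulVec x := by
      intro i
      induction i with
      | zero => simp
      | succ i ih =>
        intro x
        rw [pow_succ', End.mul_apply, ih, hm, Matrix.mulVec_mulVec, pow_succ']
    have := dotProduct_pow_mulVec_eq_zero m f (b u) (g (a u)) fun s hs hd => ?_
    · exact ⟨this.1, fun i => by rw [hf, hpow]; exact this.2 i⟩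
    let L := sysB K (ι → K) Q P + s • (M.coprod b).prod (c.coprod a)
    have hL : ∀ x y, L (x, y) = (x + s • (M x + b y), s • (c x + a y)) := fun x y => by
      simp [L]
    have hL1 : ∀ x, x + s • M x = (1 + s • m).mulVec x := fun x => by
      rw [Matrix.add_mulVec, Matrix.one_mulVec, Matrix.smul_mulVec, hm]
    -- The projection of the range to the states is onto, hence injective.
    let π := LinearMap.fst K (ι → K) P ∘ₗ (LinearMap.range L).subtype
    have hsurj : Function.Surjective π := fun x => by
      refine ⟨⟨_, ⟨((1 + s • m)⁻¹.mulVec x, 0), rfl⟩⟩, ?_⟩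
      change (L ((1 + s • m)⁻¹.mulVec x, 0)).1 = x
      rw [hL, map_zero, add_zero]
      change _ + s • M _ = x
      rw [hL1, Matrix.mulVec_mulVec, Matrix.mul_nonsing_inv _ (isUnit_iff_ne_zero.2 hd),
        Matrix.one_mulVec]
    have hfin : finrank K (LinearMap.range L) = finrank K (ι → K) := by
      refine le_antisymm ?_ (LinearMap.finrank_le_finrank_of_surjective hsurj)
      rw [finrank_fintype_fun_eq_card]
      exact h s
    have hinj := (LinearMap.injective_iff_surjective_of_finrank_eq_finrank hfin).2 hsurj
    -- The states and inputs `v` are chosen such that the state component of `L v` vanishes.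
    let v : (ι → K) × Q := (-(s • (1 + s • m).adjugate.mulVec (b u)), (1 + s • m).det • u)
    have hv1 : (L v).1 = 0 := by
      change (L (-(s • (1 + s • m).adjugate.mulVec (b u)), (1 + s • m).det • u)).1 = 0
      rw [hL, smul_add, ← add_assoc]
      change _ + s • M _ + _ = _
      rw [hL1, Matrix.mulVec_neg, Matrix.mulVec_smul, Matrix.mulVec_mulVec, Matrix.mul_adjugate,
        Matrix.smul_mulVec, Matrix.one_mulVec, map_smul, neg_add_cancel]
    have hv0 : (⟨L v, ⟨v, rfl⟩⟩ : LinearMap.range L) = 0 :=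
      hinj (by rw [map_zero]; exact hv1)
    have hv2 : (L v).2 = 0 := congrArg (fun z : LinearMap.range L => z.1.2) hv0
    have hv3 : s • (c (-(s • (1 + s • m).adjugate.mulVec (b u))) + a ((1 + s • m).det • u)) = 0 :=
      (congrArg Prod.snd (hL _ _)).symm.trans hv2
    rw [smul_eq_zero_iff_right hs] at hv3
    have hv4 := congrArg g hv3
    rw [map_neg, map_smul, map_smul, map_add, map_neg, map_smul, map_smul, map_zero, hf,
      neg_add_eq_zero, smul_eq_mul, smul_eq_mul] at hv4
    exact hv4.symm
  refine ⟨LinearMap.ext fun u => ?_, fun i y => ?_⟩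
  · exact (Module.forall_dual_apply_eq_zero_iff K _).1 fun g => (key g u).1
  · exact (Module.forall_dual_apply_eq_zero_iff K _).1 fun g => (key g y).2 i

/-- The rank bound for a pair whose second map has the largest rank in the pencil: in suitable bases
the pair is a system with states `range B` and inputs `ker B`. -/
theorem rankDichotomy_of_finrank_range_le {V W : Type*} [AddCommGroup V] [Module K V]
    [AddCommGroup W] [Module K W] [FiniteDimensional K V] [FiniteDimensional K W]
    (hcubic : ∀ p : K[X], p.Monic → p.natDegree = 3 → ∃ b, p.IsRoot b) (A B : V →ₗ[K] W)
    (h : ∀ s : K, finrank K (LinearMap.range (B + s • A)) ≤ finrank K (LinearMap.range B)) :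
    RankDichotomy A B := by
  let β : LinearMap.range B ≃ₗ[K] (Fin (finrank K (LinearMap.range B)) → K) :=
    (finBasis K (LinearMap.range B)).equivFun
  obtain ⟨P, hP⟩ := (LinearMap.range B).exists_isCompl
  obtain ⟨σ, hσ⟩ := B.rangeRestrict.exists_rightInverse_of_surjective B.range_rangeRestrict
  replace hσ : ∀ y, B (σ y) = y := fun y => congrArg Subtype.val (LinearMap.congr_fun hσ y)
  -- The isomorphisms with states and inputs, and with states and outputs.
  let E₀ : (Fin (finrank K (LinearMap.range B)) → K) × LinearMap.ker B →ₗ[K] V :=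
    (σ ∘ₗ β.symm.toLinearMap).coprod (LinearMap.ker B).subtype
  have hE₀ : ∀ x q, E₀ (x, q) = σ (β.symm x) + q := fun x q => rfl
  have hBE : ∀ x q, B (E₀ (x, q)) = β.symm x := fun x q => by
    rw [hE₀, map_add, hσ, LinearMap.mem_ker.1 q.2, add_zero]
  have hEb : Function.Bijective E₀ := by
    refine ⟨(injective_iff_map_eq_zero E₀).2 ?_, fun v => ?_⟩
    · rintro ⟨x, q⟩ h0
      have h1 := hBE x q
      rw [h0, map_zero] at h1
      have hx : x = 0 := by simpa using h1.symm
      subst hx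
      simpa [hE₀] using h0
    · refine ⟨(β (B.rangeRestrict v), ⟨v - σ (B.rangeRestrict v), ?_⟩), ?_⟩
      · rw [LinearMap.mem_ker, map_sub, hσ]; simp
      · rw [hE₀]; simp
  let E := LinearEquiv.ofBijective E₀ hEb
  let F := ((β.symm.prodCongr (LinearEquiv.refl K P)).trans
    (Submodule.prodEquivOfIsCompl _ _ hP)).symm
  have hFB : ∀ v, F (B (E v)) = (v.1, 0) := fun v => by
    rw [LinearEquiv.symm_apply_eq]
    change B (E₀ (v.1, v.2)) = _
    rw [hBE]
    simp
  let L := F.toLinearMap ∘ₗ A ∘ₗ E.toLinearMap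
  let M := LinearMap.fst K _ _ ∘ₗ L ∘ₗ LinearMap.inl K _ _
  let b := LinearMap.fst K _ _ ∘ₗ L ∘ₗ LinearMap.inr K _ _
  let c := LinearMap.snd K _ _ ∘ₗ L ∘ₗ LinearMap.inl K _ _
  let a := LinearMap.snd K _ _ ∘ₗ L ∘ₗ LinearMap.inr K _ _
  have hL : ∀ v, F (A (E v)) = (M.coprod b).prod (c.coprod a) v := by
    rintro ⟨x, q⟩
    have h1 : L (x, q) = L (x, 0) + L (0, q) := by rw [← map_add]; simp
    exact h1
  obtain ⟨ha, hc⟩ := markov_eq_zero M b c a fun s => by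
    have h1 : sysB K _ (LinearMap.ker B) P + s • (M.coprod b).prod (c.coprod a) =
        F.toLinearMap ∘ₗ (B + s • A) ∘ₗ E.toLinearMap := by
      refine LinearMap.ext fun v => ?_
      simp only [LinearMap.add_apply, LinearMap.smul_apply, ← hL, LinearMap.comp_apply,
        LinearEquiv.coe_coe, map_add, map_smul, hFB, sysB_apply]
    rw [h1, Fintype.card_fin, LinearMap.range_comp, LinearEquiv.finrank_map_eq,
      LinearMap.range_comp, LinearEquiv.range, Submodule.map_top]
    exact h s
  refine (rankDichotomy_sys hcubic M b c hc).of_iso (PencilIso.symm ⟨E, F.symm, ?_, ?_⟩)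
  · rintro ⟨x, q⟩
    rw [LinearEquiv.symm_apply_eq, hL, ha]
    simp
  · rintro ⟨x, q⟩
    rw [LinearEquiv.symm_apply_eq, hFB]
    rfl

end Transfer

/-! ### The lower bound for the maximal rank -/

section LowerBound

variable {K : Type*} [Field K]

/-- An `m × n × 2` tensor of maximal rank when `k = n / 2` and `m ≤ n ≤ 2 * m`: the second slice
has ones on the diagonal, and the first slice has ones in the positions `(i, k + i)` with
`i < k`. -/
def extremalTensor (K : Type*) [Field K] (m n k : ℕ) : Tensor2 K (Fin m) (Fin n) :=
  ![Matrix.of fun i j => if (j : ℕ) = k + i ∧ (i : ℕ) < k then 1 else 0,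
    Matrix.of fun i j => if (i : ℕ) = j then 1 else 0]

/-- The substitution method: `k` of the simple tensors are killed by restricting to the graph of a
linear map into the first `k` coordinates of `Kⁿ`, and the remaining ones still have to generate all
the rows. -/
theorem le_of_isSumOfSimple_extremalTensor {m n k r : ℕ} (hkm : k ≤ m) (hmn : m ≤ n)
    (hkn : 2 * k ≤ n) (h : IsSumOfSimple r (extremalTensor K m n k)) : m + k ≤ r := by
  classical
  obtain ⟨a, b, c, h⟩ := h
  obtain ⟨n', rfl⟩ : ∃ n', n = k + n' := ⟨n - k, by omega⟩
  let ι : Fin k → Fin (k + n') := Fin.castAdd n'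
  let b' : Fin r → Fin k → K := fun l j => b l (ι j)
  have hspan : Submodule.span K (Set.range b') = ⊤ := by
    by_contra hne
    obtain ⟨ψ, hψ0, hψ⟩ := Submodule.exists_le_ker_of_lt_top _ (lt_top_iff_ne_top.2 hne)
    have hb : ∀ l, ∑ j, b' l j * ψ (Pi.single j 1) = 0 := fun l => by
      have h1 : ψ (b' l) = 0 := hψ (Submodule.subset_span ⟨l, rfl⟩)
      rw [ψ.pi_apply_eq_sum_univ] at h1
      rw [← h1]
      refine Finset.sum_congr rfl fun j _ => ?_
      rw [smul_eq_mul]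
      congr 2
      ext i
      simp [Pi.single_apply, eq_comm]
    refine hψ0 (LinearMap.pi_ext' fun j => LinearMap.ext_ring ?_)
    have h1 : ∑ j', extremalTensor K m (k + n') k 1 (Fin.castLE hkm j) (ι j') * ψ (Pi.single j' 1) =
        0 := by
      simp only [h, Finset.sum_mul]
      rw [Finset.sum_comm]
      refine Finset.sum_eq_zero fun l _ => ?_
      rw [← mul_zero (a l (Fin.castLE hkm j) * c l 1), ← hb l, Finset.mul_sum]
      exact Finset.sum_congr rfl fun _ _ => by ring
    simpa [extremalTensor, ι, Fin.val_inj] using h1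
  -- The vectors `b' (e x)` form a basis of the space of the first `k` columns.
  obtain ⟨κ, e, he, hesp, heli⟩ := exists_linearIndependent' K b'
  have : Finite κ := Finite.of_injective e he
  have := Fintype.ofFinite κ
  have hcard : Fintype.card κ = k := by
    have h1 := finrank_span_eq_card heli
    rw [hesp, hspan, finrank_top, finrank_fin_fun] at h1
    exact h1.symm
  by_contra hlt
  -- A functional `w` on the rows killing the simple tensors that were not chosen.
  let R := {l : Fin r // l ∉ Set.range e}
  have hR : Fintype.card R < m := by
    have h1 : Fintype.card R = r - k := by
      rw [Fintype.card_subtype_compl, Fintype.card_fin,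
        Set.card_range_of_injective he, hcard]
    omega
  let Φ : (Fin m → K) →ₗ[K] (R → K) :=
    LinearMap.pi fun l => ∑ i, a l.1 i • LinearMap.proj i
  have hΦ : ∀ w l, Φ w l = ∑ i, a l.1 i * w i := fun w l => by simp [Φ]
  obtain ⟨w, hwΦ, hw0⟩ := (LinearMap.ker Φ).exists_mem_ne_zero_of_ne_bot
    (LinearMap.ker_ne_bot_of_finrank_lt (by simpa using hR))
  have hw : ∀ l, l ∉ Set.range e → ∑ i, a l i * w i = 0 := fun l hl => by
    rw [← hΦ w ⟨l, hl⟩, LinearMap.mem_ker.1 hwΦ]; rfl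
  -- Every vector can be changed in the first `k` coordinates so that the chosen ones vanish.
  have hv : ∀ t : Fin (k + n') → K, ∃ v : Fin (k + n') → K,
      (∀ j : Fin (k + n'), k ≤ (j : ℕ) → v j = t j) ∧
      ∀ s, ∑ i, ∑ j, w i * extremalTensor K m (k + n') k s i j * v j = 0 := by
    intro t
    obtain ⟨ψ, hψ⟩ := heli.exists_dual_eq fun x => ∑ j, b (e x) (Fin.natAdd k j) * t (Fin.natAdd k j)
    let v : Fin (k + n') → K := fun j =>
      if hj : (j : ℕ) < k then -ψ (Pi.single ⟨j, hj⟩ 1) else t j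
    have hbv : ∀ x, ∑ j, b (e x) j * v j = 0 := by
      intro x
      have h1 := hψ x
      rw [ψ.pi_apply_eq_sum_univ] at h1
      have h3 : ∑ j, b (e x) (Fin.natAdd k j) * v (Fin.natAdd k j) =
          ∑ j, b (e x) (Fin.natAdd k j) * t (Fin.natAdd k j) := by simp [v]
      rw [Fin.sum_univ_add, h3, ← h1, ← Finset.sum_add_distrib]
      refine Finset.sum_eq_zero fun j _ => ?_
      have h2 : (fun i => if j = i then (1 : K) else 0) = Pi.single j 1 := by
        ext i
        simp [Pi.single_apply, eq_comm]
      simp [v, b', ι, h2]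
    refine ⟨v, fun j hj => by simp [v, hj.not_gt], fun s => ?_⟩
    have h1 : ∀ l, (∑ i, a l i * w i) * (∑ j, b l j * v j) = 0 := fun l => by
      by_cases hl : l ∈ Set.range e
      · obtain ⟨x, rfl⟩ := hl
        rw [hbv, mul_zero]
      · rw [hw l hl, zero_mul]
    have h2 : ∑ i, ∑ j, w i * extremalTensor K m (k + n') k s i j * v j =
        ∑ l, c l s * ((∑ i, a l i * w i) * ∑ j, b l j * v j) := by
      simp only [h, Finset.mul_sum, Finset.sum_mul]
      rw [Finset.sum_comm]
      conv_rhs => rw [Finset.sum_comm]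
      refine Finset.sum_congr rfl fun j _ => ?_
      rw [Finset.sum_comm]
      exact Finset.sum_congr rfl fun l _ => Finset.sum_congr rfl fun i _ => by ring
    rw [h2]
    exact Finset.sum_eq_zero fun l _ => by rw [h1, mul_zero]
  -- The first slice sees the rows `i < k`, the second slice the other ones.
  have hwk : ∀ i : Fin m, (i : ℕ) < k → w i = 0 := by
    intro i hi
    obtain ⟨v, hv1, hv2⟩ := hv (Pi.single ⟨k + i, by omega⟩ 1)
    have h1 := hv2 0
    rw [Finset.sum_eq_single i, Finset.sum_eq_single ⟨k + i, by omega⟩] at h1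
    · rw [hv1 _ (by simp)] at h1
      simpa [extremalTensor, hi] using h1
    · intro j _ hj
      have : (j : ℕ) ≠ k + i := fun h' => hj (Fin.ext h')
      simp [extremalTensor, this]
    · simp
    · intro i' _ hi'
      refine Finset.sum_eq_zero fun j _ => ?_
      by_cases hj : (j : ℕ) = k + i' ∧ (i' : ℕ) < k
      · have h3 : j ≠ ⟨k + i, by omega⟩ := fun h' => hi' (Fin.ext (by
          rw [Fin.ext_iff] at h'; dsimp only at h'; omega))
        rw [hv1 j (by omega), Pi.single_eq_of_ne h3, mul_zero]
      · simp [extremalTensor, hj]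
    · simp
  refine hw0 (funext fun i => ?_)
  by_cases hi : (i : ℕ) < k
  · exact hwk i hi
  obtain ⟨v, hv1, hv2⟩ := hv (Pi.single ⟨i, by omega⟩ 1)
  have h1 := hv2 1
  rw [Finset.sum_eq_single i, Finset.sum_eq_single ⟨i, by omega⟩] at h1
  · rw [hv1 _ (by simp; omega)] at h1
    simpa [extremalTensor] using h1
  · intro j _ hj
    have : (i : ℕ) ≠ j := fun h' => hj (Fin.ext h'.symm)
    simp [extremalTensor, this]
  · simp
  · intro i' _ hi'
    by_cases hi'k : (i' : ℕ) < k
    · simp [hwk i' hi'k]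
    refine Finset.sum_eq_zero fun j _ => ?_
    by_cases hj : (i' : ℕ) = j
    · have h3 : j ≠ ⟨i, by omega⟩ := fun h' => hi' (Fin.ext (by
        rw [Fin.ext_iff] at h'; dsimp only at h'; omega))
      rw [hv1 j (by omega), Pi.single_eq_of_ne h3, mul_zero]
    · simp [extremalTensor, hj]
  · simp

theorem add_half_le_maxRank {m n : ℕ} (hmn : m ≤ n) (hnm : n ≤ 2 * m) :
    m + n / 2 ≤ maxRank K m n :=
  (le_of_isSumOfSimple_extremalTensor (by omega) hmn (by omega)
    (isSumOfSimple_tensorRank _)).trans ((isGreatest_maxRank K m n).2 ⟨_, rfl⟩)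

theorem PencilRankLE.tensorRank_le {m n r : ℕ} {A B : Matrix (Fin m) (Fin n) K}
    (h : PencilRankLE A.mulVecLin B.mulVecLin r) : tensorRank ![A, B] ≤ r := by
  obtain ⟨w, f, c, d, hA, hB⟩ := h
  refine Nat.sInf_le ⟨w, fun l j => f l (Pi.single j 1), fun l => ![c l, d l], fun s i j => ?_⟩
  fin_cases s
  · have := congrFun (hA (Pi.single j 1)) i
    simp at this
    simp only [Fin.zero_eta, Matrix.cons_val_zero, this]
    exact Finset.sum_congr rfl fun _ _ => by ring
  · have := congrFun (hB (Pi.single j 1)) i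
    simp at this
    simp only [Fin.mk_one, Matrix.cons_val_one, Matrix.cons_val_zero, this]
    exact Finset.sum_congr rfl fun _ _ => by ring

theorem PencilRankLE.shear {V W : Type*} [AddCommGroup V] [Module K V] [AddCommGroup W]
    [Module K W] {A B : V →ₗ[K] W} {r : ℕ} (h : PencilRankLE A B r) (t : K) :
    PencilRankLE A (B - t • A) r := by
  obtain ⟨w, f, c, d, hA, hB⟩ := h
  refine ⟨w, f, c, d - t • c, hA, fun v => ?_⟩
  simp [hA, hB, Finset.smul_sum, ← Finset.sum_sub_distrib, smul_smul, ← sub_smul, sub_mul,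
    mul_assoc]

end LowerBound

/-! ### The blocks after a change of the second slice -/

section Blocks

variable {K ι κ : Type*} [Field K]

theorem TensorIso.of_det [Fintype ι] [DecidableEq ι] [Fintype κ] [DecidableEq κ]
    {S S' : Tensor2 K ι κ} (P : Matrix ι ι K) (Q : Matrix κ κ K) (hP : P.det ≠ 0) (hQ : Q.det ≠ 0)
    (h : ∀ s, P * S s = S' s * Q) : TensorIso S S' :=
  TensorIso.of_matrix P P⁻¹ Q Q⁻¹ (P.mul_nonsing_inv (isUnit_iff_ne_zero.2 hP))
    (Q.mul_nonsing_inv (isUnit_iff_ne_zero.2 hQ)) h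

theorem blockE_one : blockE K 1 = ![!![0, 1], !![1, 0]] := by
  ext s i j
  fin_cases s <;> fin_cases i <;> fin_cases j <;> simp [blockE]

theorem blockE_two : blockE K 2 = ![!![0, 1, 0; 0, 0, 1], !![1, 0, 0; 0, 1, 0]] := by
  ext s i j
  fin_cases s <;> fin_cases i <;> fin_cases j <;> simp [blockE]

theorem blockF_one : blockF K 1 = ![!![0; 1], !![1; 0]] := by
  ext s i j
  fin_cases s <;> fin_cases i <;> fin_cases j <;> simp [blockF, blockE]

theorem shiftJ_two : shiftJ K 2 = !![0, 1; 0, 0] := by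
  ext i j
  fin_cases i <;> fin_cases j <;> simp [shiftJ]

theorem shiftJ_three : shiftJ K 3 = !![0, 1, 0; 0, 0, 1; 0, 0, 0] := by
  ext i j
  fin_cases i <;> fin_cases j <;> simp [shiftJ]

theorem blockB_two (x : K) : blockB x 2 = ![!![x, 1; 0, x], !![1, 0; 0, 1]] := by
  rw [blockB, shiftJ_two, Matrix.one_fin_two]
  simp

theorem blockB_three (x : K) :
    blockB x 3 = ![!![x, 1, 0; 0, x, 1; 0, 0, x], !![1, 0, 0; 0, 1, 0; 0, 0, 1]] := by
  rw [blockB, shiftJ_three, Matrix.one_fin_three]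
  simp

theorem blockD_two : blockD K 2 = ![!![1, 0; 0, 1], !![0, 1; 0, 0]] := by
  rw [blockD, shiftJ_two, Matrix.one_fin_two]

theorem blockD_three :
    blockD K 3 = ![!![1, 0, 0; 0, 1, 0; 0, 0, 1], !![0, 1, 0; 0, 0, 1; 0, 0, 0]] := by
  rw [blockD, shiftJ_three, Matrix.one_fin_three]

theorem shear_blockE_one_tensorIso (t : K) : TensorIso (shear t (blockE K 1)) (blockE K 1) := by
  refine TensorIso.symm (TensorIso.of_det 1 !![1, t; 0, 1] (by simp) (by simp) fun s => ?_)
  fin_cases s <;> ext i j <;> fin_cases i <;> fin_cases j <;>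
    simp [blockE_one, shear, Matrix.mul_apply, Fin.sum_univ_succ]

theorem shear_blockE_two_tensorIso (t : K) : TensorIso (shear t (blockE K 2)) (blockE K 2) := by
  refine TensorIso.symm (TensorIso.of_det !![1, t; 0, 1]
    !![1, 2 * t, t ^ 2; 0, 1, t; 0, 0, 1] (by simp) (by simp [Matrix.det_fin_three]) fun s => ?_)
  fin_cases s <;> ext i j <;> fin_cases i <;> fin_cases j <;>
    simp [blockE_two, shear, Matrix.mul_apply, Fin.sum_univ_succ] <;> ring

theorem shear_blockF_one_tensorIso (t : K) : TensorIso (shear t (blockF K 1)) (blockF K 1) := by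
  refine TensorIso.symm (TensorIso.of_det !![1, 0; -t, 1] 1 (by simp) (by simp) fun s => ?_)
  fin_cases s <;> ext i j <;> fin_cases i <;> fin_cases j <;>
    simp [blockF_one, shear, Matrix.mul_apply, Fin.sum_univ_succ]

/-- The pair `(x; 1 - t x)` is a multiple of `(y; 1)`, or of `(1; 0)` if `t x = 1`. -/
theorem shear_linear_tensorIso (t x : K) :
    (∃ y, TensorIso (shear t ![!![x], !![1]]) ![!![y], !![1]]) ∨
      TensorIso (shear t ![!![x], !![1]]) ![!![1], !![0]] := by
  by_cases hw : 1 - t * x = 0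
  · have hx : x ≠ 0 := by rintro rfl; simp at hw
    refine Or.inr (TensorIso.symm (TensorIso.of_det !![x] 1 (by simpa) (by simp) fun s => ?_))
    fin_cases s <;> ext i j <;> fin_cases i <;> fin_cases j <;> simp [shear, hw]
  · refine Or.inl ⟨x / (1 - t * x), TensorIso.symm
      (TensorIso.of_det !![1 - t * x] 1 (by simpa) (by simp) fun s => ?_)⟩
    fin_cases s <;> ext i j <;> fin_cases i <;> fin_cases j <;>
      simp [shear, Matrix.mul_apply]
    field_simp

/-- If `w = 1 - t x` is not zero, then the second slice `w E₂ - t J₂` is invertible, and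
`(x E₂ + J₂) (w E₂ - t J₂)⁻¹` is one Jordan block with eigenvalue `x / w`. -/
theorem shear_blockB_two_tensorIso {t x : K} (hw : 1 - t * x ≠ 0) :
    TensorIso (shear t (blockB x 2)) (blockB (x / (1 - t * x)) 2) := by
  set w := 1 - t * x with hwd
  refine TensorIso.symm (TensorIso.of_det !![w, -t * w ^ 2; 0, w ^ 3] !![1, 0; 0, w ^ 2]
    (by simp [hw]) (by simp [hw]) fun s => ?_)
  fin_cases s <;> ext i j <;> fin_cases i <;> fin_cases j <;>
    simp [blockB_two, shear, Matrix.mul_apply, Fin.sum_univ_succ] <;>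
    field_simp <;> rw [hwd] <;> ring

theorem shear_blockB_three_tensorIso {t x : K} (hw : 1 - t * x ≠ 0) :
    TensorIso (shear t (blockB x 3)) (blockB (x / (1 - t * x)) 3) := by
  set w := 1 - t * x with hwd
  refine TensorIso.symm (TensorIso.of_det
    !![w, -t * w ^ 2, t ^ 2 * w ^ 3; 0, w ^ 3, -2 * t * w ^ 4; 0, 0, w ^ 5]
    !![1, 0, 0; 0, w ^ 2, -t * w ^ 3; 0, 0, w ^ 4]
    (by simp [Matrix.det_fin_three, hw]) (by simp [Matrix.det_fin_three, hw]) fun s => ?_)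
  fin_cases s <;> ext i j <;> fin_cases i <;> fin_cases j <;>
    simp [blockB_three, shear, Matrix.mul_apply, Fin.sum_univ_succ] <;>
    field_simp <;> rw [hwd] <;> ring

/-- If `t x = 1`, then the first slice is invertible and the second one is `-t J₂`. -/
theorem shear_blockB_two_tensorIso_blockD {t x : K} (hw : 1 - t * x = 0) :
    TensorIso (shear t (blockB x 2)) (blockD K 2) := by
  have hx : x ≠ 0 := by rintro rfl; simp at hw
  obtain rfl : t = x⁻¹ := by field_simp; linear_combination -hw
  refine TensorIso.symm (TensorIso.of_det !![x, -x ^ 2; 0, -x ^ 3] !![1, 0; 0, -x ^ 2]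
    (by simp [hx]) (by simp [hx]) fun s => ?_)
  fin_cases s <;> ext i j <;> fin_cases i <;> fin_cases j <;>
    simp [blockB_two, blockD_two, shear, Matrix.mul_apply, Fin.sum_univ_succ, hx] <;> field_simp

theorem shear_blockB_three_tensorIso_blockD {t x : K} (hw : 1 - t * x = 0) :
    TensorIso (shear t (blockB x 3)) (blockD K 3) := by
  have hx : x ≠ 0 := by rintro rfl; simp at hw
  obtain rfl : t = x⁻¹ := by field_simp; linear_combination -hw
  refine TensorIso.symm (TensorIso.of_det
    !![x, -x ^ 2, x ^ 3; 0, -x ^ 3, 2 * x ^ 4; 0, 0, x ^ 5]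
    !![1, 0, 0; 0, -x ^ 2, x ^ 3; 0, 0, x ^ 4]
    (by simp [Matrix.det_fin_three, hx]) (by simp [Matrix.det_fin_three, hx]) fun s => ?_)
  fin_cases s <;> ext i j <;> fin_cases i <;> fin_cases j <;>
    simp [blockB_three, blockD_three, shear, Matrix.mul_apply, Fin.sum_univ_succ, hx] <;>
    field_simp <;> ring

/-- The matrices `C_1(c, s)` multiply like the numbers `c + i s`, and the new parameters are those of
`(c + i s) / (1 - t (c + i s))`; the denominator is the norm of `1 - t (c + i s)`. -/
theorem shear_blockC_tensorIso {t c s : K} (hD : (1 - t * c) ^ 2 + t ^ 2 * s ^ 2 ≠ 0) :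
    TensorIso (shear t (blockC c s))
      (blockC ((c - t * (c ^ 2 + s ^ 2)) / ((1 - t * c) ^ 2 + t ^ 2 * s ^ 2))
        (s / ((1 - t * c) ^ 2 + t ^ 2 * s ^ 2))) := by
  refine TensorIso.symm (TensorIso.of_det !![1 - t * c, t * s; -t * s, 1 - t * c] 1
    (by rw [Matrix.det_fin_two_of]; convert hD using 1; ring) (by simp) fun k => ?_)
  fin_cases k <;> ext i j <;> fin_cases i <;> fin_cases j <;>
    simp [blockC, shear, Matrix.mul_apply, Fin.sum_univ_succ, Matrix.one_apply] <;>
    field_simp <;> ring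
end Blocks

/-! ### Undoing the change of the second slice -/

section ShearSum

variable {K ι κ ι' κ' ι₁ κ₁ ι₂ κ₂ : Type*} [Field K]
  [Fintype κ] [Fintype κ'] [Fintype ι₁] [Fintype κ₁] [Fintype κ₂]

theorem shear_dsum_tensorIso [Fintype ι] [Fintype ι'] [Fintype ι₂] {t : K} {S : Tensor2 K ι κ} {S' : Tensor2 K ι' κ'}
    {T : Tensor2 K ι₁ κ₁} {T' : Tensor2 K ι₂ κ₂} (h : TensorIso (shear t S) T)
    (h' : TensorIso (shear t S') T') : TensorIso (shear t (dsum S S')) (dsum T T') := by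
  rw [shear_dsum]
  exact h.dsum h'

theorem shear_copies_tensorIso [Fintype ι] {t : K} {S : Tensor2 K ι κ} {T : Tensor2 K ι₁ κ₁}
    (h : TensorIso (shear t S) T) (a : ℕ) : TensorIso (shear t (copies a S)) (copies a T) := by
  rw [shear_copies]
  exact h.copies a

/-- A form of `(A; B + t A)` gives a form of `(A; B)`. -/
theorem tensorEquivalent_of_pencilRep_shear {m n : ℕ} {A B : Matrix (Fin m) (Fin n) K} {t : K}
    {S : Tensor2 K ι κ} {T : Tensor2 K ι₁ κ₁}
    (h : PencilRep A.mulVecLin (B.mulVecLin + t • A.mulVecLin) S) (hS : TensorIso (shear t S) T) :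
    TensorEquivalent ![A, B] T := by
  have h1 := h.shear t
  rw [add_sub_cancel_right] at h1
  exact TensorIso.tensorEquivalent (S := ![A, B]) (PencilRep.trans h1 hS)

theorem compBlock_tensorIso_blockC {g : K[X]} {c s : K} (hs : s ≠ 0)
    (h0 : g.coeff 0 = c ^ 2 + s ^ 2) (h1 : g.coeff 1 = -(2 * c)) :
    TensorIso (compBlock g) (blockC c s) := by
  refine TensorIso.symm (TensorIso.of_det !![1, -c / s; 0, 1 / s] !![1, -c / s; 0, 1 / s]
    (by simp [hs]) (by simp [hs]) fun k => ?_)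
  fin_cases k <;> ext i j <;> fin_cases i <;> fin_cases j <;>
    simp [blockC, compBlock, h0, h1, Matrix.one_fin_two, Matrix.mul_apply,
      Fin.sum_univ_succ] <;>
    field_simp <;> ring

end ShearSum

/-! ### The real and the complex field -/

section RCLike

variable {𝕜 : Type*} [RCLike 𝕜]

/-- Irreducible real polynomials have degree at most two, so that a real cubic has a root. -/
theorem RCLike.exists_isRoot_of_natDegree_eq_three (p : 𝕜[X]) (hp : p.Monic)
    (h3 : p.natDegree = 3) : ∃ b, p.IsRoot b := by
  have key : ∀ {F : Type} [Field F] (e : 𝕜 ≃+* F),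
      (∀ q : F[X], q.Monic → q.natDegree = 3 → ∃ b, q.IsRoot b) → ∃ b, p.IsRoot b := by
    intro F _ e hF
    obtain ⟨b, hb⟩ := hF (p.map e.toRingHom) (hp.map _) (by rw [hp.natDegree_map, h3])
    refine ⟨e.symm b, e.injective ?_⟩
    rw [IsRoot.def, eval_map, ← e.apply_symm_apply b] at hb
    rw [map_zero, ← hb]
    exact (eval₂_at_apply (e : 𝕜 →+* F) (e.symm b)).symm
  rcases RCLike.I_eq_zero_or_im_I_eq_one (K := 𝕜) with h | h
  · refine key (RCLike.realRingEquiv h) fun q hq hq3 => ?_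
    have hirr : ¬ Irreducible q := fun hi => by
      have := hi.natDegree_le_two
      omega
    rw [hq.irreducible_iff_roots_eq_zero_of_degree_le_three (by omega) hq3.le] at hirr
    obtain ⟨b, hb⟩ := Multiset.exists_mem_of_ne_zero hirr
    exact ⟨b, isRoot_of_mem_roots hb⟩
  · exact key (RCLike.complexRingEquiv h) fun q hq hq3 =>
      IsAlgClosed.exists_root q fun h0 => by
        have := natDegree_eq_zero_iff_degree_le_zero.2 h0.le
        omega

/-- Every complex number is a square; a real number is a square or the negative of a nonzero square. -/
theorem RCLike.eq_mul_self_or_neg_eq_mul_self (D : 𝕜) : (∃ d, D = d * d) ∨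
    (RCLike.I : 𝕜) = 0 ∧ ∃ s, s ≠ 0 ∧ -D = s * s := by
  rcases RCLike.I_eq_zero_or_im_I_eq_one (K := 𝕜) with h | h
  · let e := RCLike.realRingEquiv h
    rcases le_or_gt 0 (e D) with hD | hD
    · exact Or.inl ⟨e.symm (√(e D)), e.injective (by simp [Real.mul_self_sqrt hD])⟩
    · refine Or.inr ⟨h, e.symm (√(-e D)), ?_, e.injective ?_⟩
      · have := Real.sqrt_pos.2 (neg_pos.2 hD)
        simpa using this.ne'
      · simp [Real.mul_self_sqrt (neg_pos.2 hD).le]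
  · let e := RCLike.complexRingEquiv h
    obtain ⟨z, hz⟩ := IsAlgClosed.exists_pow_nat_eq (e D) (n := 2) (by norm_num)
    exact Or.inl ⟨e.symm z, e.injective (by rw [map_mul, e.apply_symm_apply, ← hz, pow_two])⟩

theorem RCLike.add_sq_ne_zero_of_I_eq_zero (h : (RCLike.I : 𝕜) = 0) {a b : 𝕜}
    (hab : a ≠ 0 ∨ b ≠ 0) : a ^ 2 + b ^ 2 ≠ 0 := by
  let e := RCLike.realRingEquiv h
  intro h0
  have h1 := congrArg e h0
  rw [map_add, map_pow, map_pow, map_zero] at h1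
  have ha : e a = 0 := by nlinarith [sq_nonneg (e a), sq_nonneg (e b)]
  have hb : e b = 0 := by nlinarith [sq_nonneg (e a), sq_nonneg (e b)]
  simp at ha hb
  simp [ha, hb] at hab

/-- A quadratic polynomial without two distinct roots is a square or, over the real field, has the roots
`c ± i s` with `s ≠ 0`. -/
theorem BadQuadratic.eq_sq_or {g : 𝕜[X]} (hg : BadQuadratic g) :
    (∃ x, g = (X - C x) * (X - C x)) ∨ (RCLike.I : 𝕜) = 0 ∧
      ∃ c s, s ≠ 0 ∧ g.coeff 0 = c ^ 2 + s ^ 2 ∧ g.coeff 1 = -(2 * c) := by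
  obtain ⟨hm, h2, hlin⟩ := hg
  have hlead : g.coeff 2 = 1 := by rw [← h2]; exact hm
  have hgX : g = X ^ 2 + C (g.coeff 1) * X + C (g.coeff 0) := by
    conv_lhs => rw [g.as_sum_range_C_mul_X_pow, h2]
    simp [Finset.sum_range_succ, hlead]
    ring
  obtain ⟨c, hc⟩ : ∃ c, g.coeff 1 = -(2 * c) := ⟨-g.coeff 1 / 2, by ring⟩
  rcases RCLike.eq_mul_self_or_neg_eq_mul_self (c ^ 2 - g.coeff 0) with ⟨d, hd⟩ | ⟨h, s, hs, hd⟩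
  · have h0 : g.coeff 0 = (c + d) * (c - d) := by linear_combination -hd
    have h1 : g = (X - C (c + d)) * (X - C (c - d)) := by
      rw [hgX, h0, hc]
      simp only [map_add, map_sub, map_mul, map_neg, map_ofNat]
      ring
    exact Or.inl ⟨c + d, by rwa [← hlin _ _ h1] at h1⟩
  · exact Or.inr ⟨h, c, s, hs, by linear_combination hd, hc⟩

theorem shear_blockB_two_isYBlock (t x : 𝕜) :
    ∃ Y, IsYBlock Y ∧ TensorIso (shear t (blockB x 2)) Y := by
  by_cases hw : 1 - t * x = 0
  · exact ⟨_, Or.inr (Or.inl rfl), shear_blockB_two_tensorIso_blockD hw⟩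
  · exact ⟨_, Or.inl ⟨_, rfl⟩, shear_blockB_two_tensorIso hw⟩

/-- The blocks of the normal form stay admissible when the change of the second slice is undone. -/
theorem BadQuadratic.shear_compBlock {g : 𝕜[X]} (hg : BadQuadratic g) (t : 𝕜) :
    ∃ Y, IsYBlock Y ∧ TensorIso (shear t (compBlock g)) Y := by
  rcases hg.eq_sq_or with ⟨x, rfl⟩ | ⟨h, c, s, hs, h0, h1⟩
  · obtain ⟨Y, hY, hiso⟩ := shear_blockB_two_isYBlock t x
    exact ⟨Y, hY, ((compBlock_sq_tensorIso x).shear t).trans hiso⟩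
  · have hD : (1 - t * c) ^ 2 + t ^ 2 * s ^ 2 ≠ 0 := by
      rw [← mul_pow]
      refine RCLike.add_sq_ne_zero_of_I_eq_zero h ?_
      by_cases ht : t = 0
      · exact Or.inl (by simp [ht])
      · exact Or.inr (mul_ne_zero ht hs)
    exact ⟨_, Or.inr (Or.inr ⟨h, _, _, div_ne_zero hs hD, rfl⟩),
      ((compBlock_tensorIso_blockC hs h0 h1).shear t).trans (shear_blockC_tensorIso hD)⟩

/-- The rank bound for all pairs, by passing to a map `B + t A` of the largest rank. -/
theorem exists_rankDichotomy {V W : Type*} [AddCommGroup V] [Module 𝕜 V]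
    [AddCommGroup W] [Module 𝕜 W] [FiniteDimensional 𝕜 V] [FiniteDimensional 𝕜 W]
    (A B : V →ₗ[𝕜] W) : ∃ t : 𝕜, RankDichotomy A (B + t • A) := by
  let f : 𝕜 → ℕ := fun t => finrank 𝕜 (LinearMap.range (B + t • A))
  have hb : BddAbove (Set.range f) := ⟨finrank 𝕜 W, by
    rintro _ ⟨t, rfl⟩
    exact Submodule.finrank_le _⟩
  obtain ⟨t, ht⟩ := Nat.sSup_mem (Set.range_nonempty f) hb
  refine ⟨t, rankDichotomy_of_finrank_range_le RCLike.exists_isRoot_of_natDegree_eq_three _ _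
    fun s => ?_⟩
  rw [add_assoc, ← add_smul]
  exact (le_csSup hb ⟨t + s, rfl⟩).trans ht.ge

/-- The rank of `(A; B)` equals that of `(A; B + t A)`, so that the bound passes to `(A; B)`, and the
forms are known for `(A; B + t A)`. -/
theorem exists_tensorRank_le {m n : ℕ} (A B : Matrix (Fin m) (Fin n) 𝕜) :
    ∃ (r e : ℕ) (t : 𝕜), tensorRank ![A, B] ≤ r ∧ 2 * r + e = 2 * m + n ∧
      (e = 0 → MaximalForm A.mulVecLin (B.mulVecLin + t • A.mulVecLin)) ∧
      (e = 1 → SubmaximalForm A.mulVecLin (B.mulVecLin + t • A.mulVecLin)) := by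
  obtain ⟨t, r, e, hr, he, h0, h1⟩ := exists_rankDichotomy A.mulVecLin B.mulVecLin
  rw [finrank_fin_fun, finrank_fin_fun] at he
  refine ⟨r, e, t, PencilRankLE.tensorRank_le ?_, he, h0, h1⟩
  simpa using hr.shear t

theorem maxRank_eq {m n : ℕ} (hmn : m ≤ n) (hnm : n ≤ 2 * m) : maxRank 𝕜 m n = m + n / 2 := by
  refine le_antisymm ?_ (add_half_le_maxRank hmn hnm)
  obtain ⟨T, hT⟩ := (isGreatest_maxRank 𝕜 m n).1
  obtain ⟨r, e, -, hr, he, -⟩ := exists_tensorRank_le (T 0) (T 1)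
  have : ![T 0, T 1] = T := by ext s; fin_cases s <;> rfl
  rw [this, hT] at hr
  omega

theorem MaximalForm.exists_tensorEquivalent {m n : ℕ} {A B : Matrix (Fin m) (Fin n) 𝕜} {t : 𝕜}
    (h : MaximalForm A.mulVecLin (B.mulVecLin + t • A.mulVecLin)) :
    ∃ (α ℓ : ℕ) (Y : Tensor2 𝕜 (Fin 2) (Fin 2)), IsYBlock Y ∧
      TensorEquivalent ![A, B] (dsum (copies α Y) (copies ℓ (blockE 𝕜 1))) := by
  obtain ⟨g, α, ℓ, hg, h⟩ := h
  obtain ⟨Y, hY, hiso⟩ := hg.shear_compBlock t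
  exact ⟨α, ℓ, Y, hY, tensorEquivalent_of_pencilRep_shear h (shear_dsum_tensorIso
    (shear_copies_tensorIso hiso α) (shear_copies_tensorIso (shear_blockE_one_tensorIso t) ℓ))⟩

end RCLike

end

theorem mainTheorem7 {𝕜 : Type*} [RCLike 𝕜] (m n : ℕ) (hmn : m ≤ n) (hnm : n ≤ 2 * m)
    (A B : Matrix (Fin m) (Fin n) 𝕜) (hrank : tensorRank ![A, B] = maxRank 𝕜 m n) :
    maxRank 𝕜 m n = min (min (n + m / 2) (m + n / 2)) (min (2 * m) (2 * n)) ∧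
    (Even n → ∃ (α ℓ : ℕ) (Y : Tensor2 𝕜 (Fin 2) (Fin 2)), IsYBlock Y ∧
      TensorEquivalent ![A, B] (dsum (copies α Y) (copies ℓ (blockE 𝕜 1)))) ∧
    (Odd n →
      -- (i)
      (∃ (α ℓ : ℕ) (Y : Tensor2 𝕜 (Fin 2) (Fin 2)), IsYBlock Y ∧
        TensorEquivalent ![A, B]
          (dsum (dsum (copies α Y) (copies ℓ (blockE 𝕜 1))) (0 : Tensor2 𝕜 (Fin 0) (Fin 1)))) ∨
      -- (ii)
      (∃ (α ℓ : ℕ) (Y : Tensor2 𝕜 (Fin 2) (Fin 2)), IsYBlock Y ∧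
        TensorEquivalent ![A, B]
          (dsum (dsum (copies α Y) (copies ℓ (blockE 𝕜 1))) (blockF 𝕜 1))) ∨
      -- (iii)
      (∃ (α ℓ : ℕ) (Y : Tensor2 𝕜 (Fin 2) (Fin 2)) (x : 𝕜), IsYBlock Y ∧
        TensorEquivalent ![A, B]
          (dsum (dsum (copies α Y) (copies ℓ (blockE 𝕜 1))) ![!![x], !![1]])) ∨
      -- (iv)
      (∃ (α ℓ : ℕ) (Y : Tensor2 𝕜 (Fin 2) (Fin 2)), IsYBlock Y ∧
        TensorEquivalent ![A, B]
          (dsum (dsum (copies α Y) (copies ℓ (blockE 𝕜 1))) ![!![1], !![0]])) ∨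
      -- (v)
      (∃ (α ℓ : ℕ) (x : 𝕜), 1 ≤ α ∧
        TensorEquivalent ![A, B]
          (dsum (dsum (copies (α - 1) (blockB x 2)) (blockB x 3)) (copies ℓ (blockE 𝕜 1)))) ∨
      -- (vi)
      (∃ α ℓ : ℕ, 1 ≤ α ∧
        TensorEquivalent ![A, B]
          (dsum (dsum (copies (α - 1) (blockD 𝕜 2)) (blockD 𝕜 3)) (copies ℓ (blockE 𝕜 1)))) ∨
      -- (vii)
      (∃ (α ℓ : ℕ) (Y : Tensor2 𝕜 (Fin 2) (Fin 2)), IsYBlock Y ∧ 1 ≤ ℓ ∧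
        TensorEquivalent ![A, B]
          (dsum (dsum (copies α Y) (copies (ℓ - 1) (blockE 𝕜 1))) (blockE 𝕜 2)))) := by
  have hmax : maxRank 𝕜 m n = m + n / 2 := maxRank_eq hmn hnm
  obtain ⟨r, e, t, hr, he, h0, h1⟩ := exists_tensorRank_le A B
  rw [hrank, hmax] at hr
  refine ⟨by omega, fun hn => ?_, fun hn => ?_⟩
  · obtain ⟨k, rfl⟩ := hn
    exact (h0 (by omega)).exists_tensorEquivalent
  · obtain ⟨k, rfl⟩ := hn
    have hE := fun ℓ => shear_copies_tensorIso (shear_blockE_one_tensorIso t) ℓ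
    rcases h1 (by omega) with ⟨g, α, ℓ, hg, h⟩ | ⟨α, ℓ, x, h⟩
    · obtain ⟨Y, hY, hiso⟩ := hg.shear_compBlock t
      have hYE := shear_dsum_tensorIso (shear_copies_tensorIso hiso α) (hE ℓ)
      rcases h with h | h | ⟨x, h⟩ | h
      · refine Or.inl ⟨α, ℓ, Y, hY, tensorEquivalent_of_pencilRep_shear h
          (shear_dsum_tensorIso hYE ?_)⟩
        rw [Subsingleton.elim (shear t 0) 0]
        exact TensorIso.refl _
      · exact Or.inr (Or.inl ⟨α, ℓ, Y, hY, tensorEquivalent_of_pencilRep_shear h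
          (shear_dsum_tensorIso hYE (shear_blockF_one_tensorIso t))⟩)
      · rcases shear_linear_tensorIso t x with ⟨y, hy⟩ | hy
        · exact Or.inr (Or.inr (Or.inl ⟨α, ℓ, Y, y, hY, tensorEquivalent_of_pencilRep_shear h
            (shear_dsum_tensorIso hYE hy)⟩))
        · exact Or.inr (Or.inr (Or.inr (Or.inl ⟨α, ℓ, Y, hY,
            tensorEquivalent_of_pencilRep_shear h (shear_dsum_tensorIso hYE hy)⟩)))
      · exact Or.inr (Or.inr (Or.inr (Or.inr (Or.inr (Or.inr ⟨α, ℓ + 1, Y, hY, by omega,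
          tensorEquivalent_of_pencilRep_shear h
            (shear_dsum_tensorIso hYE (shear_blockE_two_tensorIso t))⟩)))))
    · by_cases hw : 1 - t * x = 0
      · exact Or.inr (Or.inr (Or.inr (Or.inr (Or.inr (Or.inl ⟨α + 1, ℓ, by omega,
          tensorEquivalent_of_pencilRep_shear h (shear_dsum_tensorIso (shear_dsum_tensorIso
            (shear_copies_tensorIso (shear_blockB_two_tensorIso_blockD hw) α)
            (shear_blockB_three_tensorIso_blockD hw)) (hE ℓ))⟩)))))
      · exact Or.inr (Or.inr (Or.inr (Or.inr (Or.inl ⟨α + 1, ℓ, x / (1 - t * x), by omega,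
          tensorEquivalent_of_pencilRep_shear h (shear_dsum_tensorIso (shear_dsum_tensorIso
            (shear_copies_tensorIso (shear_blockB_two_tensorIso hw) α)
            (shear_blockB_three_tensorIso hw)) (hE ℓ))⟩))))
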